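/- **Theorem 3.1.** Let $n\ge 3$ be an integer, $p>1$, $c_1,c_2>0$, and let $u,v:\mathbb R^n\to(0,\infty)$ satisfy, for every $x\in\mathbb R^n$, $$u(x)=c_1\int_{\mathbb R^n}\frac{u^{p-1}(y)\,v(y)}{|x-y|^{n-2}}\,dy,\qquad v(x)=c_2\int_{\mathbb R^n}\frac{u^{p}(y)}{|x-y|^{n-2}}\,dy .$$ Suppose that $u\in L^{\frac{n(p-1)}2}(\mathbb R^n)$. Then: (R1) $u,v\in L^s(\mathbb R^n)$ for every real $s>\frac n{n-2}$, and $u\notin L^s(\mathbb R^n)$, $v\notin L^s(\mathbb R^n)$ for every $0<s\le\frac n{n-2}$; (R2) $u$ and $v$ are bounded, and $\lim_{|x|\to\infty}u(x)=\lim_{|x|\to\infty}v(x)=0$; (R3) there is a point $x^*\in\mathbb R^n$ such that both $u$ and $v$ are radially symmetric about $x^*$ and strictly decreasing in $|x-x^*|$. -/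

import Mathlib

open MeasureTheory Filter Topology

/-- `u, v` are positive functions on `ℝⁿ` solving, at every point `x`,
`u(x) = c₁ ∫ u(y)^(p-1) v(y) / |x-y|^(n-2) dy` and `v(x) = c₂ ∫ u(y)^p / |x-y|^(n-2) dy`
(used for `n ≥ 3`, where the natural-number exponent `n - 2` is the true one).
Since the left-hand sides are nonzero, both integrals are genuine convergent integrals for every
`x`: the Bochner integral of a non-integrable function is `0`. -/
structure IsPositiveSolution (n : ℕ) (p c₁ c₂ : ℝ) (u v : EuclideanSpace ℝ (Fin n) → ℝ) :
    Prop where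
  u_pos : ∀ x, 0 < u x
  v_pos : ∀ x, 0 < v x
  u_eq : ∀ x, u x = c₁ * ∫ y, u y ^ (p - 1) * v y / ‖x - y‖ ^ (n - 2)
  v_eq : ∀ x, v x = c₂ * ∫ y, u y ^ p / ‖x - y‖ ^ (n - 2)

/-- `w` is radially symmetric about `a` and (strictly) decreasing in the distance to `a`. -/
def IsRadialDecreasingAbout {n : ℕ} (w : EuclideanSpace ℝ (Fin n) → ℝ)
    (a : EuclideanSpace ℝ (Fin n)) : Prop :=
  (∀ x y, ‖x - a‖ = ‖y - a‖ → w x = w y) ∧ (∀ x y, ‖x - a‖ < ‖y - a‖ → w y < w x)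

/-! Let I denote convolution with |x|^(2-n), so that u = c₁ I(u^(p-1) v) and v = c₂ I(u^p). A
positive source has positive mass in the unit ball, hence u and v are at least c (1+|x|)^(2-n)
(`exists_le_pot`), and this excludes L^s for s ≤ n/(n-2). Applied to the integrability hypothesis on
u, the same bound forces n(p-1)/2 > n/(n-2), that is (n-2)(p-1) > 2; the exponents below are chosen
from this strict inequality.

Integrability. W = u + v satisfies W ≤ C I(W^(p-1) W) with W^(p-1) in L^(n/2). By Hölder and
Hardy–Littlewood–Sobolev (`exists_Lp_pot_le`), g ↦ I(V g) is bounded on L^s for s > n/(n-2), with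
norm at most a multiple of the L^(n/2) norm of V. If V is the part of W^(p-1) where W or |y| is
large, this map is a contraction both on the critical space and on L^s, and the remaining source is
bounded with bounded support. Regularity lifting (`lpn_lt_top_of_le_contraction`) then puts W in
L^s.

Decay. Since W^p lies in Lebesgue spaces on both sides of n/2, W is bounded. Absorbing I(V W) once
more, now pointwise with the weight (1+|x|)^(-θ), n/p < θ < n-2, gives decay of order θ. As θp > n,
one more use of the inequality yields the kernel rate (1+|x|)^(2-n) (`exists_le_bracket_of_le_pot`).
Boundedness, vanishing at infinity, continuity and v ≤ C u follow.

Symmetry. This is the method of moving planes in integral form. The excess of u and v over their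
reflections is bounded by a potential of itself over the set where it is positive; when that set is
negligible, the excess halves repeatedly and vanishes (`eventually_dominated`). The plane therefore
starts at infinity and moves until the functions agree with their reflections (`exists_symmetric`).
Strictness beyond that plane places every plane of symmetry through a maximum point of u, and
perpendicular bisectors turn this into radial symmetry and strict monotonicity. -/

open scoped ENNReal

/-! ### Kernel integrals and the Hardy–Littlewood–Sobolev inequality -/

namespace RieszPotential

/-- Euclidean space of dimension `n`. -/
abbrev Euc (n : ℕ) := EuclideanSpace ℝ (Fin n)

variable {n : ℕ}

/-- The kernel `‖z‖ ^ (-κ)`, with values in `ℝ≥0∞`. -/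
noncomputable def ker (κ : ℝ) (z : Euc n) : ℝ≥0∞ := ENNReal.ofReal (‖z‖ ^ (-κ))

@[fun_prop]
lemma measurable_ker (κ : ℝ) : Measurable (ker κ : Euc n → ℝ≥0∞) := by
  unfold ker; fun_prop

lemma ker_neg (κ : ℝ) (z : Euc n) : ker κ (-z) = ker κ z := by simp [ker]

lemma ker_sub_comm (κ : ℝ) (x y : Euc n) : ker κ (x - y) = ker κ (y - x) := by
  rw [← ker_neg, neg_sub]

lemma ker_rpow (κ s : ℝ) (hs : 0 ≤ s) (z : Euc n) : ker κ z ^ s = ker (κ * s) z := by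
  unfold ker
  rw [ENNReal.ofReal_rpow_of_nonneg (by positivity) hs, ← Real.rpow_mul (norm_nonneg _)]
  ring_nf

/-- Integral over a ball of a power of the norm which is locally integrable. -/
lemma setLIntegral_ball_ker (hn : 0 < n) {κ : ℝ} (hκ : κ < n) :
    ∃ A : ℝ, 0 ≤ A ∧ ∀ R : ℝ, 0 < R →
      ∫⁻ z in Metric.ball (0 : Euc n) R, ker κ z = ENNReal.ofReal (A * R ^ (n - κ)) := by
  have : Nontrivial (Euc n) := by
    have : Nonempty (Fin n) := ⟨⟨0, hn⟩⟩
    infer_instance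
  refine ⟨n * (volume.real (Metric.ball (0 : Euc n) 1)) * (1 / (n - κ)), ?_, fun R hR => ?_⟩
  · have : 0 < n - κ := by linarith
    positivity
  have hfun : ∀ z : Euc n, (Metric.ball (0 : Euc n) R).indicator (fun z => ‖z‖ ^ (-κ)) z =
      (Set.Iio R).indicator (fun t : ℝ => t ^ (-κ)) ‖z‖ := by
    intro z; simp [Set.indicator]
  have hone : ∀ t ∈ Set.Ioi (0 : ℝ),
      t ^ (Module.finrank ℝ (Euc n) - 1) • (Set.Iio R).indicator (fun t : ℝ => t ^ (-κ)) t =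
      (Set.Iio R).indicator (fun t : ℝ => t ^ (n - 1 - κ)) t := by
    intro t ht
    have ht : 0 < t := ht
    simp only [Set.indicator, finrank_euclideanSpace, Fintype.card_fin, smul_eq_mul]
    split_ifs
    · rw [← Real.rpow_natCast, ← Real.rpow_add ht, Nat.cast_pred hn]; ring_nf
    · simp
  have hint1 : IntegrableOn (fun t : ℝ => t ^ (n - 1 - κ)) (Set.Ioo 0 R) := by
    rw [intervalIntegral.integrableOn_Ioo_rpow_iff hR]; linarith
  have hint : Integrable (fun z : Euc n => (Set.Iio R).indicator (fun t : ℝ => t ^ (-κ)) ‖z‖) := by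
    rw [integrable_fun_norm_addHaar volume (f := (Set.Iio R).indicator (fun t : ℝ => t ^ (-κ))),
      integrableOn_congr_fun hone measurableSet_Ioi, IntegrableOn,
      integrable_indicator_iff measurableSet_Iio, IntegrableOn,
      Measure.restrict_restrict measurableSet_Iio]
    rwa [Set.inter_comm, Set.Ioi_inter_Iio]
  have hval := integral_fun_norm_addHaar (volume : Measure (Euc n))
    ((Set.Iio R).indicator (fun t : ℝ => t ^ (-κ)))
  rw [setIntegral_congr_fun measurableSet_Ioi hone, setIntegral_indicator measurableSet_Iio,
    Set.Ioi_inter_Iio, ← integral_Ioc_eq_integral_Ioo, ← intervalIntegral.integral_of_le hR.le,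
    integral_rpow (Or.inl (by linarith))] at hval
  rw [← lintegral_indicator Metric.isOpen_ball.measurableSet]
  have : ∀ z : Euc n, (Metric.ball (0 : Euc n) R).indicator (ker κ) z =
      ENNReal.ofReal ((Set.Iio R).indicator (fun t : ℝ => t ^ (-κ)) ‖z‖) := by
    intro z
    rw [← hfun]; unfold ker Set.indicator; split_ifs <;> simp
  simp_rw [this]
  rw [← ofReal_integral_eq_lintegral_ofReal hint, hval]
  · congr 1
    simp only [finrank_euclideanSpace, Fintype.card_fin, nsmul_eq_mul, smul_eq_mul]
    rw [Real.zero_rpow (by linarith)]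
    have h1 : (n : ℝ) - 1 - κ + 1 = n - κ := by ring
    rw [h1]; ring
  · filter_upwards with z
    simp only [Set.indicator]; split_ifs <;> simp; positivity

/-- Integral over the complement of a ball of a power of the norm integrable at infinity. -/
lemma setLIntegral_compl_ball_ker (hn : 0 < n) {κ : ℝ} (hκ : n < κ) :
    ∃ A : ℝ, 0 ≤ A ∧ ∀ R : ℝ, 0 < R →
      ∫⁻ z in (Metric.ball (0 : Euc n) R)ᶜ, ker κ z = ENNReal.ofReal (A * R ^ (n - κ)) := by
  have : Nontrivial (Euc n) := by
    have : Nonempty (Fin n) := ⟨⟨0, hn⟩⟩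
    infer_instance
  refine ⟨n * (volume.real (Metric.ball (0 : Euc n) 1)) * (1 / (κ - n)), ?_, fun R hR => ?_⟩
  · have : 0 < κ - n := by linarith
    positivity
  have hfun : ∀ z : Euc n, (Metric.ball (0 : Euc n) R)ᶜ.indicator (fun z => ‖z‖ ^ (-κ)) z =
      (Set.Ici R).indicator (fun t : ℝ => t ^ (-κ)) ‖z‖ := by
    intro z; simp [Set.indicator]
  have hone : ∀ t ∈ Set.Ioi (0 : ℝ),
      t ^ (Module.finrank ℝ (Euc n) - 1) • (Set.Ici R).indicator (fun t : ℝ => t ^ (-κ)) t =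
      (Set.Ici R).indicator (fun t : ℝ => t ^ (n - 1 - κ)) t := by
    intro t ht
    have ht : 0 < t := ht
    simp only [Set.indicator, finrank_euclideanSpace, Fintype.card_fin, smul_eq_mul]
    split_ifs
    · rw [← Real.rpow_natCast, ← Real.rpow_add ht, Nat.cast_pred hn]; ring_nf
    · simp
  have hset : Set.Ioi (0 : ℝ) ∩ Set.Ici R = Set.Ici R := by
    ext t; simp only [Set.mem_inter_iff, Set.mem_Ioi, Set.mem_Ici]
    exact ⟨fun h => h.2, fun h => ⟨by linarith, h⟩⟩
  have hint1 : IntegrableOn (fun t : ℝ => t ^ (n - 1 - κ)) (Set.Ici R) := by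
    rw [integrableOn_Ici_iff_integrableOn_Ioi]
    exact integrableOn_Ioi_rpow_of_lt (by linarith) hR
  have hint : Integrable (fun z : Euc n => (Set.Ici R).indicator (fun t : ℝ => t ^ (-κ)) ‖z‖) := by
    rw [integrable_fun_norm_addHaar volume (f := (Set.Ici R).indicator (fun t : ℝ => t ^ (-κ))),
      integrableOn_congr_fun hone measurableSet_Ioi, IntegrableOn,
      integrable_indicator_iff measurableSet_Ici, IntegrableOn,
      Measure.restrict_restrict measurableSet_Ici]
    rwa [Set.inter_comm, hset]
  have hval := integral_fun_norm_addHaar (volume : Measure (Euc n))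
    ((Set.Ici R).indicator (fun t : ℝ => t ^ (-κ)))
  rw [setIntegral_congr_fun measurableSet_Ioi hone, setIntegral_indicator measurableSet_Ici,
    hset, integral_Ici_eq_integral_Ioi, integral_Ioi_rpow_of_lt (by linarith) hR] at hval
  rw [← lintegral_indicator Metric.isOpen_ball.measurableSet.compl]
  have : ∀ z : Euc n, (Metric.ball (0 : Euc n) R)ᶜ.indicator (ker κ) z =
      ENNReal.ofReal ((Set.Ici R).indicator (fun t : ℝ => t ^ (-κ)) ‖z‖) := by
    intro z
    rw [← hfun]; unfold ker Set.indicator; split_ifs <;> simp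
  simp_rw [this]
  rw [← ofReal_integral_eq_lintegral_ofReal hint, hval]
  · congr 1
    simp only [finrank_euclideanSpace, Fintype.card_fin, nsmul_eq_mul, smul_eq_mul]
    have h1 : (n : ℝ) - 1 - κ + 1 = n - κ := by ring
    rw [h1, ← neg_sub (n : ℝ) κ, one_div, inv_neg, neg_div, div_eq_mul_inv]; ring
  · filter_upwards with z
    simp only [Set.indicator]; split_ifs <;> simp; positivity

/-- Layer cake formula for a number. -/
lemma lintegral_Ioi_ite_rpow {s : ℝ} (hs : 0 < s) (a : ℝ≥0∞) :
    ∫⁻ t in Set.Ioi (0 : ℝ), (if ENNReal.ofReal t < a then ENNReal.ofReal (t ^ (s - 1)) else 0) =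
      a ^ s / ENNReal.ofReal s := by
  have fin : ∀ b : ℝ, 0 ≤ b → ∫⁻ t in Set.Ioi (0 : ℝ), (if ENNReal.ofReal t < ENNReal.ofReal b then
      ENNReal.ofReal (t ^ (s - 1)) else 0) = ENNReal.ofReal b ^ s / ENNReal.ofReal s := by
    intro b hb
    have h1 : ∀ t ∈ Set.Ioi (0 : ℝ), (if ENNReal.ofReal t < ENNReal.ofReal b then
      ENNReal.ofReal (t ^ (s - 1)) else 0) =
        (Set.Iio b).indicator (fun t : ℝ => ENNReal.ofReal (t ^ (s - 1))) t := by
      intro t ht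
      have : ENNReal.ofReal t < ENNReal.ofReal b ↔ t < b :=
        ENNReal.ofReal_lt_ofReal_iff_of_nonneg (le_of_lt ht)
      simp [Set.indicator, this]
    rw [setLIntegral_congr_fun measurableSet_Ioi h1, setLIntegral_indicator measurableSet_Iio,
      Set.inter_comm, Set.Ioi_inter_Iio, Measure.restrict_congr_set Ioo_ae_eq_Ioc,
      ← ofReal_integral_eq_lintegral_ofReal, ← intervalIntegral.integral_of_le hb,
      integral_rpow (Or.inl (by linarith)), ENNReal.ofReal_rpow_of_nonneg hb hs.le,
      ← ENNReal.ofReal_div_of_pos hs]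
    · congr 1
      rw [Real.zero_rpow (by linarith)]; ring_nf
    · exact (intervalIntegral.intervalIntegrable_rpow' (by linarith)).1
    · filter_upwards [ae_restrict_mem measurableSet_Ioc] with t ht
      exact Real.rpow_nonneg ht.1.le _
  by_cases ha : a = ∞
  · subst ha
    rw [ENNReal.top_rpow_of_pos hs, ENNReal.top_div_of_ne_top ENNReal.ofReal_ne_top]
    refine ENNReal.eq_top_of_forall_nnreal_le fun r => ?_
    -- At this finite height b the value b^s / s is exactly r, so the integral for a = ∞ exceeds
    -- every finite r.
    have hb : (0 : ℝ) ≤ (r * s) ^ (1 / s) := by positivity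
    have h2 := fin _ hb
    rw [ENNReal.ofReal_rpow_of_nonneg hb hs.le, ← Real.rpow_mul (by positivity),
      one_div_mul_cancel hs.ne', Real.rpow_one, ← ENNReal.ofReal_div_of_pos hs,
      mul_div_cancel_right₀ _ hs.ne', ENNReal.ofReal_coe_nnreal] at h2
    rw [← h2]
    gcongr with t
    split_ifs <;> simp_all
  · rw [← ENNReal.ofReal_toReal ha]
    exact fin _ ENNReal.toReal_nonneg

/-- The potential of `f` with kernel `‖z‖ ^ (-κ)`. -/
noncomputable def pot (κ : ℝ) (f : Euc n → ℝ≥0∞) (x : Euc n) : ℝ≥0∞ := ∫⁻ y, f y * ker κ (x - y)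

@[fun_prop]
lemma measurable_pot {κ : ℝ} {f : Euc n → ℝ≥0∞} (hf : Measurable f) : Measurable (pot κ f) := by
  unfold pot
  apply Measurable.lintegral_prod_right
  fun_prop

lemma pot_mono {κ : ℝ} {f g : Euc n → ℝ≥0∞} (h : ∀ y, f y ≤ g y) (x : Euc n) :
    pot κ f x ≤ pot κ g x := by
  unfold pot; gcongr; exact h _

lemma pot_const_mul (κ : ℝ) {f : Euc n → ℝ≥0∞} (hf : Measurable f) (c : ℝ≥0∞) (x : Euc n) :
    pot κ (fun y => c * f y) x = c * pot κ f x := by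
  unfold pot
  simp_rw [mul_assoc]
  rw [lintegral_const_mul]
  fun_prop

lemma pot_add (κ : ℝ) {f g : Euc n → ℝ≥0∞} (hf : Measurable f) (x : Euc n) :
    pot κ (fun y => f y + g y) x = pot κ f x + pot κ g x := by
  unfold pot
  simp_rw [add_mul]
  rw [lintegral_add_left]
  fun_prop

lemma setLIntegral_ker_sub (κ : ℝ) {s : Set (Euc n)} (hs : MeasurableSet s) (x : Euc n) :
    ∫⁻ y in {y | x - y ∈ s}, ker κ (x - y) = ∫⁻ z in s, ker κ z := by
  have hm : MeasurableSet {y | x - y ∈ s} := measurableSet_preimage (by fun_prop) hs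
  rw [← lintegral_indicator hs, ← lintegral_indicator hm,
    ← lintegral_sub_left_eq_self (fun z => s.indicator (ker κ) z) x]
  rfl

/-- Hölder's inequality for a potential restricted to `x - y ∈ s`. -/
lemma lintegral_mul_ker_le {κ r r' : ℝ} (hr : r.HolderConjugate r') {f : Euc n → ℝ≥0∞}
    (hf : Measurable f) {s : Set (Euc n)} (hs : MeasurableSet s) (x : Euc n) :
    ∫⁻ y in {y | x - y ∈ s}, f y * ker κ (x - y) ≤
      (∫⁻ y, f y ^ r) ^ (1 / r) * (∫⁻ z in s, ker (κ * r') z) ^ (1 / r') := by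
  have h := ENNReal.lintegral_mul_le_Lp_mul_Lq (volume.restrict {y | x - y ∈ s}) hr
    (f := f) (g := fun y => ker κ (x - y)) (by fun_prop) (by fun_prop)
  simp_rw [ker_rpow _ _ hr.symm.nonneg] at h
  rw [setLIntegral_ker_sub _ hs] at h
  refine h.trans ?_
  gcongr
  · exact one_div_nonneg.2 hr.nonneg
  · exact Measure.restrict_le_self

lemma pot_eq_add {κ : ℝ} (f : Euc n → ℝ≥0∞) {s : Set (Euc n)} (hs : MeasurableSet s) (x : Euc n) :
    pot κ f x = (∫⁻ y in {y | x - y ∈ s}, f y * ker κ (x - y)) +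
      ∫⁻ y in {y | x - y ∈ sᶜ}, f y * ker κ (x - y) := by
  have hm : MeasurableSet {y | x - y ∈ s} := measurableSet_preimage (by fun_prop) hs
  exact (lintegral_add_compl _ hm).symm

/-- A normalised form of the Hardy–Littlewood–Sobolev inequality. -/
lemma exists_lintegral_pot_rpow_le_of_le_one (hn : 0 < n) {σ r q : ℝ} (hσ : 0 < σ)
    (hr : 1 < r) (hq : 0 < q) (hrq : 1 / r = 1 / q + σ / n) :
    ∃ C : ℝ≥0∞, C ≠ ∞ ∧ ∀ f : Euc n → ℝ≥0∞, Measurable f → ∫⁻ y, f y ^ r ≤ 1 →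
      ∫⁻ x, pot (n - σ) f x ^ q ≤ C := by
  have hn' : (0 : ℝ) < n := by exact_mod_cast hn
  set κ : ℝ := n - σ with hκ
  have hr0 : 0 < r := by linarith
  set r' := r.conjExponent with hr'
  have hrr : r.HolderConjugate r' := Real.HolderConjugate.conjExponent hr
  have hqr : q / r = 1 + σ * q / n := by
    have := congrArg (q * ·) hrq
    field_simp at this ⊢
    linarith
  have hr'inv : 1 / r' = 1 - 1 / r := by
    have := hrr.inv_add_inv_eq_one
    simp only [one_div]; linarith
  have hr'0 : 0 < r' := hrr.symm.pos
  have hκr' : n < κ * r' := by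
    have h1 : 1 / r' < κ / n := by
      rw [hr'inv, hrq, hκ, sub_div, div_self hn'.ne']
      have : 0 < 1 / q := by positivity
      linarith
    rw [div_lt_div_iff₀ hr'0 hn'] at h1
    linarith
  obtain ⟨A, hA0, hA⟩ := setLIntegral_ball_ker (κ := κ) hn (by linarith)
  obtain ⟨B, hB0, hB⟩ := setLIntegral_compl_ball_ker (κ := κ * r') hn hκr'
  -- The summand 1 gives D ≥ 1; hence a potential that exceeds 2Dt but is at most Dt + J must have J
  -- ≥ t.
  set D : ℝ := A + B ^ (1 / r') + 1 with hD
  have hBp : 0 ≤ B ^ (1 / r') := Real.rpow_nonneg hB0 _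
  have hD1 : 1 ≤ D := by linarith
  set s : ℝ := q - q / r with hs
  have hs0 : 0 < s := by
    rw [hs, sub_pos, div_lt_iff₀ hr0]; nlinarith
  have hDE : ENNReal.ofReal (2 * D) ≠ 0 := by
    simp only [ne_eq, ENNReal.ofReal_eq_zero, not_le]; linarith
  refine ⟨ENNReal.ofReal (2 * D) ^ q * (ENNReal.ofReal q * (ENNReal.ofReal A / ENNReal.ofReal s)),
    ?_, fun f hf hf1 => ?_⟩
  · refine ENNReal.mul_ne_top (ENNReal.rpow_ne_top_of_nonneg hq.le ENNReal.ofReal_ne_top)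
      (ENNReal.mul_ne_top ENNReal.ofReal_ne_top (ENNReal.div_ne_top ENNReal.ofReal_ne_top ?_))
    simpa using hs0
  -- At level t the kernel is cut at radius t^(-q/n) and f at height t^(q/r). These are tuned so
  -- that the far kernel (Hölder, with ∫ f^r ≤ 1) and the near kernel against the low part of f each
  -- contribute a constant times t. Only the near kernel against the tall part of f, the quantity J,
  -- is left.
  set bk : ℝ → Euc n → ℝ≥0∞ := fun t z => if ‖z‖ < t ^ (-q / n) then ker κ z else 0 with hbk
  set fl : ℝ → Euc n → ℝ≥0∞ := fun t y => if ENNReal.ofReal (t ^ (q / r)) < f y then f y else 0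
    with hfl
  set J : ℝ → Euc n → ℝ≥0∞ := fun t x => ∫⁻ y, fl t y * bk t (x - y) with hJ
  have hbkm : Measurable (fun p : (Euc n × ℝ) × Euc n => bk p.1.2 (p.1.1 - p.2)) := by
    refine Measurable.ite (measurableSet_lt (by fun_prop) (by fun_prop)) (by fun_prop) (by fun_prop)
  have hflm : Measurable (fun p : ℝ × Euc n => fl p.1 p.2) := by
    refine Measurable.ite (measurableSet_lt (by fun_prop) (by fun_prop)) (by fun_prop) (by fun_prop)
  have hflm' : Measurable (fun p : (Euc n × ℝ) × Euc n => fl p.1.2 p.2) :=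
    hflm.comp (g := fun p : ℝ × Euc n => fl p.1 p.2) (f := fun p : (Euc n × ℝ) × Euc n => (p.1.2, p.2))
      (by fun_prop)
  have hJm : Measurable (fun p : Euc n × ℝ => J p.2 p.1) :=
    (hflm'.mul hbkm).lintegral_prod_right
  have hintbk : ∀ t : ℝ, 0 < t → ∀ x : Euc n, ∫⁻ z, bk t (x - z) =
      ENNReal.ofReal (A * t ^ (-(σ * q / n))) := by
    intro t ht x
    have h1 := hA (t ^ (-q / n)) (by positivity)
    rw [lintegral_sub_left_eq_self (fun z => bk t z) x]
    rw [← lintegral_indicator Metric.isOpen_ball.measurableSet] at h1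
    rw [← Real.rpow_mul ht.le, hκ] at h1
    have h2 : -q / n * (n - (n - σ)) = -(σ * q / n) := by ring
    rw [h2] at h1
    rw [← h1]
    congr 1 with z
    simp [hbk, hκ, Set.indicator]
  have key : ∀ t : ℝ, 0 < t → ∀ x, pot κ f x ≤ ENNReal.ofReal (D * t) + J t x := by
    intro t ht x
    have hR : 0 < t ^ (-q / n) := by positivity
    rw [pot_eq_add f (s := Metric.ball 0 (t ^ (-q / n))) Metric.isOpen_ball.measurableSet x]
    have far : ∫⁻ y in {y | x - y ∈ (Metric.ball (0 : Euc n) (t ^ (-q / n)))ᶜ},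
        f y * ker κ (x - y) ≤ ENNReal.ofReal (B ^ (1 / r') * t) := by
      refine (lintegral_mul_ker_le hrr hf Metric.isOpen_ball.measurableSet.compl x).trans ?_
      rw [hB _ hR, ENNReal.ofReal_rpow_of_nonneg (by positivity) (by positivity),
        Real.mul_rpow hB0 (by positivity), ← Real.rpow_mul ht.le, ← Real.rpow_mul ht.le]
      have h3 : -q / n * (n - κ * r') * (1 / r') = 1 := by
        have : -q / n * (n - κ * r') * (1 / r') = -q / n * (n * (1 / r') - κ) := by
          field_simp
        rw [this, hr'inv, hrq, hκ]; field_simp; ring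
      rw [h3, Real.rpow_one]
      calc _ ≤ 1 * ENNReal.ofReal (B ^ (1 / r') * t) := by
            gcongr
            exact ENNReal.rpow_le_one hf1 (by positivity)
        _ = _ := one_mul _
    have near : ∫⁻ y in {y | x - y ∈ Metric.ball (0 : Euc n) (t ^ (-q / n))},
        f y * ker κ (x - y) ≤ ENNReal.ofReal (A * t) + J t x := by
      have hm : MeasurableSet {y | x - y ∈ Metric.ball (0 : Euc n) (t ^ (-q / n))} :=
        measurableSet_preimage (by fun_prop) Metric.isOpen_ball.measurableSet
      rw [← lintegral_indicator hm]
      have h4 : ENNReal.ofReal (A * t) = ∫⁻ y, ENNReal.ofReal (t ^ (q / r)) * bk t (x - y) := by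
        have hbkm1 : Measurable (fun y => bk t (x - y)) := by
          refine Measurable.ite (measurableSet_lt (by fun_prop) (by fun_prop)) (by fun_prop)
            (by fun_prop)
        rw [lintegral_const_mul _ hbkm1, hintbk t ht, ← ENNReal.ofReal_mul (by positivity), hqr,
          mul_left_comm, ← Real.rpow_add ht]
        simp
      rw [h4, ← lintegral_add_left]
      · refine lintegral_mono fun y => ?_
        simp only [Set.indicator, Set.mem_ofPred_eq, Metric.mem_ball, dist_zero_right, hbk, hfl]
        split_ifs with h5 h6
        · exact le_add_self
        · simp only [zero_mul, add_zero]
          gcongr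
          exact not_lt.1 h6
        · simp
        · simp
      · exact (Measurable.ite (measurableSet_lt (by fun_prop) (by fun_prop)) (by fun_prop)
            (by fun_prop)).const_mul _
    refine (add_le_add near far).trans ?_
    rw [add_right_comm, ← ENNReal.ofReal_add (by positivity) (by positivity), ← add_mul]
    gcongr
    linarith
  -- Layer cake for the potential divided by 2D: at each level t below that quotient J ≥ t, so
  -- t^(q-1) ≤ t^(q-2) J and the indicator can be dropped. The resulting bound is linear in J, which
  -- lets Tonelli finish the proof.
  have pointwise : ∀ x, pot κ f x ^ q ≤ ENNReal.ofReal (2 * D) ^ q * (ENNReal.ofReal q *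
      ∫⁻ t in Set.Ioi (0 : ℝ), ENNReal.ofReal (t ^ (q - 2)) * J t x) := by
    intro x
    have h1 := lintegral_Ioi_ite_rpow hq (pot κ f x / ENNReal.ofReal (2 * D))
    have h2 : pot κ f x ^ q = ENNReal.ofReal (2 * D) ^ q * (ENNReal.ofReal q *
        ((pot κ f x / ENNReal.ofReal (2 * D)) ^ q / ENNReal.ofReal q)) := by
      rw [ENNReal.mul_div_cancel (by simpa using hq) ENNReal.ofReal_ne_top,
        ← ENNReal.mul_rpow_of_nonneg _ _ hq.le, ENNReal.mul_div_cancel hDE ENNReal.ofReal_ne_top]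
    rw [h2, ← h1]
    gcongr ENNReal.ofReal (2 * D) ^ q * (ENNReal.ofReal q * ?_)
    refine setLIntegral_mono' measurableSet_Ioi fun t ht => ?_
    have ht : 0 < t := ht
    split_ifs with h3
    · have h4 : ENNReal.ofReal t ≤ J t x := by
        by_contra hcon
        rw [not_le] at hcon
        rw [ENNReal.lt_div_iff_mul_lt (Or.inl hDE) (Or.inl ENNReal.ofReal_ne_top),
          ← ENNReal.ofReal_mul ht.le] at h3
        have h5 := h3.trans_le (key t ht x)
        have h6 : ENNReal.ofReal (D * t) + J t x ≤ ENNReal.ofReal (D * t) + ENNReal.ofReal t := by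
          gcongr
        rw [← ENNReal.ofReal_add (by positivity) ht.le] at h6
        have h7 := (ENNReal.ofReal_lt_ofReal_iff_of_nonneg (by positivity)).1 (h5.trans_le h6)
        nlinarith
      calc ENNReal.ofReal (t ^ (q - 1)) = ENNReal.ofReal (t ^ (q - 2)) * ENNReal.ofReal t := by
            rw [← ENNReal.ofReal_mul (by positivity), ← Real.rpow_add_one ht.ne']; ring_nf
        _ ≤ _ := by gcongr
    · exact zero_le
  have hJint : ∀ t : ℝ, 0 < t → ∫⁻ x, J t x =
      ENNReal.ofReal (A * t ^ (-(σ * q / n))) * ∫⁻ y, fl t y := by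
    intro t ht
    have hm1 : Measurable (fl t) := hflm.comp (g := fun p : ℝ × Euc n => fl p.1 p.2)
      (f := fun y => (t, y)) (by fun_prop)
    have hm2 : Measurable (fun p : Euc n × Euc n => bk t (p.1 - p.2)) :=
      hbkm.comp (g := fun p : (Euc n × ℝ) × Euc n => bk p.1.2 (p.1.1 - p.2))
        (f := fun p : Euc n × Euc n => ((p.1, t), p.2)) (by fun_prop)
    simp only [hJ]
    rw [lintegral_lintegral_swap]
    · have : ∀ y, ∫⁻ x, fl t y * bk t (x - y) =
          ENNReal.ofReal (A * t ^ (-(σ * q / n))) * fl t y := by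
        intro y
        rw [lintegral_const_mul, mul_comm, ← hintbk t ht y]
        · congr 1
          refine lintegral_congr fun x => ?_
          simp only [hbk]
          rw [ker_sub_comm, norm_sub_rev]
        · exact hm2.comp (f := fun x => (x, y)) (by fun_prop)
      simp_rw [this]
      rw [lintegral_const_mul _ hm1]
    · exact ((hm1.comp measurable_snd).mul hm2).aemeasurable
  have hmeas1 : Measurable (fun p : Euc n × ℝ => ENNReal.ofReal (p.2 ^ (q - 2)) * J p.2 p.1) := by
    exact Measurable.mul (by fun_prop) hJm
  calc ∫⁻ x, pot κ f x ^ q ≤ ∫⁻ x, ENNReal.ofReal (2 * D) ^ q * (ENNReal.ofReal q *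
      ∫⁻ t in Set.Ioi (0 : ℝ), ENNReal.ofReal (t ^ (q - 2)) * J t x) := lintegral_mono pointwise
    _ = ENNReal.ofReal (2 * D) ^ q * (ENNReal.ofReal q *
      ∫⁻ t in Set.Ioi (0 : ℝ), ENNReal.ofReal (t ^ (q - 2)) * ∫⁻ x, J t x) := by
        have hm3 : Measurable (fun x : Euc n =>
            ∫⁻ t in Set.Ioi (0 : ℝ), ENNReal.ofReal (t ^ (q - 2)) * J t x) :=
          hmeas1.lintegral_prod_right'
        rw [lintegral_const_mul _ (hm3.const_mul _), lintegral_const_mul _ hm3,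
          lintegral_lintegral_swap hmeas1.aemeasurable]
        congr 2
        refine lintegral_congr fun t => ?_
        rw [lintegral_const_mul]
        exact hJm.comp (f := fun x => (x, t)) (by fun_prop)
    _ = ENNReal.ofReal (2 * D) ^ q * (ENNReal.ofReal q * (ENNReal.ofReal A *
      ∫⁻ t in Set.Ioi (0 : ℝ), ∫⁻ y, ENNReal.ofReal (t ^ (s - 1)) * fl t y)) := by
        congr 2
        rw [← lintegral_const_mul]
        · refine setLIntegral_congr_fun measurableSet_Ioi fun t ht => ?_
          have ht : 0 < t := ht
          rw [hJint t ht, lintegral_const_mul, ← mul_assoc, ← mul_assoc,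
            ← ENNReal.ofReal_mul (by positivity), ← ENNReal.ofReal_mul hA0, mul_left_comm,
            ← Real.rpow_add ht]
          · congr 4
            rw [hs, hqr]; ring
          · exact hflm.comp (g := fun p : ℝ × Euc n => fl p.1 p.2) (f := fun y => (t, y))
              (by fun_prop)
        · exact Measurable.lintegral_prod_right'
            (f := fun p : ℝ × Euc n => ENNReal.ofReal (p.1 ^ (s - 1)) * fl p.1 p.2)
            (Measurable.mul (by fun_prop) hflm)
    _ = ENNReal.ofReal (2 * D) ^ q * (ENNReal.ofReal q * (ENNReal.ofReal A *
      ∫⁻ y, f y * (f y ^ (r - 1) / ENNReal.ofReal s))) := by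
        -- For fixed y the t-integral runs over t < f(y)^(r/q) and equals f(y)^(r-1) / s, where s >
        -- 0 comes from r > 1. The factor f(y) outside restores f^r.
        rw [lintegral_lintegral_swap]
        · congr 3
          refine lintegral_congr fun y => ?_
          have h1 := lintegral_Ioi_ite_rpow hs0 (f y ^ (r / q))
          rw [← ENNReal.rpow_mul] at h1
          have h2 : r / q * s = r - 1 := by rw [hs]; field_simp
          rw [h2] at h1
          rw [← h1, ← lintegral_const_mul]
          · refine setLIntegral_congr_fun measurableSet_Ioi fun t ht => ?_
            have ht : 0 < t := ht
            have h3 : ENNReal.ofReal t < f y ^ (r / q) ↔ ENNReal.ofReal (t ^ (q / r)) < f y := by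
              rw [← ENNReal.ofReal_rpow_of_pos ht,
                ← ENNReal.rpow_lt_rpow_iff (z := q / r) (by positivity), ← ENNReal.rpow_mul]
              have : r / q * (q / r) = 1 := by field_simp
              rw [this, ENNReal.rpow_one]
            simp only [hfl, h3]
            split_ifs
            · rw [mul_comm]
            · simp
          · exact Measurable.ite (measurableSet_lt (by fun_prop) (by fun_prop)) (by fun_prop)
              (by fun_prop)
        · exact (Measurable.mul (f := fun p : ℝ × Euc n => ENNReal.ofReal (p.1 ^ (s - 1)))
            (g := fun p : ℝ × Euc n => fl p.1 p.2) (by fun_prop) hflm).aemeasurable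
    _ = ENNReal.ofReal (2 * D) ^ q * (ENNReal.ofReal q * (ENNReal.ofReal A *
      ((∫⁻ y, f y ^ r) / ENNReal.ofReal s))) := by
        simp_rw [div_eq_mul_inv]
        rw [← lintegral_mul_const _ (by fun_prop)]
        congr 3
        refine lintegral_congr fun y => ?_
        rw [← mul_assoc]
        congr 1
        by_cases hy0 : f y = 0
        · rw [hy0, zero_mul, ENNReal.zero_rpow_of_pos hr0]
        by_cases hyt : f y = ∞
        · rw [hyt, ENNReal.top_rpow_of_pos hr0, ENNReal.top_rpow_of_pos (by linarith)]; simp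
        · have := ENNReal.rpow_add 1 (r - 1) hy0 hyt
          rw [ENNReal.rpow_one] at this
          rw [← this]; ring_nf
    _ ≤ _ := by
        rw [div_eq_mul_inv, div_eq_mul_inv]
        gcongr
        calc _ ≤ 1 * (ENNReal.ofReal s)⁻¹ := by gcongr
          _ = _ := one_mul _

/-- **Hardy–Littlewood–Sobolev inequality** for potentials. -/
theorem exists_Lp_pot_le (hn : 0 < n) {σ r q : ℝ} (hσ : 0 < σ)
    (hr : 1 < r) (hq : 0 < q) (hrq : 1 / r = 1 / q + σ / n) :
    ∃ C : ℝ≥0∞, C ≠ ∞ ∧ ∀ f : Euc n → ℝ≥0∞, Measurable f →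
      (∫⁻ x, pot (n - σ) f x ^ q) ^ (1 / q) ≤ C * (∫⁻ y, f y ^ r) ^ (1 / r) := by
  obtain ⟨C, hC, h⟩ := exists_lintegral_pot_rpow_le_of_le_one hn hσ hr hq hrq
  have hr0 : 0 < r := by linarith
  -- The extra 1 keeps the constant nonzero: when the norm of f is infinite the right-hand side must
  -- be ∞, whereas 0 * ∞ = 0.
  refine ⟨C ^ (1 / q) + 1, by
    simpa using ENNReal.rpow_ne_top_of_nonneg (by positivity : 0 ≤ 1 / q) hC, fun f hf => ?_⟩
  set N := (∫⁻ y, f y ^ r) ^ (1 / r) with hN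
  have hNr : N ^ r = ∫⁻ y, f y ^ r := by
    rw [hN, ← ENNReal.rpow_mul, one_div_mul_cancel hr0.ne', ENNReal.rpow_one]
  by_cases hN0 : N = 0
  · rw [hN0, ENNReal.zero_rpow_of_pos hr0, eq_comm,
      lintegral_eq_zero_iff (by fun_prop)] at hNr
    have hz : ∀ x, pot (n - σ) f x = 0 := by
      intro x
      unfold pot
      rw [lintegral_eq_zero_iff (by fun_prop)]
      filter_upwards [hNr] with y hy
      have : f y = 0 := by simpa [hr0, hr0.not_gt] using hy
      simp [this]
    simp [hz, hq]
  by_cases hNt : N = ∞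
  · rw [hNt, ENNReal.mul_top (by simp)]; exact le_top
  have h1 := h (fun y => N⁻¹ * f y) (by fun_prop) (by
    simp_rw [ENNReal.mul_rpow_of_nonneg _ _ hr0.le]
    rw [lintegral_const_mul _ (by fun_prop), ← hNr, ← ENNReal.mul_rpow_of_nonneg _ _ hr0.le,
      ENNReal.inv_mul_cancel hN0 hNt, ENNReal.one_rpow])
  simp_rw [pot_const_mul _ hf, ENNReal.mul_rpow_of_nonneg _ _ hq.le] at h1
  rw [lintegral_const_mul _ (by fun_prop)] at h1
  have h2 := ENNReal.rpow_le_rpow h1 (by positivity : 0 ≤ 1 / q)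
  rw [ENNReal.mul_rpow_of_nonneg _ _ (by positivity), ← ENNReal.rpow_mul,
    mul_one_div_cancel hq.ne', ENNReal.rpow_one] at h2
  calc (∫⁻ x, pot (n - σ) f x ^ q) ^ (1 / q)
      = N * (N⁻¹ * (∫⁻ x, pot (n - σ) f x ^ q) ^ (1 / q)) := by
        rw [← mul_assoc, ENNReal.mul_inv_cancel hN0 hNt, one_mul]
    _ ≤ N * C ^ (1 / q) := by gcongr
    _ ≤ _ := by rw [mul_comm]; gcongr; exact le_self_add

/-! ### Lower bounds for potentials and non-integrability -/

lemma ofReal_div_norm_pow (hn : 2 ≤ n) {a : ℝ} (ha : 0 ≤ a) (z : Euc n) :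
    ENNReal.ofReal (a / ‖z‖ ^ (n - 2)) = ENNReal.ofReal a * ker ((n : ℝ) - 2) z := by
  unfold ker
  rw [← ENNReal.ofReal_mul ha, Real.rpow_neg (norm_nonneg _), div_eq_mul_inv]
  have : (n : ℝ) - 2 = ((n - 2 : ℕ) : ℝ) := by push_cast [Nat.cast_sub hn]; ring
  rw [this, Real.rpow_natCast]

/-- A potential of a function which is positive on the unit ball decays at most like the kernel. -/
lemma exists_le_pot (hn : 0 < n) {κ : ℝ} (hκ : 0 ≤ κ) {f : Euc n → ℝ≥0∞} (hf : Measurable f)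
    (hf0 : ∀ y, f y ≠ 0) :
    ∃ c : ℝ, 0 < c ∧ ∀ x, ENNReal.ofReal (c * (1 + ‖x‖) ^ (-κ)) ≤ pot κ f x := by
  have : Nontrivial (Euc n) := by
    have : Nonempty (Fin n) := ⟨⟨0, hn⟩⟩
    infer_instance
  set m : ℝ≥0∞ := ∫⁻ y in Metric.ball (0 : Euc n) 1, f y with hm
  have hm0 : m ≠ 0 := by
    intro h
    rw [hm, lintegral_eq_zero_iff hf] at h
    have h1 : ∀ᵐ y ∂(volume.restrict (Metric.ball (0 : Euc n) 1)), False := by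
      filter_upwards [h] with y hy using hf0 y hy
    rw [eventually_false_iff_eq_bot, ae_eq_bot, Measure.restrict_eq_zero] at h1
    exact (Metric.measure_ball_pos volume (0 : Euc n) one_pos).ne' h1
  -- The mass m may be infinite; capping it at 1 produces a real constant.
  have hm1 : min m 1 ≠ ∞ := (min_le_right m 1).trans_lt ENNReal.one_lt_top |>.ne
  have hm2 : min m 1 ≠ 0 := by
    rcases min_choice m 1 with h | h <;> rw [h] <;> simp [hm0]
  refine ⟨(min m 1).toReal, ENNReal.toReal_pos hm2 hm1, fun x => ?_⟩
  rw [ENNReal.ofReal_mul ENNReal.toReal_nonneg, ENNReal.ofReal_toReal hm1]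
  calc min m 1 * ENNReal.ofReal ((1 + ‖x‖) ^ (-κ))
      ≤ m * ENNReal.ofReal ((1 + ‖x‖) ^ (-κ)) := by gcongr; exact min_le_left _ _
    _ = ∫⁻ y in Metric.ball (0 : Euc n) 1, f y * ENNReal.ofReal ((1 + ‖x‖) ^ (-κ)) := by
        rw [lintegral_mul_const _ hf]
    _ ≤ ∫⁻ y in Metric.ball (0 : Euc n) 1, f y * ker κ (x - y) := by
        refine lintegral_mono_ae ?_
        -- For κ ≠ 0 the real power makes the kernel 0 at the origin instead of ∞, so the lower
        -- bound can fail at y = x, a null set.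
        have h1 : ∀ᵐ y ∂(volume : Measure (Euc n)), y ≠ x := by
          simp [ae_iff]
        filter_upwards [ae_restrict_mem Metric.isOpen_ball.measurableSet, ae_restrict_of_ae h1]
          with y hy hyx
        have h2 : 0 < ‖x - y‖ := norm_pos_iff.2 (sub_ne_zero.2 (Ne.symm hyx))
        have h3 : ‖x - y‖ ≤ 1 + ‖x‖ := by
          have := norm_sub_le x y
          rw [Metric.mem_ball, dist_zero_right] at hy
          linarith
        unfold ker
        have h4 := Real.rpow_le_rpow_of_nonpos h2 h3 (neg_nonpos.2 hκ)
        exact mul_le_mul le_rfl (ENNReal.ofReal_le_ofReal h4) zero_le zero_le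
    _ ≤ pot κ f x := setLIntegral_le_lintegral _ _

/-- Functions with slow decay are not in `L^s`. -/
lemma not_memLp_of_le (hn : 0 < n) {κ c s : ℝ} (hκ : 0 ≤ κ) (hc : 0 < c) (hs : 0 < s)
    (hκs : κ * s ≤ n)
    {w : Euc n → ℝ} (hw : ∀ x, c * (1 + ‖x‖) ^ (-κ) ≤ w x) :
    ¬ MemLp w (ENNReal.ofReal s) volume := by
  intro h
  have : Nontrivial (Euc n) := by
    have : Nonempty (Fin n) := ⟨⟨0, hn⟩⟩
    infer_instance
  have h1 : Integrable (fun x => ‖w x‖ ^ s) := by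
    have := h.integrable_norm_rpow (by simpa using hs) ENNReal.ofReal_ne_top
    rwa [ENNReal.toReal_ofReal hs.le] at this
  have h2 : Integrable (fun x : Euc n => (c * (1 + ‖x‖) ^ (-κ)) ^ s) := by
    refine h1.mono' (Measurable.aestronglyMeasurable (by fun_prop)) ?_
    filter_upwards with x
    have h3 : 0 ≤ c * (1 + ‖x‖) ^ (-κ) := by positivity
    rw [Real.norm_of_nonneg (by positivity)]
    gcongr
    exact (hw x).trans (le_abs_self _)
  rw [integrable_fun_norm_addHaar volume (f := fun t => (c * (1 + t) ^ (-κ)) ^ s)] at h2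
  have h3 := h2.mono_set (Set.Ioi_subset_Ioi zero_le_one)
  -- For t > 1 one has 1 + t ≤ 2t, which gives the factor 2^(-κ s) and leaves a pure power of
  -- exponent n - 1 - κ s ≥ -1, not integrable at infinity.
  have h4 : IntegrableOn (fun t : ℝ => (c ^ s * 2 ^ (-κ * s)) * t ^ ((n : ℝ) - 1 - κ * s))
      (Set.Ioi 1) := by
    refine Integrable.mono' h3 (Measurable.aestronglyMeasurable (by fun_prop)) ?_
    filter_upwards [ae_restrict_mem measurableSet_Ioi] with t ht
    have ht : 1 < t := ht
    have ht0 : 0 < t := by linarith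
    rw [Real.norm_of_nonneg (by positivity)]
    simp only [finrank_euclideanSpace, Fintype.card_fin, smul_eq_mul]
    rw [Real.mul_rpow hc.le (by positivity), ← Real.rpow_mul (by positivity), ← Real.rpow_natCast,
      Nat.cast_pred hn, sub_eq_add_neg ((n : ℝ) - 1), Real.rpow_add ht0, ← neg_mul]
    calc c ^ s * 2 ^ (-κ * s) * (t ^ ((n : ℝ) - 1) * t ^ (-κ * s))
        = t ^ ((n : ℝ) - 1) * (c ^ s * (2 * t) ^ (-κ * s)) := by
          rw [Real.mul_rpow two_pos.le ht0.le]; ring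
      _ ≤ _ := by
          gcongr ?_ * (?_ * ?_)
          refine Real.rpow_le_rpow_of_nonpos (by linarith) (by linarith) ?_
          nlinarith
  have h5 : IntegrableOn (fun t : ℝ => t ^ ((n : ℝ) - 1 - κ * s)) (Set.Ioi 1) := by
    have hk : c ^ s * 2 ^ (-κ * s) ≠ 0 := by positivity
    exact (integrable_const_mul_iff (IsUnit.mk0 _ hk) _).1 h4
  rw [integrableOn_Ioi_rpow_iff one_pos] at h5
  linarith

end RieszPotential

/-! ### Solutions as potentials: measurability and lower bounds -/

namespace IsPositiveSolution

open RieszPotential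

variable {n : ℕ} {p c₁ c₂ : ℝ} {u v : EuclideanSpace ℝ (Fin n) → ℝ}

/-- The equation holds at every point and its integral ignores null sets, so replacing u by a
measurable representative inside the integral leaves v itself unchanged. The same device then
upgrades u. -/
lemma measurable_right (h : IsPositiveSolution n p c₁ c₂ u v) (hu : AEStronglyMeasurable u volume) :
    Measurable v := by
  have : v = fun x => c₂ * ∫ y, hu.mk u y ^ p / ‖x - y‖ ^ (n - 2) := by
    ext x
    rw [h.v_eq x]
    congr 1
    refine integral_congr_ae ?_
    filter_upwards [hu.ae_eq_mk] with y hy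
    rw [hy]
  rw [this]
  have hm := hu.stronglyMeasurable_mk.measurable
  refine Measurable.const_mul (StronglyMeasurable.measurable ?_) _
  refine StronglyMeasurable.integral_prod_right (f := fun x y => hu.mk u y ^ p / ‖x - y‖ ^ (n - 2)) ?_
  exact Measurable.stronglyMeasurable (by unfold Function.uncurry; fun_prop)

lemma measurable_left (h : IsPositiveSolution n p c₁ c₂ u v) (hu : AEStronglyMeasurable u volume) :
    Measurable u := by
  have hv := h.measurable_right hu
  have : u = fun x => c₁ * ∫ y, hu.mk u y ^ (p - 1) * v y / ‖x - y‖ ^ (n - 2) := by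
    ext x
    rw [h.u_eq x]
    congr 1
    refine integral_congr_ae ?_
    filter_upwards [hu.ae_eq_mk] with y hy
    rw [hy]
  rw [this]
  have hm := hu.stronglyMeasurable_mk.measurable
  refine Measurable.const_mul (StronglyMeasurable.measurable ?_) _
  refine StronglyMeasurable.integral_prod_right
    (f := fun x y => hu.mk u y ^ (p - 1) * v y / ‖x - y‖ ^ (n - 2)) ?_
  exact Measurable.stronglyMeasurable (by unfold Function.uncurry; fun_prop)

/-- A non-integrable integrand would have Bochner integral 0 and make w vanish at x. Positivity thus
makes the integral genuine and permits passing to the Lebesgue integral with values in `ℝ≥0∞`. -/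
lemma integrable_and_ofReal_eq {f w : EuclideanSpace ℝ (Fin n) → ℝ} (hn : 2 ≤ n)
    (hf : ∀ y, 0 ≤ f y) {c : ℝ} (hc : 0 < c) {x : EuclideanSpace ℝ (Fin n)} (hw : 0 < w x)
    (h : w x = c * ∫ y, f y / ‖x - y‖ ^ (n - 2)) :
    Integrable (fun y => f y / ‖x - y‖ ^ (n - 2)) ∧
    ENNReal.ofReal (w x) = ENNReal.ofReal c * pot ((n : ℝ) - 2) (fun y => ENNReal.ofReal (f y)) x := by
  have hi : Integrable (fun y => f y / ‖x - y‖ ^ (n - 2)) := by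
    by_contra hcon
    rw [integral_undef hcon] at h
    simp [h] at hw
  refine ⟨hi, ?_⟩
  rw [h, ENNReal.ofReal_mul hc.le, ofReal_integral_eq_lintegral_ofReal hi]
  · unfold pot
    simp_rw [ofReal_div_norm_pow hn (hf _)]
  · filter_upwards with y
    have := hf y
    positivity

lemma left_source_pos (h : IsPositiveSolution n p c₁ c₂ u v) (y) : 0 < u y ^ (p - 1) * v y :=
  mul_pos (Real.rpow_pos_of_pos (h.u_pos y) _) (h.v_pos y)

lemma right_source_pos (h : IsPositiveSolution n p c₁ c₂ u v) (y) : 0 < u y ^ p :=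
  Real.rpow_pos_of_pos (h.u_pos y) _

lemma ofReal_left_eq (h : IsPositiveSolution n p c₁ c₂ u v) (hn : 2 ≤ n) (hc₁ : 0 < c₁) (x) :
    ENNReal.ofReal (u x) = ENNReal.ofReal c₁ *
      pot ((n : ℝ) - 2) (fun y => ENNReal.ofReal (u y ^ (p - 1) * v y)) x :=
  (integrable_and_ofReal_eq hn (fun y => (h.left_source_pos y).le) hc₁ (h.u_pos x) (h.u_eq x)).2

lemma ofReal_right_eq (h : IsPositiveSolution n p c₁ c₂ u v) (hn : 2 ≤ n) (hc₂ : 0 < c₂) (x) :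
    ENNReal.ofReal (v x) = ENNReal.ofReal c₂ *
      pot ((n : ℝ) - 2) (fun y => ENNReal.ofReal (u y ^ p)) x :=
  (integrable_and_ofReal_eq hn (fun y => (h.right_source_pos y).le) hc₂ (h.v_pos x) (h.v_eq x)).2

lemma exists_le_left (h : IsPositiveSolution n p c₁ c₂ u v) (hn : 2 ≤ n) (hc₁ : 0 < c₁)
    (hu : AEStronglyMeasurable u volume) :
    ∃ c : ℝ, 0 < c ∧ ∀ x, c * (1 + ‖x‖) ^ (-((n : ℝ) - 2)) ≤ u x := by
  have h2 : (2 : ℝ) ≤ n := by exact_mod_cast hn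
  have := h.measurable_left hu
  have := h.measurable_right hu
  obtain ⟨c, hc, hle⟩ := exists_le_pot (n := n) (κ := (n : ℝ) - 2)
    (f := fun y => ENNReal.ofReal (u y ^ (p - 1) * v y)) (by omega) (by linarith) (by fun_prop)
    (fun y => by simpa using h.left_source_pos y)
  refine ⟨c₁ * c, by positivity, fun x => ?_⟩
  rw [← ENNReal.ofReal_le_ofReal_iff (h.u_pos x).le, h.ofReal_left_eq hn hc₁ x, mul_assoc,
    ENNReal.ofReal_mul hc₁.le]
  gcongr
  exact hle x

lemma exists_le_right (h : IsPositiveSolution n p c₁ c₂ u v) (hn : 2 ≤ n) (hc₂ : 0 < c₂)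
    (hu : AEStronglyMeasurable u volume) :
    ∃ c : ℝ, 0 < c ∧ ∀ x, c * (1 + ‖x‖) ^ (-((n : ℝ) - 2)) ≤ v x := by
  have h2 : (2 : ℝ) ≤ n := by exact_mod_cast hn
  have := h.measurable_left hu
  obtain ⟨c, hc, hle⟩ := exists_le_pot (n := n) (κ := (n : ℝ) - 2)
    (f := fun y => ENNReal.ofReal (u y ^ p)) (by omega) (by linarith) (by fun_prop)
    (fun y => by simpa using h.right_source_pos y)
  refine ⟨c₂ * c, by positivity, fun x => ?_⟩
  rw [← ENNReal.ofReal_le_ofReal_iff (h.v_pos x).le, h.ofReal_right_eq hn hc₂ x, mul_assoc,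
    ENNReal.ofReal_mul hc₂.le]
  gcongr
  exact hle x

end IsPositiveSolution

/-! ### Regularity lifting in Lebesgue spaces -/

namespace RieszPotential

variable {n : ℕ}

/-- The `L^s` seminorm of a function with values in `ℝ≥0∞`. -/
noncomputable def lpn (s : ℝ) (g : Euc n → ℝ≥0∞) : ℝ≥0∞ := (∫⁻ x, g x ^ s) ^ (1 / s)

lemma lpn_rpow {s : ℝ} (hs : 0 < s) (g : Euc n → ℝ≥0∞) : lpn s g ^ s = ∫⁻ x, g x ^ s := by
  unfold lpn
  rw [← ENNReal.rpow_mul, one_div_mul_cancel hs.ne', ENNReal.rpow_one]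

lemma lpn_lt_top_iff {s : ℝ} (hs : 0 < s) (g : Euc n → ℝ≥0∞) :
    lpn s g < ∞ ↔ ∫⁻ x, g x ^ s < ∞ :=
  ENNReal.rpow_lt_top_iff_of_pos (by positivity)

lemma lpn_mono {s : ℝ} (hs : 0 < s) {f g : Euc n → ℝ≥0∞} (h : ∀ x, f x ≤ g x) :
    lpn s f ≤ lpn s g := by
  unfold lpn
  have := hs.le
  gcongr
  exact h _

lemma lpn_const_mul {s : ℝ} (hs : 0 < s) (c : ℝ≥0∞) {g : Euc n → ℝ≥0∞} (hg : Measurable g) :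
    lpn s (fun x => c * g x) = c * lpn s g := by
  unfold lpn
  simp_rw [ENNReal.mul_rpow_of_nonneg _ _ hs.le]
  rw [lintegral_const_mul _ (by fun_prop), ENNReal.mul_rpow_of_nonneg _ _ (by positivity),
    ← ENNReal.rpow_mul, mul_one_div_cancel hs.ne', ENNReal.rpow_one]

lemma lpn_add_le {s : ℝ} (hs : 1 ≤ s) {f g : Euc n → ℝ≥0∞} (hf : Measurable f)
    (hg : Measurable g) : lpn s (fun x => f x + g x) ≤ lpn s f + lpn s g :=
  ENNReal.lintegral_Lp_add_le hf.aemeasurable hg.aemeasurable hs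

/-- Potentials of order two of products, in the critical range. -/
lemma exists_lpn_pot_mul_le (hn : 3 ≤ n) {s : ℝ} (hs : (n : ℝ) / (n - 2) < s) :
    ∃ C : ℝ≥0∞, C ≠ ∞ ∧ ∀ V g : Euc n → ℝ≥0∞, Measurable V → Measurable g →
      lpn s (pot ((n : ℝ) - 2) (fun y => V y * g y)) ≤ C * (lpn ((n : ℝ) / 2) V * lpn s g) := by
  have hn3 : (3 : ℝ) ≤ n := by exact_mod_cast hn
  have hn2 : (0 : ℝ) < n - 2 := by linarith
  have hn0 : (0 : ℝ) < n := by linarith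
  have hs0 : 0 < s := lt_trans (by positivity) hs
  -- Hölder pairs L^(n/2) with L^s into L^r, and a potential of order two maps L^r back to L^s. The
  -- requirement r > 1 is exactly s > n/(n-2).
  set r : ℝ := (1 / s + 2 / n)⁻¹ with hr
  have hrr : 1 / r = 1 / s + 2 / n := by rw [hr, one_div, inv_inv]
  have hr0 : 0 < r := by positivity
  have hr1 : 1 < r := by
    rw [hr]
    refine (one_lt_inv₀ (by positivity)).2 ?_
    have h1 : 1 / s < (n - 2) / n := by
      rw [div_lt_div_iff₀ hs0 hn0, one_mul]
      rwa [div_lt_iff₀ hn2, mul_comm] at hs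
    rw [sub_div, div_self hn0.ne'] at h1
    linarith
  have hrs : r < s := by
    rw [← one_div_lt_one_div hs0 hr0, hrr]
    have : (0 : ℝ) < 2 / n := by positivity
    linarith
  obtain ⟨C, hC, h⟩ := exists_Lp_pot_le (n := n) (by omega) two_pos hr1 hs0 hrr
  refine ⟨C, hC, fun V g hV hg => (h _ (hV.mul hg)).trans ?_⟩
  gcongr
  have := ENNReal.lintegral_Lp_mul_le_Lq_mul_Lr (r := n / 2) hr0 hrs (by rw [hrr]; field_simp)
    (volume : Measure (Euc n)) hg.aemeasurable hV.aemeasurable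
  rw [mul_comm g V] at this
  exact this.trans_eq (mul_comm _ _)

/-- Integrals over sets which eventually avoid almost every point tend to zero. -/
lemma tendsto_setLIntegral_of_eventually_notMem {ι : Type*} {l : Filter ι}
    [l.IsCountablyGenerated] {D : ι → Set (Euc n)} (hD : ∀ i, MeasurableSet (D i))
    (h : ∀ᵐ y, ∀ᶠ i in l, y ∉ D i) {g : Euc n → ℝ≥0∞} (hg : Measurable g)
    (hfin : ∫⁻ y, g y ≠ ∞) : Tendsto (fun i => ∫⁻ y in D i, g y) l (𝓝 0) := by
  simp_rw [← lintegral_indicator (hD _)]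
  rw [show (0 : ℝ≥0∞) = ∫⁻ _ : Euc n, 0 by simp]
  refine tendsto_lintegral_filter_of_dominated_convergence g ?_ ?_ hfin ?_
  · exact Eventually.of_forall fun i => hg.indicator (hD i)
  · exact Eventually.of_forall fun i => Eventually.of_forall fun y =>
      Set.indicator_le_self _ _ _
  · filter_upwards [h] with y hy
    refine tendsto_nhds_of_eventually_eq ?_
    filter_upwards [hy] with i hi
    simp [hi]

lemma lpn_indicator_rpow {s : ℝ} (hs : 0 < s) {D : Set (Euc n)} (hD : MeasurableSet D)
    (V : Euc n → ℝ≥0∞) : lpn s (D.indicator V) = (∫⁻ y in D, V y ^ s) ^ (1 / s) := by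
  unfold lpn
  rw [← lintegral_indicator hD]
  congr 2 with y
  by_cases hy : y ∈ D <;> simp [hy, hs]

/-- Dominated convergence. The general filter serves both the truncation level k → ∞ and the
position t of a moving hyperplane. -/
lemma tendsto_lpn_indicator {ι : Type*} {l : Filter ι}
    [l.IsCountablyGenerated] {D : ι → Set (Euc n)} (hD : ∀ i, MeasurableSet (D i))
    (h : ∀ᵐ y, ∀ᶠ i in l, y ∉ D i) {s : ℝ} (hs : 0 < s) {V : Euc n → ℝ≥0∞} (hV : Measurable V)
    (hfin : lpn s V < ∞) : Tendsto (fun i => lpn s ((D i).indicator V)) l (𝓝 0) := by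
  have h1 := tendsto_setLIntegral_of_eventually_notMem hD h (g := fun y => V y ^ s) (by fun_prop)
    ((lpn_lt_top_iff hs _).1 hfin).ne
  have h2 := (ENNReal.continuous_rpow_const (y := 1 / s)).tendsto 0 |>.comp h1
  rw [ENNReal.zero_rpow_of_pos (by positivity)] at h2
  simp_rw [lpn_indicator_rpow hs (hD _)]
  exact h2

/-- **Regularity lifting**: a function dominated by the sum of a contraction applied to itself and
a function in `L^s` is in `L^s`. -/
lemma lpn_lt_top_of_le_contraction {q s : ℝ} (hq : 0 < q) (hs : 1 ≤ s)
    {T : (Euc n → ℝ≥0∞) → Euc n → ℝ≥0∞} {W F : Euc n → ℝ≥0∞}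
    (hTm : ∀ g, Measurable g → Measurable (T g))
    (hTmono : ∀ f g, (∀ x, f x ≤ g x) → ∀ x, T f x ≤ T g x)
    (hTadd : ∀ f g, Measurable f → ∀ x, T (fun y => f y + g y) x = T f x + T g x)
    (hTq : ∀ g, Measurable g → lpn q (T g) ≤ 2⁻¹ * lpn q g)
    (hTs : ∀ g, Measurable g → lpn s (T g) ≤ 2⁻¹ * lpn s g)
    (hW : Measurable W) (hWtop : ∀ x, W x ≠ ∞) (hF : Measurable F) (hWq : lpn q W < ∞)
    (hFs : lpn s F < ∞) (hle : ∀ x, W x ≤ T W x + F x) : lpn s W < ∞ := by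
  have hs0 : 0 < s := by linarith
  -- Iterating W ≤ T W + F gives W ≤ G k + H k, where G k carries the remaining copy of W and H k
  -- the accumulated F. The first tends to 0 geometrically in L^q, the second stays bounded in L^s.
  -- Both estimates are homogeneous, so W need not be known to lie in L^s.
  set G : ℕ → Euc n → ℝ≥0∞ := fun k => T^[k] W with hG
  set H : ℕ → Euc n → ℝ≥0∞ := fun k => (fun g x => T g x + F x)^[k] (fun _ => 0) with hH
  have hGs : ∀ k, G (k + 1) = T (G k) := fun k => Function.iterate_succ_apply' _ _ _
  have hHs : ∀ k, H (k + 1) = fun x => T (H k) x + F x :=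
    fun k => Function.iterate_succ_apply' _ _ _
  have hGm : ∀ k, Measurable (G k) := by
    intro k
    induction k with
    | zero => exact hW
    | succ k ih => rw [hGs]; exact hTm _ ih
  have hHm : ∀ k, Measurable (H k) := by
    intro k
    induction k with
    | zero => exact measurable_const
    | succ k ih => rw [hHs]; exact (hTm _ ih).add hF
  have hGH : ∀ k x, W x ≤ G k x + H k x := by
    intro k
    induction k with
    | zero => intro x; exact le_self_add
    | succ k ih =>
      intro x
      rw [hGs, hHs]
      calc W x ≤ T W x + F x := hle x
        _ ≤ T (fun y => G k y + H k y) x + F x := by gcongr; exact hTmono _ _ ih x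
        _ = _ := by rw [hTadd _ _ (hGm k), add_assoc]
  have hGq : ∀ k, lpn q (G k) ≤ 2⁻¹ ^ k * lpn q W := by
    intro k
    induction k with
    | zero => simp [hG]
    | succ k ih =>
      rw [hGs, pow_succ', mul_assoc]
      exact (hTq _ (hGm k)).trans (by gcongr)
  have hHq : ∀ k, lpn s (H k) ≤ 2 * lpn s F := by
    intro k
    induction k with
    | zero => simp [hH, lpn, hs0]
    | succ k ih =>
      rw [hHs]
      calc _ ≤ lpn s (T (H k)) + lpn s F := lpn_add_le hs (hTm _ (hHm k)) hF
        _ ≤ 2⁻¹ * (2 * lpn s F) + lpn s F := by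
          gcongr
          exact (hTs _ (hHm k)).trans (by gcongr)
        _ = _ := by
          rw [← mul_assoc, ENNReal.inv_mul_cancel two_ne_zero ENNReal.ofNat_ne_top, one_mul,
            two_mul]
  -- The geometric rate makes the sum of the q-th powers integrable, hence finite a.e.; G k
  -- therefore tends to 0 a.e. along the whole sequence.
  have hsum : ∫⁻ x, ∑' k, G k x ^ q < ∞ := by
    rw [lintegral_tsum fun k => ((hGm k).pow_const q).aemeasurable]
    calc ∑' k, ∫⁻ x, G k x ^ q ≤ ∑' k : ℕ, (2⁻¹ ^ q) ^ k * lpn q W ^ q := by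
          refine ENNReal.tsum_le_tsum fun k => ?_
          rw [← lpn_rpow hq]
          calc _ ≤ (2⁻¹ ^ k * lpn q W) ^ q := by gcongr; exact hGq k
            _ = _ := by
              rw [ENNReal.mul_rpow_of_nonneg _ _ hq.le, ← ENNReal.rpow_natCast,
                ← ENNReal.rpow_mul, ← ENNReal.rpow_natCast, ← ENNReal.rpow_mul, mul_comm q]
      _ < ∞ := by
          rw [ENNReal.tsum_mul_right, ENNReal.tsum_geometric]
          refine ENNReal.mul_lt_top ?_ (ENNReal.rpow_lt_top_of_nonneg hq.le hWq.ne)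
          rw [ENNReal.inv_lt_top, tsub_pos_iff_lt]
          exact ENNReal.rpow_lt_one (by simp) hq
  have hGae : ∀ᵐ x, Tendsto (fun k => G k x) atTop (𝓝 0) := by
    have hm : Measurable fun x => ∑' k, G k x ^ q :=
      Measurable.tsum fun k => (hGm k).pow_const q
    filter_upwards [ae_lt_top hm hsum.ne] with x hx
    have h1 := ENNReal.tendsto_atTop_zero_of_tsum_ne_top hx.ne
    have h2 := (ENNReal.continuous_rpow_const (y := 1 / q)).tendsto 0 |>.comp h1
    rw [ENNReal.zero_rpow_of_pos (by positivity)] at h2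
    refine h2.congr fun k => ?_
    simp only [Function.comp_apply]
    rw [← ENNReal.rpow_mul, mul_one_div_cancel hq.ne', ENNReal.rpow_one]
  -- Where W > 0, G k is eventually below W / 2 a.e., so H k is eventually at least W / 2, and Fatou
  -- transfers the L^s bound.
  have hfat : ∫⁻ x, (2⁻¹ * W x) ^ s ≤ (2 * lpn s F) ^ s := by
    calc ∫⁻ x, (2⁻¹ * W x) ^ s ≤ ∫⁻ x, liminf (fun k => H k x ^ s) atTop := by
          refine lintegral_mono_ae ?_
          filter_upwards [hGae] with x hx
          refine le_liminf_of_le (by isBoundedDefault) ?_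
          by_cases hW0 : W x = 0
          · simp [hW0, hs0]
          have hpos : 0 < 2⁻¹ * W x := by
            have : 0 < W x := pos_iff_ne_zero.2 hW0
            exact ENNReal.mul_pos (by simp) this.ne'
          filter_upwards [hx.eventually (gt_mem_nhds hpos)] with k hk
          gcongr
          have h1 := hGH k x
          have h2 : W x = 2⁻¹ * W x + 2⁻¹ * W x := by
            rw [← add_mul, ENNReal.inv_two_add_inv_two, one_mul]
          have h3 : 2⁻¹ * W x + 2⁻¹ * W x ≤ 2⁻¹ * W x + H k x := by
            rw [← h2]
            exact h1.trans (by gcongr)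
          exact (ENNReal.add_le_add_iff_left (ENNReal.mul_ne_top (by simp) (hWtop x))).1 h3
      _ ≤ liminf (fun k => ∫⁻ x, H k x ^ s) atTop :=
          lintegral_liminf_le fun k => (hHm k).pow_const s
      _ ≤ (2 * lpn s F) ^ s := by
          refine liminf_le_of_le (by isBoundedDefault) fun b hb => ?_
          obtain ⟨k, hk⟩ := hb.exists
          refine hk.trans ?_
          rw [← lpn_rpow hs0]
          gcongr
          exact hHq k
  have h4 : lpn s (fun x => 2⁻¹ * W x) < ∞ := by
    rw [lpn_lt_top_iff hs0]
    refine hfat.trans_lt (ENNReal.rpow_lt_top_of_nonneg hs0.le ?_)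
    exact ENNReal.mul_ne_top (by simp) hFs.ne
  rw [lpn_const_mul hs0 _ hW] at h4
  by_contra hcon
  rw [not_lt, top_le_iff] at hcon
  rw [hcon, ENNReal.mul_top (by simp)] at h4
  exact lt_irrefl _ h4

/-- A solution of `W ≤ C₀ I₂(W ^ p)` in the critical space belongs to every `L^s`,
`s > n / (n - 2)`. -/
theorem lpn_lt_top_of_le_pot (hn : 3 ≤ n) {p : ℝ} (hp : 1 < p)
    (hpn : (n : ℝ) / (n - 2) < n * (p - 1) / 2)
    {C₀ : ℝ≥0∞} (hC₀ : C₀ ≠ ∞) {W : Euc n → ℝ≥0∞} (hW : Measurable W) (hWtop : ∀ x, W x ≠ ∞)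
    (hWq : lpn (n * (p - 1) / 2) W < ∞)
    (hle : ∀ x, W x ≤ C₀ * pot ((n : ℝ) - 2) (fun y => W y ^ p) x)
    {s : ℝ} (hs : (n : ℝ) / (n - 2) < s) : lpn s W < ∞ := by
  have hn3 : (3 : ℝ) ≤ n := by exact_mod_cast hn
  have hn2 : (0 : ℝ) < n - 2 := by linarith
  have hn0 : (0 : ℝ) < n := by linarith
  have hp1 : 0 < p - 1 := by linarith
  have hs1 : 1 < s := lt_trans ((one_lt_div hn2).2 (by linarith)) hs
  set q : ℝ := n * (p - 1) / 2 with hq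
  have hq0 : 0 < q := by positivity
  have hV : lpn ((n : ℝ) / 2) (fun y => W y ^ (p - 1)) < ∞ := by
    rw [lpn_lt_top_iff (by positivity)]
    rw [lpn_lt_top_iff hq0] at hWq
    convert hWq using 3 with x
    rw [← ENNReal.rpow_mul, hq]; ring_nf
  obtain ⟨C₁, hC₁, h₁⟩ := exists_lpn_pot_mul_le hn hpn
  obtain ⟨C₂, hC₂, h₂⟩ := exists_lpn_pot_mul_le hn hs
  -- These sets shrink to the empty set because W is finite, so the L^(n/2) norm of W^(p-1) on them
  -- tends to 0. Off D k the function W is bounded by k and the region lies in a ball.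
  set D : ℕ → Set (Euc n) := fun k => {y | (k : ℝ≥0∞) < W y} ∪ {y | (k : ℝ) < ‖y‖} with hD
  have hDm : ∀ k, MeasurableSet (D k) := fun k =>
    (measurableSet_lt measurable_const hW).union (measurableSet_lt measurable_const measurable_norm)
  have htend := tendsto_lpn_indicator hDm (l := atTop) (s := n / 2)
    (V := fun y => W y ^ (p - 1)) (Eventually.of_forall fun y => by
      obtain ⟨k₁, hk₁⟩ := ENNReal.exists_nat_gt (hWtop y)
      obtain ⟨k₂, hk₂⟩ := exists_nat_gt ‖y‖
      filter_upwards [eventually_ge_atTop (max k₁ k₂)] with k hk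
      simp only [hD, Set.mem_union, Set.mem_ofPred_eq, not_or, not_lt]
      refine ⟨hk₁.le.trans ?_, hk₂.le.trans ?_⟩
      · exact_mod_cast (le_max_left _ _).trans hk
      · exact_mod_cast (le_max_right _ _).trans hk) (by positivity) (by fun_prop) hV
  have hCtop : ∀ C : ℝ≥0∞, C ≠ ∞ → ∀ᶠ k in atTop,
      C₀ * (C * lpn ((n : ℝ) / 2) ((D k).indicator fun y => W y ^ (p - 1))) < 2⁻¹ := by
    intro C hC
    have h3 := ENNReal.Tendsto.const_mul htend (Or.inr (ENNReal.mul_ne_top hC₀ hC))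
    rw [mul_zero] at h3
    simp_rw [mul_assoc] at h3
    exact h3.eventually (gt_mem_nhds (by simp))
  obtain ⟨k, hk₁, hk₂⟩ := ((hCtop C₁ hC₁).and (hCtop C₂ hC₂)).exists
  set V := (D k).indicator fun y => W y ^ (p - 1) with hVdef
  have hVm : Measurable V := Measurable.indicator (by fun_prop) (hDm k)
  refine lpn_lt_top_of_le_contraction hq0 hs1.le
    (T := fun g x => C₀ * pot ((n : ℝ) - 2) (fun y => V y * g y) x)
    (F := fun x => C₀ * pot ((n : ℝ) - 2) ((D k)ᶜ.indicator fun y => W y ^ p) x)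
    (fun g hg => by fun_prop) (fun f g h x => ?_) (fun f g hf x => ?_) (fun g hg => ?_)
    (fun g hg => ?_) hW hWtop ?_ hWq ?_ fun x => ?_
  · gcongr
    exact pot_mono (fun y => by gcongr; exact h y) x
  · simp_rw [mul_add]
    rw [pot_add _ (by fun_prop), mul_add]
  · rw [lpn_const_mul hq0 _ (by fun_prop)]
    calc _ ≤ C₀ * (C₁ * (lpn ((n : ℝ) / 2) V * lpn q g)) := by gcongr; exact h₁ _ _ hVm hg
      _ = C₀ * (C₁ * lpn ((n : ℝ) / 2) V) * lpn q g := by ring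
      _ ≤ _ := by gcongr
  · rw [lpn_const_mul (by linarith) _ (by fun_prop)]
    calc _ ≤ C₀ * (C₂ * (lpn ((n : ℝ) / 2) V * lpn s g)) := by gcongr; exact h₂ _ _ hVm hg
      _ = C₀ * (C₂ * lpn ((n : ℝ) / 2) V) * lpn s g := by ring
      _ ≤ _ := by gcongr
  · exact (measurable_pot (Measurable.indicator (by fun_prop) (hDm k).compl)).const_mul _
  · have hind : Measurable ((D k)ᶜ.indicator fun y => W y ^ (p - 1)) :=
      Measurable.indicator (by fun_prop) (hDm k).compl
    have hind' : Measurable ((D k)ᶜ.indicator W) := Measurable.indicator hW (hDm k).compl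
    -- Factoring the remaining source as W^(p-1) times W lets the same L^s estimate apply; W
    -- restricted to the bounded region off D k is in L^s since it is at most k there.
    have hprod : ((D k)ᶜ.indicator fun y => W y ^ p) =
        fun y => (D k)ᶜ.indicator (fun y => W y ^ (p - 1)) y * (D k)ᶜ.indicator W y := by
      ext y
      by_cases hy : y ∈ (D k)ᶜ
      · simp only [Set.indicator_of_mem hy]
        by_cases hy0 : W y = 0
        · rw [hy0, mul_zero, ENNReal.zero_rpow_of_pos (by linarith)]
        · nth_rewrite 3 [← ENNReal.rpow_one (W y)]
          rw [← ENNReal.rpow_add _ _ hy0 (hWtop y)]; ring_nf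
      · simp only [Set.indicator_of_notMem hy, mul_zero]
    rw [hprod, lpn_const_mul (by linarith) _ (by fun_prop)]
    refine ENNReal.mul_lt_top hC₀.lt_top ((h₂ _ _ hind hind').trans_lt ?_)
    refine ENNReal.mul_lt_top hC₂.lt_top (ENNReal.mul_lt_top ?_ ?_)
    · exact (lpn_mono (by positivity) fun y => Set.indicator_le_self _ _ y).trans_lt hV
    · rw [lpn_indicator_rpow (by linarith) (hDm k).compl]
      refine ENNReal.rpow_lt_top_of_nonneg (by positivity) (LT.lt.ne ?_)
      have hsub : (D k)ᶜ ⊆ Metric.closedBall 0 k := by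
        intro y hy
        simp only [hD, Set.mem_compl_iff, Set.mem_union, not_or, Set.mem_ofPred_eq, not_lt] at hy
        simpa using hy.2
      calc ∫⁻ y in (D k)ᶜ, W y ^ s ≤ ∫⁻ y in (D k)ᶜ, (k : ℝ≥0∞) ^ s := by
            refine setLIntegral_mono' (hDm k).compl fun y hy => ?_
            simp only [hD, Set.mem_compl_iff, Set.mem_union, not_or, Set.mem_ofPred_eq,
              not_lt] at hy
            gcongr
            exact hy.1
        _ < ∞ := by
            rw [setLIntegral_const]
            refine ENNReal.mul_lt_top (ENNReal.rpow_lt_top_of_nonneg (by linarith) (by simp))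
              ((measure_mono hsub).trans_lt measure_closedBall_lt_top)
  · refine (hle x).trans ?_
    rw [← mul_add, ← pot_add _ (by fun_prop)]
    gcongr
    refine pot_mono (fun y => ?_) x
    by_cases hy : y ∈ D k
    · have : y ∉ (D k)ᶜ := by simpa using hy
      simp only [hVdef, Set.indicator_of_mem hy, Set.indicator_of_notMem this, add_zero]
      by_cases hy0 : W y = 0
      · rw [hy0, mul_zero, ENNReal.zero_rpow_of_pos (by linarith)]
      · nth_rewrite 3 [← ENNReal.rpow_one (W y)]
        rw [← ENNReal.rpow_add _ _ hy0 (hWtop y)]; ring_nf; rfl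
    · have : y ∈ (D k)ᶜ := by simpa using hy
      simp [hVdef, Set.indicator_of_mem this, Set.indicator_of_notMem hy]

/-! ### Pointwise bounds and decay at the rate of the kernel -/

/-- Potentials of order two are bounded by `L^a` and `L^b` norms with `a < n / 2 < b`. -/
lemma exists_pot_le_lpn_add_lpn (hn : 3 ≤ n) {a b : ℝ} (ha : 1 < a) (han : a < n / 2)
    (hb : n / 2 < b) :
    ∃ C : ℝ≥0∞, C ≠ ∞ ∧ ∀ V : Euc n → ℝ≥0∞, Measurable V → ∀ x,
      pot ((n : ℝ) - 2) V x ≤ C * (lpn a V + lpn b V) := by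
  have hn3 : (3 : ℝ) ≤ n := by exact_mod_cast hn
  have hn2 : (0 : ℝ) < n - 2 := by linarith
  have hn0 : (0 : ℝ) < n := by linarith
  have hb1 : 1 < b := by linarith
  have haa := Real.HolderConjugate.conjExponent ha
  have hbb := Real.HolderConjugate.conjExponent hb1
  set a' := a.conjExponent
  set b' := b.conjExponent
  have ha'0 : 0 < a' := haa.symm.pos
  have hb'0 : 0 < b' := hbb.symm.pos
  have ha' : (n : ℝ) < (n - 2) * a' := by
    have h1 : 1 / a' = 1 - 1 / a := by
      have := haa.inv_add_inv_eq_one; simp only [one_div]; linarith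
    have h2 : 2 / n < 1 / a := by
      rw [div_lt_div_iff₀ hn0 (by linarith)]; linarith
    have h3 : 1 / a' < (n - 2) / n := by rw [h1, sub_div, div_self hn0.ne']; linarith
    rw [div_lt_div_iff₀ ha'0 hn0] at h3
    linarith
  have hb' : (n - 2) * b' < (n : ℝ) := by
    have h1 : 1 / b' = 1 - 1 / b := by
      have := hbb.inv_add_inv_eq_one; simp only [one_div]; linarith
    have h2 : 1 / b < 2 / n := by
      rw [div_lt_div_iff₀ (by linarith) hn0]; linarith
    have h3 : (n - 2) / n < 1 / b' := by rw [h1, sub_div, div_self hn0.ne']; linarith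
    rw [div_lt_div_iff₀ hn0 hb'0] at h3
    linarith
  obtain ⟨A, hA0, hA⟩ := setLIntegral_ball_ker (n := n) (by omega) hb'
  obtain ⟨B, hB0, hB⟩ := setLIntegral_compl_ball_ker (n := n) (by omega) ha'
  have hA1 := hA 1 one_pos
  have hB1 := hB 1 one_pos
  refine ⟨ENNReal.ofReal A ^ (1 / b') + ENNReal.ofReal B ^ (1 / a'), ?_, fun V hV x => ?_⟩
  · exact ENNReal.add_ne_top.2 ⟨ENNReal.rpow_ne_top_of_nonneg (by positivity) ENNReal.ofReal_ne_top,
      ENNReal.rpow_ne_top_of_nonneg (by positivity) ENNReal.ofReal_ne_top⟩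
  -- The kernel is in the dual space of L^b near its pole, because b > n/2, and in that of L^a away
  -- from it, because a < n/2.
  rw [pot_eq_add V (s := Metric.ball 0 1) Metric.isOpen_ball.measurableSet x]
  have near := lintegral_mul_ker_le (κ := (n : ℝ) - 2) hbb hV (s := Metric.ball 0 1)
    Metric.isOpen_ball.measurableSet x
  have far := lintegral_mul_ker_le (κ := (n : ℝ) - 2) haa hV (s := (Metric.ball 0 1)ᶜ)
    Metric.isOpen_ball.measurableSet.compl x
  rw [hA1, Real.one_rpow, mul_one] at near
  rw [hB1, Real.one_rpow, mul_one] at far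
  calc _ ≤ lpn b V * ENNReal.ofReal A ^ (1 / b') + lpn a V * ENNReal.ofReal B ^ (1 / a') :=
        add_le_add near far
    _ ≤ (lpn a V + lpn b V) * ENNReal.ofReal A ^ (1 / b') +
        (lpn a V + lpn b V) * ENNReal.ofReal B ^ (1 / a') := by
        gcongr
        · exact le_add_self
        · exact le_self_add
    _ = _ := by ring

/-- The weight `(1 + ‖x‖) ^ (-θ)` with values in `ℝ≥0∞`. -/
noncomputable def bracket (θ : ℝ) (x : Euc n) : ℝ≥0∞ := ENNReal.ofReal ((1 + ‖x‖) ^ (-θ))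

@[fun_prop]
lemma measurable_bracket (θ : ℝ) : Measurable (bracket θ : Euc n → ℝ≥0∞) := by
  unfold bracket; fun_prop

lemma bracket_rpow (θ : ℝ) {s : ℝ} (hs : 0 ≤ s) (x : Euc n) :
    bracket θ x ^ s = bracket (θ * s) x := by
  unfold bracket
  rw [ENNReal.ofReal_rpow_of_nonneg (by positivity) hs, ← Real.rpow_mul (by positivity)]
  ring_nf

lemma bracket_mono {θ η : ℝ} (h : θ ≤ η) (x : Euc n) : bracket η x ≤ bracket θ x := by
  unfold bracket
  gcongr
  simp

/-- Whenever r dominates 1 + ‖x‖ up to the factor c, a negative power of r can be traded for the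
weight at x. Taking r = 1 bounds the constant 1 by the weight on a bounded region. -/
lemma ofReal_rpow_neg_le_bracket {θ c r : ℝ} (hθ : 0 ≤ θ) (hc : 0 < c) {x : Euc n} (hr : 0 < r)
    (h : 1 + ‖x‖ ≤ c * r) :
    ENNReal.ofReal (r ^ (-θ)) ≤ ENNReal.ofReal (c ^ θ) * bracket θ x := by
  unfold bracket
  rw [← ENNReal.ofReal_mul (by positivity)]
  gcongr
  calc r ^ (-θ) = c ^ θ * (c * r) ^ (-θ) := by
        rw [Real.mul_rpow hc.le hr.le, ← mul_assoc, ← Real.rpow_add hc]; simp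
    _ ≤ _ := by
        gcongr ?_ * ?_
        exact Real.rpow_le_rpow_of_nonpos (by positivity) h (by linarith)

lemma ker_le_of_le {κ r : ℝ} (hκ : 0 ≤ κ) (hr : 0 < r) {z : Euc n} (h : r ≤ ‖z‖) :
    ker κ z ≤ ENNReal.ofReal (r ^ (-κ)) := by
  unfold ker
  exact ENNReal.ofReal_le_ofReal (Real.rpow_le_rpow_of_nonpos hr h (by linarith))

lemma lpn_bracket_lt_top {θ s : ℝ} (hs : 0 < s) (h : n < θ * s) :
    lpn s (bracket θ : Euc n → ℝ≥0∞) < ∞ := by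
  rw [lpn_lt_top_iff hs]
  simp_rw [bracket_rpow θ hs.le]
  exact finite_integral_one_add_norm (by simpa using h)

/-- Contraction estimate for potentials in weighted spaces. -/
lemma exists_pot_mul_bracket_le (hn : 3 ≤ n) {a b : ℝ} (ha : 1 < a) (han : a < n / 2)
    (hb : n / 2 < b) {θ : ℝ} (hθ : 0 < θ) (hθn : θ < n - 2) :
    ∃ C : ℝ≥0∞, C ≠ ∞ ∧ ∀ V : Euc n → ℝ≥0∞, Measurable V → ∀ x,
      pot ((n : ℝ) - 2) (fun y => V y * bracket θ y) x ≤
        C * (lpn a V + lpn b V + lpn ((n : ℝ) / 2) V) * bracket θ x := by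
  have hn3 : (3 : ℝ) ≤ n := by exact_mod_cast hn
  have hn2 : (0 : ℝ) < n - 2 := by linarith
  have hn0 : (0 : ℝ) < n := by linarith
  obtain ⟨C, hC, h⟩ := exists_pot_le_lpn_add_lpn hn ha han hb
  obtain ⟨A, hA0, hA⟩ := setLIntegral_ball_ker (n := n) (κ := θ * (n / (n - 2))) (by omega) (by
    rw [mul_div_assoc', div_lt_iff₀ hn2]; nlinarith)
  have hconj : ((n : ℝ) / 2).HolderConjugate (n / (n - 2)) := by
    rw [Real.holderConjugate_iff]
    refine ⟨by linarith, ?_⟩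
    field_simp; ring
  -- Where 1 + ‖y‖ is at least half of 1 + ‖x‖, the weight at y is bounded by the weight at x and
  -- leaves the integral.
  have outer : ∀ V : Euc n → ℝ≥0∞, Measurable V → ∀ x, ∀ s : Set (Euc n), MeasurableSet s →
      (∀ y ∈ s, 1 + ‖x‖ ≤ 2 * (1 + ‖y‖)) →
      ∫⁻ y in s, V y * bracket θ y * ker ((n : ℝ) - 2) (x - y) ≤
        ENNReal.ofReal (2 ^ θ) * (C * (lpn a V + lpn b V)) * bracket θ x := by
    intro V hV x s hs hsx
    calc _ ≤ ∫⁻ y in s, (ENNReal.ofReal (2 ^ θ) * bracket θ x) *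
            (V y * ker ((n : ℝ) - 2) (x - y)) := by
          refine setLIntegral_mono' hs fun y hy => ?_
          have : bracket θ y ≤ _ :=
            ofReal_rpow_neg_le_bracket hθ.le two_pos (by positivity) (hsx y hy)
          calc _ = bracket θ y * (V y * ker ((n : ℝ) - 2) (x - y)) := by ring
            _ ≤ _ := by gcongr
      _ ≤ (ENNReal.ofReal (2 ^ θ) * bracket θ x) * pot ((n : ℝ) - 2) V x := by
          rw [lintegral_const_mul _ (by fun_prop)]
          gcongr
          exact setLIntegral_le_lintegral _ _
      _ ≤ (ENNReal.ofReal (2 ^ θ) * bracket θ x) * (C * (lpn a V + lpn b V)) := by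
          gcongr; exact h V hV x
      _ = _ := by ring
  set E : ℝ≥0∞ := ENNReal.ofReal (A ^ (((n : ℝ) - 2) / n)) * ENNReal.ofReal (4 ^ θ) with hE
  refine ⟨ENNReal.ofReal (2 ^ θ) * C + E, ?_, fun V hV x => ?_⟩
  · exact ENNReal.add_ne_top.2 ⟨ENNReal.mul_ne_top ENNReal.ofReal_ne_top hC,
      ENNReal.mul_ne_top ENNReal.ofReal_ne_top ENNReal.ofReal_ne_top⟩
  set L := lpn a V + lpn b V + lpn ((n : ℝ) / 2) V with hL
  have hbig : ENNReal.ofReal (2 ^ θ) * (C * (lpn a V + lpn b V)) * bracket θ x ≤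
      ENNReal.ofReal (2 ^ θ) * C * L * bracket θ x := by
    rw [← mul_assoc]
    gcongr
    exact le_self_add
  rcases lt_or_ge ‖x‖ 1 with hx | hx
  · have h1 := outer V hV x Set.univ MeasurableSet.univ (fun y _ => by
      have := norm_nonneg y; linarith)
    rw [Measure.restrict_univ] at h1
    refine (h1.trans hbig).trans ?_
    gcongr
    exact le_self_add
  -- On this ball the kernel is at most (‖x‖/2)^(2-n), and Hölder with exponents n/2 and n/(n-2)
  -- bounds the rest. The condition θ < n - 2 makes |y|^(-θn/(n-2)) locally integrable, contributing
  -- (‖x‖/2)^(n-2-θ); the product is (‖x‖/2)^(-θ).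
  · set s : Set (Euc n) := Metric.ball 0 (‖x‖ / 2) with hs
    have hsm : MeasurableSet s := Metric.isOpen_ball.measurableSet
    have hx2 : 0 < ‖x‖ / 2 := by linarith
    have h1 : ∫⁻ y in sᶜ, V y * bracket θ y * ker ((n : ℝ) - 2) (x - y) ≤
        ENNReal.ofReal (2 ^ θ) * C * L * bracket θ x := by
      refine (outer V hV x _ hsm.compl fun y hy => ?_).trans hbig
      have : ‖x‖ / 2 ≤ ‖y‖ := by simpa [hs] using hy
      linarith
    have h2 : ∫⁻ y in s, V y * bracket θ y * ker ((n : ℝ) - 2) (x - y) ≤ E * L * bracket θ x := by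
      have hker : ∀ y ∈ s, ker ((n : ℝ) - 2) (x - y) ≤
          ENNReal.ofReal ((‖x‖ / 2) ^ (-((n : ℝ) - 2))) := by
        intro y hy
        refine ker_le_of_le hn2.le hx2 ?_
        have h3 : ‖y‖ < ‖x‖ / 2 := by simpa [hs] using hy
        have := norm_sub_norm_le x y
        linarith
      have hhol := ENNReal.lintegral_mul_le_Lp_mul_Lq (volume.restrict s) hconj
        (f := V) (g := bracket θ) (by fun_prop) (by fun_prop)
      have hbr : ∫⁻ y in s, bracket θ y ^ ((n : ℝ) / (n - 2)) ≤
          ENNReal.ofReal (A * (‖x‖ / 2) ^ (n - θ * (n / (n - 2)))) := by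
        rw [← hA _ hx2]
        refine lintegral_mono_ae ?_
        have h1 : ∀ᵐ y ∂(volume : Measure (Euc n)), y ≠ 0 := by
          have : Nonempty (Fin n) := ⟨⟨0, by omega⟩⟩
          simp [ae_iff]
        filter_upwards [ae_restrict_of_ae h1] with y hy
        rw [bracket_rpow θ (by positivity)]
        unfold bracket ker
        refine ENNReal.ofReal_le_ofReal
          (Real.rpow_le_rpow_of_nonpos (norm_pos_iff.2 hy) (by linarith) ?_)
        have : 0 < θ * (n / (n - 2)) := by positivity
        linarith
      calc _ ≤ ∫⁻ y in s, V y * bracket θ y * ENNReal.ofReal ((‖x‖ / 2) ^ (-((n : ℝ) - 2))) := by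
            refine setLIntegral_mono' hsm fun y hy => ?_
            gcongr
            exact hker y hy
        _ = (∫⁻ y in s, V y * bracket θ y) * ENNReal.ofReal ((‖x‖ / 2) ^ (-((n : ℝ) - 2))) := by
            rw [lintegral_mul_const _ (by fun_prop)]
        _ ≤ (lpn ((n : ℝ) / 2) V * ENNReal.ofReal (A * (‖x‖ / 2) ^ (n - θ * (n / (n - 2)))) ^
              (1 / ((n : ℝ) / (n - 2)))) * ENNReal.ofReal ((‖x‖ / 2) ^ (-((n : ℝ) - 2))) := by
            gcongr ?_ * _
            refine hhol.trans ?_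
            unfold lpn
            gcongr
            exact Measure.restrict_le_self
        _ = lpn ((n : ℝ) / 2) V * (ENNReal.ofReal (A ^ (((n : ℝ) - 2) / n)) *
              ENNReal.ofReal ((‖x‖ / 2) ^ (-θ))) := by
            rw [mul_assoc, ENNReal.ofReal_rpow_of_nonneg (by positivity) (by positivity),
              ← ENNReal.ofReal_mul (by positivity), ← ENNReal.ofReal_mul (by positivity),
              Real.mul_rpow hA0 (by positivity), ← Real.rpow_mul hx2.le, mul_assoc,
              ← Real.rpow_add hx2, one_div_div]
            congr 5
            field_simp; ring
        _ ≤ L * (ENNReal.ofReal (A ^ (((n : ℝ) - 2) / n)) *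
              (ENNReal.ofReal (4 ^ θ) * bracket θ x)) := by
            gcongr
            · exact le_add_self
            · exact ofReal_rpow_neg_le_bracket hθ.le (by norm_num) hx2 (by linarith)
        _ = _ := by rw [hE]; ring
    unfold pot
    rw [← lintegral_add_compl _ hsm]
    calc _ ≤ E * L * bracket θ x + ENNReal.ofReal (2 ^ θ) * C * L * bracket θ x := add_le_add h2 h1
      _ = _ := by ring

/-- Potentials of rapidly decaying functions decay like the kernel. -/
lemma exists_pot_bracket_le (hn : 3 ≤ n) {m : ℝ} (hm : n < m) :
    ∃ C : ℝ≥0∞, C ≠ ∞ ∧ ∀ x : Euc n, pot ((n : ℝ) - 2) (bracket m) x ≤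
      C * bracket ((n : ℝ) - 2) x := by
  have hn3 : (3 : ℝ) ≤ n := by exact_mod_cast hn
  have hn2 : (0 : ℝ) < n - 2 := by linarith
  have hn0 : (0 : ℝ) < n := by linarith
  obtain ⟨C, hC, h⟩ := exists_pot_le_lpn_add_lpn hn (a := (1 + n / 2) / 2) (b := n) (by linarith)
    (by linarith) (by linarith)
  have h1 : lpn ((1 + n / 2) / 2) (bracket m : Euc n → ℝ≥0∞) < ∞ :=
    lpn_bracket_lt_top (by linarith) (by nlinarith)
  have h2 : lpn n (bracket m : Euc n → ℝ≥0∞) < ∞ := lpn_bracket_lt_top hn0 (by nlinarith)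
  have h3 : lpn 1 (bracket m : Euc n → ℝ≥0∞) < ∞ := lpn_bracket_lt_top one_pos (by linarith)
  obtain ⟨A, hA0, hA⟩ := setLIntegral_ball_ker (n := n) (κ := (n : ℝ) - 2) (by omega) (by linarith)
  set M := C * (lpn ((1 + n / 2) / 2) (bracket m : Euc n → ℝ≥0∞) +
    lpn n (bracket m : Euc n → ℝ≥0∞)) with hM
  have hMtop : M ≠ ∞ := ENNReal.mul_ne_top hC (ENNReal.add_ne_top.2 ⟨h1.ne, h2.ne⟩)
  set E := ENNReal.ofReal (2 ^ m) * ENNReal.ofReal (A) with hE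
  refine ⟨ENNReal.ofReal (2 ^ ((n : ℝ) - 2)) * M + (E + lpn 1 (bracket m : Euc n → ℝ≥0∞)) *
    ENNReal.ofReal (4 ^ ((n : ℝ) - 2)), ?_, fun x => ?_⟩
  · exact ENNReal.add_ne_top.2 ⟨ENNReal.mul_ne_top ENNReal.ofReal_ne_top hMtop,
      ENNReal.mul_ne_top (ENNReal.add_ne_top.2 ⟨ENNReal.mul_ne_top ENNReal.ofReal_ne_top
        ENNReal.ofReal_ne_top, h3.ne⟩) ENNReal.ofReal_ne_top⟩
  rw [add_mul]
  rcases lt_or_ge ‖x‖ 1 with hx | hx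
  · refine le_add_right ((h _ (by fun_prop) x).trans ?_)
    have h4 := ofReal_rpow_neg_le_bracket (θ := (n : ℝ) - 2) (c := 2) (r := 1) (x := x) hn2.le
      two_pos one_pos (by linarith)
    rw [Real.one_rpow, ENNReal.ofReal_one] at h4
    calc M = M * 1 := (mul_one _).symm
      _ ≤ M * (ENNReal.ofReal (2 ^ ((n : ℝ) - 2)) * bracket ((n : ℝ) - 2) x) := by gcongr
      _ = _ := by ring
  · refine le_add_left ?_
    have hx2 : 0 < ‖x‖ / 2 := by linarith
    have hker : ENNReal.ofReal ((‖x‖ / 2) ^ (-((n : ℝ) - 2))) ≤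
        ENNReal.ofReal (4 ^ ((n : ℝ) - 2)) * bracket ((n : ℝ) - 2) x :=
      ofReal_rpow_neg_le_bracket hn2.le (by norm_num) hx2 (by linarith)
    have hbm : MeasurableSet (Metric.ball (0 : Euc n) (‖x‖ / 2)) :=
      Metric.isOpen_ball.measurableSet
    -- Near x the weight is at most (1 + ‖x‖/2)^(-m) while the kernel integrates to A(‖x‖/2)^2;
    -- since m > n the product is bounded by a multiple of (‖x‖/2)^(2-n). Far from x the kernel
    -- itself has this size and the weight is integrable.
    have near : ∫⁻ y in {y | x - y ∈ Metric.ball (0 : Euc n) (‖x‖ / 2)},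
        bracket m y * ker ((n : ℝ) - 2) (x - y) ≤
        E * ENNReal.ofReal ((‖x‖ / 2) ^ (-((n : ℝ) - 2))) := by
      calc _ ≤ ∫⁻ y in {y | x - y ∈ Metric.ball (0 : Euc n) (‖x‖ / 2)},
            ENNReal.ofReal ((1 + ‖x‖ / 2) ^ (-m)) * ker ((n : ℝ) - 2) (x - y) := by
            refine setLIntegral_mono' (measurableSet_preimage (by fun_prop) hbm) fun y hy => ?_
            have h5 : ‖x - y‖ < ‖x‖ / 2 := by simpa using hy
            have h6 := norm_sub_norm_le x y
            unfold bracket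
            refine mul_le_mul (ENNReal.ofReal_le_ofReal (Real.rpow_le_rpow_of_nonpos (by linarith)
              (by linarith) (by linarith))) le_rfl zero_le zero_le
        _ = ENNReal.ofReal ((1 + ‖x‖ / 2) ^ (-m)) * ENNReal.ofReal (A * (‖x‖ / 2) ^ (2 : ℝ)) := by
            rw [lintegral_const_mul _ (by fun_prop), setLIntegral_ker_sub _ hbm, hA _ hx2]
            ring_nf
        _ ≤ _ := by
            rw [hE, ← ENNReal.ofReal_mul (by positivity), ← ENNReal.ofReal_mul (by positivity),
              ← ENNReal.ofReal_mul (by positivity)]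
            apply ENNReal.ofReal_le_ofReal
            have h7 : (1 + ‖x‖ / 2) ^ (-m) ≤ (‖x‖ / 2) ^ (-(n : ℝ)) * 2 ^ m := by
              calc (1 + ‖x‖ / 2) ^ (-m) = (1 + ‖x‖ / 2) ^ (-(n : ℝ)) *
                    (1 + ‖x‖ / 2) ^ (-(m - n)) := by
                    rw [← Real.rpow_add (by linarith)]; ring_nf
                _ ≤ (‖x‖ / 2) ^ (-(n : ℝ)) * 1 :=
                    mul_le_mul (Real.rpow_le_rpow_of_nonpos hx2 (by linarith) (by linarith))
                      (Real.rpow_le_one_of_one_le_of_nonpos (by linarith) (by linarith))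
                      (by positivity) (by positivity)
                _ ≤ _ := by
                    gcongr
                    exact Real.one_le_rpow one_le_two (by linarith)
            have h8 : (‖x‖ / 2) ^ (-((n : ℝ) - 2)) = (‖x‖ / 2) ^ (-(n : ℝ)) * (‖x‖ / 2) ^ (2 : ℝ) := by
              rw [← Real.rpow_add hx2]; ring_nf
            rw [h8]
            calc _ ≤ ((‖x‖ / 2) ^ (-(n : ℝ)) * 2 ^ m) * (A * (‖x‖ / 2) ^ (2 : ℝ)) := by gcongr
              _ = _ := by ring
    have far : ∫⁻ y in {y | x - y ∈ (Metric.ball (0 : Euc n) (‖x‖ / 2))ᶜ},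
        bracket m y * ker ((n : ℝ) - 2) (x - y) ≤
        lpn 1 (bracket m : Euc n → ℝ≥0∞) * ENNReal.ofReal ((‖x‖ / 2) ^ (-((n : ℝ) - 2))) := by
      calc _ ≤ ∫⁻ y in {y | x - y ∈ (Metric.ball (0 : Euc n) (‖x‖ / 2))ᶜ},
            bracket m y * ENNReal.ofReal ((‖x‖ / 2) ^ (-((n : ℝ) - 2))) := by
            refine setLIntegral_mono' (measurableSet_preimage (by fun_prop) hbm.compl) fun y hy => ?_
            gcongr
            exact ker_le_of_le hn2.le hx2 (by simpa using hy)
        _ ≤ _ := by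
            rw [lintegral_mul_const _ (by fun_prop)]
            gcongr
            unfold lpn
            simp only [ENNReal.rpow_one, div_one]
            exact setLIntegral_le_lintegral _ _
    rw [pot_eq_add _ hbm]
    calc _ ≤ _ := add_le_add near far
      _ = (E + lpn 1 (bracket m : Euc n → ℝ≥0∞)) * ENNReal.ofReal ((‖x‖ / 2) ^ (-((n : ℝ) - 2))) :=
          by ring
      _ ≤ _ := by
          rw [mul_assoc]
          gcongr

lemma lpn_rpow_lt_top {s t : ℝ} (hs : 0 < s) (ht : 0 < t) {W : Euc n → ℝ≥0∞}
    (h : lpn (t * s) W < ∞) : lpn s (fun y => W y ^ t) < ∞ := by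
  rw [lpn_lt_top_iff (by positivity)] at h ⊢
  simpa only [← ENNReal.rpow_mul] using h

/-- A solution of `W ≤ C₀ I₂(W ^ p)` belonging to every `L^s`, `s > n / (n - 2)`, decays
like the kernel. -/
theorem exists_le_bracket_of_le_pot (hn : 3 ≤ n) {p : ℝ} (hp : 1 < p)
    (hpn : (n : ℝ) / (n - 2) < n * (p - 1) / 2)
    {C₀ : ℝ≥0∞} (hC₀ : C₀ ≠ ∞) {W : Euc n → ℝ≥0∞} (hW : Measurable W)
    (hWs : ∀ s : ℝ, (n : ℝ) / (n - 2) < s → lpn s W < ∞)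
    (hle : ∀ x, W x ≤ C₀ * pot ((n : ℝ) - 2) (fun y => W y ^ p) x) :
    ∃ C : ℝ≥0∞, C ≠ ∞ ∧ ∀ x, W x ≤ C * bracket ((n : ℝ) - 2) x := by
  have hn3 : (3 : ℝ) ≤ n := by exact_mod_cast hn
  have hn2 : (0 : ℝ) < n - 2 := by linarith
  have hn0 : (0 : ℝ) < n := by linarith
  have hp1 : 0 < p - 1 := by linarith
  have hp2 : 2 < (n - 2) * (p - 1) := by
    rw [div_lt_iff₀ hn2] at hpn
    have : (n : ℝ) * 2 < n * ((n - 2) * (p - 1)) := by linarith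
    exact lt_of_mul_lt_mul_left this hn0.le
  have hpn' : (n : ℝ) / (n - 2) < p := by
    rw [div_lt_iff₀ hn2]; linarith
  -- The midpoint of a nonempty interval: a < n/2 while W^(p-1) belongs to L^s for all s ≥ a. The
  -- interval is nonempty because (n-2)(p-1) > 2.
  set a : ℝ := (max 1 (n / ((n - 2) * (p - 1))) + n / 2) / 2 with ha
  have hmax : max 1 (n / ((n - 2) * (p - 1))) < (n : ℝ) / 2 := by
    refine max_lt (by linarith) ?_
    rw [div_lt_div_iff₀ (by positivity) two_pos]
    gcongr
  have han : a < n / 2 := by linarith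
  have ha1 : 1 < a := by
    have := le_max_left 1 (n / ((n - 2) * (p - 1)))
    linarith
  have ha2 : n / ((n - 2) * (p - 1)) < a := by
    have := le_max_right 1 (n / ((n - 2) * (p - 1)))
    linarith
  have hb : (n : ℝ) / 2 < n := by linarith
  have hVs : ∀ s : ℝ, a ≤ s → lpn s (fun y => W y ^ (p - 1)) < ∞ := by
    intro s hs
    refine lpn_rpow_lt_top (by linarith) hp1 (hWs _ ?_)
    have h1 := ha2.trans_le hs
    rw [div_lt_iff₀ (by positivity)] at h1 ⊢
    linarith
  have hWp : ∀ s : ℝ, 1 ≤ s → lpn s (fun y => W y ^ p) < ∞ := by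
    intro s hs
    exact lpn_rpow_lt_top (by linarith) (by linarith) (hWs _ (hpn'.trans_le (by nlinarith)))
  obtain ⟨C₁, hC₁, h₁⟩ := exists_pot_le_lpn_add_lpn hn ha1 han hb
  obtain ⟨M, hM, hWM⟩ : ∃ M : ℝ≥0∞, M ≠ ∞ ∧ ∀ x, W x ≤ M :=
    ⟨C₀ * (C₁ * (lpn a (fun y => W y ^ p) + lpn n (fun y => W y ^ p))),
      ENNReal.mul_ne_top hC₀ (ENNReal.mul_ne_top hC₁ (ENNReal.add_ne_top.2
        ⟨(hWp _ ha1.le).ne, (hWp _ (by linarith)).ne⟩)), fun x => (hle x).trans (by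
          gcongr
          exact h₁ _ (by fun_prop) x)⟩
  have hWtop : ∀ x, W x ≠ ∞ := fun x => ((hWM x).trans_lt hM.lt_top).ne
  -- The upper limit n - 2 is needed for the weighted contraction, the lower limit n/p so that W^p
  -- decays faster than order n once W decays at order θ. The interval is nonempty because p >
  -- n/(n-2).
  obtain ⟨θ, hθ1, hθ2⟩ : ∃ θ : ℝ, n / p < θ ∧ θ < n - 2 := by
    refine exists_between ?_
    rw [div_lt_iff₀ hn2] at hpn'
    rw [div_lt_iff₀ (by linarith)]
    linarith
  have hθ0 : 0 < θ := lt_trans (by positivity) hθ1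
  obtain ⟨C₂, hC₂, h₂⟩ := exists_pot_mul_bracket_le hn ha1 han hb hθ0 hθ2
  obtain ⟨C₃, hC₃, h₃⟩ := exists_pot_bracket_le hn (m := n + 1) (by linarith)
  set D : ℕ → Set (Euc n) := fun k => {y | (k : ℝ) < ‖y‖} with hD
  have hDm : ∀ k, MeasurableSet (D k) := fun k => measurableSet_lt measurable_const measurable_norm
  have htend : ∀ s : ℝ, a ≤ s →
      Tendsto (fun k => lpn s ((D k).indicator fun y => W y ^ (p - 1))) atTop (𝓝 0) := by
    intro s hs
    refine tendsto_lpn_indicator hDm (Eventually.of_forall fun y => ?_) (by linarith)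
      (by fun_prop) (hVs s hs)
    obtain ⟨k₂, hk₂⟩ := exists_nat_gt ‖y‖
    filter_upwards [eventually_ge_atTop k₂] with k hk
    simp only [hD, Set.mem_ofPred_eq, not_lt]
    exact hk₂.le.trans (by exact_mod_cast hk)
  have hsmall : ∀ᶠ k in atTop, C₀ * ((C₁ + C₂) *
      (lpn a ((D k).indicator fun y => W y ^ (p - 1)) +
        lpn n ((D k).indicator fun y => W y ^ (p - 1)) +
        lpn ((n : ℝ) / 2) ((D k).indicator fun y => W y ^ (p - 1)))) < 2⁻¹ := by
    have h4 := ((htend a le_rfl).add (htend n (by linarith))).add (htend (n / 2) han.le)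
    have h5 := ENNReal.Tendsto.const_mul h4
      (Or.inr (ENNReal.mul_ne_top hC₀ (ENNReal.add_ne_top.2 ⟨hC₁, hC₂⟩)))
    simp only [add_zero, mul_zero, mul_assoc] at h5
    exact h5.eventually (gt_mem_nhds (by simp))
  obtain ⟨k, hk⟩ := hsmall.exists
  set V := (D k).indicator fun y => W y ^ (p - 1) with hV
  have hVm : Measurable V := Measurable.indicator (by fun_prop) (hDm k)
  have hT1 : ∀ x, C₀ * pot ((n : ℝ) - 2) V x ≤ 2⁻¹ := by
    intro x
    refine le_trans ?_ hk.le
    gcongr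
    exact (h₁ V hVm x).trans (mul_le_mul' le_self_add le_self_add)
  have hTθ : ∀ x, C₀ * pot ((n : ℝ) - 2) (fun y => V y * bracket θ y) x ≤ 2⁻¹ * bracket θ x := by
    intro x
    calc _ ≤ C₀ * (C₂ * (lpn a V + lpn n V + lpn ((n : ℝ) / 2) V) * bracket θ x) := by
          gcongr
          exact h₂ V hVm x
      _ ≤ C₀ * ((C₁ + C₂) * (lpn a V + lpn n V + lpn ((n : ℝ) / 2) V) * bracket θ x) := by
          gcongr
          exact le_add_self
      _ = C₀ * ((C₁ + C₂) * (lpn a V + lpn n V + lpn ((n : ℝ) / 2) V)) * bracket θ x := by ring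
      _ ≤ _ := by gcongr
  obtain ⟨CF, hCF, hF⟩ : ∃ CF : ℝ≥0∞, CF ≠ ∞ ∧ ∀ x,
      C₀ * pot ((n : ℝ) - 2) ((D k)ᶜ.indicator fun y => W y ^ p) x ≤ CF * bracket θ x := by
    set B := M ^ p * ENNReal.ofReal ((1 + k : ℝ) ^ ((n : ℝ) + 1)) with hB
    have hBt : B ≠ ∞ := ENNReal.mul_ne_top (ENNReal.rpow_ne_top_of_nonneg (by linarith) hM)
      ENNReal.ofReal_ne_top
    refine ⟨C₀ * (B * C₃), ENNReal.mul_ne_top hC₀ (ENNReal.mul_ne_top hBt hC₃), fun x => ?_⟩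
    calc _ ≤ C₀ * pot ((n : ℝ) - 2) (fun y => B * bracket ((n : ℝ) + 1) y) x := by
          gcongr
          refine pot_mono (fun y => ?_) x
          by_cases hy : y ∈ (D k)ᶜ
          · rw [Set.indicator_of_mem hy, hB, mul_assoc]
            have hyk : ‖y‖ ≤ k := by simpa [hD] using hy
            have h5 := ofReal_rpow_neg_le_bracket (θ := (n : ℝ) + 1) (c := 1 + k) (r := 1) (x := y)
              (by linarith) (by positivity) one_pos (by linarith)
            rw [Real.one_rpow, ENNReal.ofReal_one] at h5
            calc W y ^ p = W y ^ p * 1 := (mul_one _).symm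
              _ ≤ _ := by gcongr; exact hWM y
          · rw [Set.indicator_of_notMem hy]; exact zero_le
      _ ≤ C₀ * (B * (C₃ * bracket ((n : ℝ) - 2) x)) := by
          rw [pot_const_mul _ (by fun_prop)]
          gcongr
          exact h₃ x
      _ ≤ C₀ * (B * (C₃ * bracket θ x)) := by gcongr; exact bracket_mono hθ2.le x
      _ = _ := by ring
  have hstep : ∀ x, W x ≤ C₀ * pot ((n : ℝ) - 2) (fun y => V y * W y) x + CF * bracket θ x := by
    intro x
    calc W x ≤ _ := hle x
      _ ≤ C₀ * pot ((n : ℝ) - 2) (fun y => V y * W y) x +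
          C₀ * pot ((n : ℝ) - 2) ((D k)ᶜ.indicator fun y => W y ^ p) x := by
          rw [← mul_add, ← pot_add _ (by fun_prop)]
          gcongr
          refine pot_mono (fun y => ?_) x
          by_cases hy : y ∈ D k
          · have : y ∉ (D k)ᶜ := by simpa using hy
            simp only [hV, Set.indicator_of_mem hy, Set.indicator_of_notMem this, add_zero]
            by_cases hy0 : W y = 0
            · rw [hy0, mul_zero, ENNReal.zero_rpow_of_pos (by linarith)]
            · nth_rewrite 3 [← ENNReal.rpow_one (W y)]
              rw [← ENNReal.rpow_add _ _ hy0 (hWtop y)]; ring_nf; rfl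
          · have : y ∈ (D k)ᶜ := by simpa using hy
            simp [hV, Set.indicator_of_mem this, Set.indicator_of_notMem hy]
      _ ≤ _ := add_le_add le_rfl (hF x)
  -- The contraction halves both the constant term and the weighted term, and 2 * CF is the fixed
  -- point of c ↦ c/2 + CF. Starting from the sup bound M avoids assuming any decay of W; letting j
  -- → ∞ removes M.
  have hiter : ∀ (j : ℕ) (x), W x ≤ 2⁻¹ ^ j * M + 2 * CF * bracket θ x := by
    intro j
    induction j with
    | zero => intro x; rw [pow_zero, one_mul]; exact le_add_right (hWM x)
    | succ j ih =>
      intro x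
      calc W x ≤ _ := hstep x
        _ ≤ C₀ * pot ((n : ℝ) - 2) (fun y => V y * (2⁻¹ ^ j * M + 2 * CF * bracket θ y)) x +
            CF * bracket θ x := by
            gcongr
            exact pot_mono (fun y => by gcongr; exact ih y) x
        _ = 2⁻¹ ^ j * M * (C₀ * pot ((n : ℝ) - 2) V x) + 2 * CF *
            (C₀ * pot ((n : ℝ) - 2) (fun y => V y * bracket θ y) x) + CF * bracket θ x := by
            have : (fun y => V y * (2⁻¹ ^ j * M + 2 * CF * bracket θ y)) =
                fun y => 2⁻¹ ^ j * M * V y + 2 * CF * (V y * bracket θ y) := by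
              ext y; ring
            rw [this, pot_add _ (by fun_prop), pot_const_mul _ hVm, pot_const_mul _ (by fun_prop)]
            ring
        _ ≤ 2⁻¹ ^ j * M * 2⁻¹ + 2 * CF * (2⁻¹ * bracket θ x) + CF * bracket θ x := by
            exact add_le_add (add_le_add (mul_le_mul' le_rfl (hT1 x))
              (mul_le_mul' le_rfl (hTθ x))) le_rfl
        _ = _ := by
            have : 2 * CF * (2⁻¹ * bracket θ x) = (2 * 2⁻¹) * (CF * bracket θ x) := by ring
            rw [this, ENNReal.mul_inv_cancel two_ne_zero ENNReal.ofNat_ne_top, pow_succ]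
            ring
  have hdecay : ∀ x, W x ≤ 2 * CF * bracket θ x := by
    intro x
    have h6 : Tendsto (fun j : ℕ => (2⁻¹ : ℝ≥0∞) ^ j * M + 2 * CF * bracket θ x) atTop
        (𝓝 (0 * M + 2 * CF * bracket θ x)) := by
      refine Tendsto.add (ENNReal.Tendsto.mul_const ?_ (Or.inr hM)) tendsto_const_nhds
      exact ENNReal.tendsto_pow_atTop_nhds_zero_of_lt_one (by simp)
    rw [zero_mul, zero_add] at h6
    exact ge_of_tendsto' h6 fun j => hiter j x
  -- Since θp > n, a single further application of the inequality raises the decay from order θ to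
  -- order n - 2.
  obtain ⟨C₄, hC₄, h₄⟩ := exists_pot_bracket_le hn (m := θ * p) (by
    rwa [div_lt_iff₀ (by linarith)] at hθ1)
  have hK : (2 * CF) ^ p ≠ ∞ := ENNReal.rpow_ne_top_of_nonneg (by linarith)
    (ENNReal.mul_ne_top (by simp) hCF)
  refine ⟨C₀ * ((2 * CF) ^ p * C₄), ENNReal.mul_ne_top hC₀ (ENNReal.mul_ne_top hK hC₄), fun x => ?_⟩
  calc W x ≤ _ := hle x
    _ ≤ C₀ * pot ((n : ℝ) - 2) (fun y => (2 * CF) ^ p * bracket (θ * p) y) x := by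
        gcongr
        refine pot_mono (fun y => ?_) x
        rw [← bracket_rpow θ (by linarith), ← ENNReal.mul_rpow_of_nonneg _ _ (by linarith)]
        gcongr
        exact hdecay y
    _ ≤ C₀ * ((2 * CF) ^ p * (C₄ * bracket ((n : ℝ) - 2) x)) := by
        rw [pot_const_mul _ (by fun_prop)]
        gcongr
        exact h₄ x
    _ = _ := by ring

/-! ### Transfer to real functions and continuity of potentials -/

lemma memLp_iff_lpn_lt_top {w : Euc n → ℝ} (hw : Measurable w) (hw0 : ∀ x, 0 ≤ w x) {s : ℝ}
    (hs : 0 < s) :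
    MemLp w (ENNReal.ofReal s) volume ↔ lpn s (fun x => ENNReal.ofReal (w x)) < ∞ := by
  have : eLpNorm w (ENNReal.ofReal s) volume = lpn s (fun x => ENNReal.ofReal (w x)) := by
    rw [eLpNorm_eq_lintegral_rpow_enorm_toReal (by simpa using hs) ENNReal.ofReal_ne_top,
      ENNReal.toReal_ofReal hs.le]
    simp_rw [Real.enorm_of_nonneg (hw0 _)]
    rfl
  rw [MemLp, this]
  exact ⟨fun h => h.2, fun h => ⟨hw.aestronglyMeasurable, h⟩⟩

/-- Newtonian potentials of bounded integrable functions are continuous. -/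
lemma continuous_integral_div_norm_pow (hn : 3 ≤ n) {f : Euc n → ℝ}
    (hfi : Integrable f) {M : ℝ} (hfM : ∀ y, |f y| ≤ M)
    (hi : ∀ x, Integrable (fun y => f y / ‖x - y‖ ^ (n - 2))) :
    Continuous fun x => ∫ y, f y / ‖x - y‖ ^ (n - 2) := by
  obtain ⟨A, hA0, hA⟩ := setLIntegral_ball_ker (n := n) (κ := (n : ℝ) - 2) (by omega) (by linarith)
  have hM : 0 ≤ M := (abs_nonneg _).trans (hfM 0)
  have hmax : ∀ (δ : ℝ), 0 < δ → ∀ z : Euc n, 0 < (max ‖z‖ δ) ^ (n - 2) := by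
    intro δ hδ z
    exact pow_pos (lt_max_of_lt_right hδ) _
  have hbound : ∀ (δ : ℝ), 0 < δ → ∀ x y : Euc n,
      ‖f y / (max ‖x - y‖ δ) ^ (n - 2)‖ ≤ |f y| / δ ^ (n - 2) := by
    intro δ hδ x y
    rw [norm_div, Real.norm_eq_abs, Real.norm_of_nonneg (hmax δ hδ _).le]
    gcongr
    exact le_max_right _ _
  have hmeas : ∀ (δ : ℝ), ∀ x : Euc n,
      AEStronglyMeasurable (fun y => f y / (max ‖x - y‖ δ) ^ (n - 2)) volume := by
    intro δ x
    refine (hfi.aestronglyMeasurable.aemeasurable.div ?_).aestronglyMeasurable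
    exact Measurable.aemeasurable (by fun_prop)
  have hint : ∀ (δ : ℝ), 0 < δ → ∀ x : Euc n,
      Integrable (fun y => f y / (max ‖x - y‖ δ) ^ (n - 2)) := by
    intro δ hδ x
    exact (hfi.abs.div_const _).mono' (hmeas δ x) (Eventually.of_forall (hbound δ hδ x))
  have hcont : ∀ (δ : ℝ), 0 < δ →
      Continuous fun x : Euc n => ∫ y, f y / (max ‖x - y‖ δ) ^ (n - 2) := by
    intro δ hδ
    refine continuous_of_dominated (hmeas δ)
      (fun x => Eventually.of_forall (hbound δ hδ x)) (hfi.abs.div_const _)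
      (Eventually.of_forall fun y => ?_)
    exact Continuous.div (by fun_prop) (by fun_prop) fun x => (hmax δ hδ _).ne'
  -- Flattening the kernel inside radius δ gives a continuous potential and changes the value by at
  -- most M times the kernel mass of a δ-ball, of order δ^2 uniformly in x.
  have hdist : ∀ (δ : ℝ), 0 < δ → ∀ x : Euc n,
      dist (∫ y, f y / ‖x - y‖ ^ (n - 2)) (∫ y, f y / (max ‖x - y‖ δ) ^ (n - 2)) ≤
        M * (A * δ ^ (2 : ℝ)) := by
    intro δ hδ x
    have hbm : MeasurableSet (Metric.ball (0 : Euc n) δ) := Metric.isOpen_ball.measurableSet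
    have hbm' : MeasurableSet {y | x - y ∈ Metric.ball (0 : Euc n) δ} :=
      measurableSet_preimage (by fun_prop) hbm
    rw [dist_eq_norm, ← integral_sub (hi x) (hint δ hδ x),
      ← ENNReal.ofReal_le_ofReal_iff (by positivity), ofReal_norm]
    refine (enorm_integral_le_lintegral_enorm _).trans ?_
    calc _ ≤ ∫⁻ y, ENNReal.ofReal M * {y | x - y ∈ Metric.ball (0 : Euc n) δ}.indicator
            (fun y => ker ((n : ℝ) - 2) (x - y)) y := by
          refine lintegral_mono_ae ?_
          have h1 : ∀ᵐ y ∂(volume : Measure (Euc n)), y ≠ x := by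
            have : Nonempty (Fin n) := ⟨⟨0, by omega⟩⟩
            simp [ae_iff]
          filter_upwards [h1] with y hy
          have hpos : 0 < ‖x - y‖ := norm_pos_iff.2 (sub_ne_zero.2 (Ne.symm hy))
          by_cases hyd : ‖x - y‖ < δ
          · have hmem : y ∈ {y | x - y ∈ Metric.ball (0 : Euc n) δ} := by simpa using hyd
            rw [Set.indicator_of_mem hmem, max_eq_right hyd.le, ← ofReal_norm,
              ← ofReal_div_norm_pow (by omega) hM]
            apply ENNReal.ofReal_le_ofReal
            rw [div_eq_mul_inv, div_eq_mul_inv, ← mul_sub, norm_mul, Real.norm_eq_abs,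
              Real.norm_eq_abs, div_eq_mul_inv]
            have h2 : (δ ^ (n - 2))⁻¹ ≤ (‖x - y‖ ^ (n - 2))⁻¹ := by gcongr
            have h3 : 0 ≤ (δ ^ (n - 2))⁻¹ := by positivity
            rw [abs_of_nonneg (a := (‖x - y‖ ^ (n - 2))⁻¹ - _) (by linarith)]
            gcongr
            · exact hfM y
            · linarith
          · rw [max_eq_left (not_lt.1 hyd), sub_self, enorm_zero]
            exact zero_le
      _ = ENNReal.ofReal (M * (A * δ ^ (2 : ℝ))) := by
          rw [lintegral_const_mul _ (Measurable.indicator (by fun_prop) hbm'),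
            lintegral_indicator hbm', setLIntegral_ker_sub _ hbm, hA δ hδ,
            ← ENNReal.ofReal_mul hM]
          ring_nf
  have hunif : TendstoUniformly (fun (j : ℕ) (x : Euc n) =>
      ∫ y, f y / (max ‖x - y‖ (1 / ((j : ℝ) + 1))) ^ (n - 2))
      (fun x => ∫ y, f y / ‖x - y‖ ^ (n - 2)) atTop := by
    rw [Metric.tendstoUniformly_iff]
    intro ε hε
    have h1 : Tendsto (fun j : ℕ => M * (A * (1 / ((j : ℝ) + 1) : ℝ) ^ (2 : ℝ))) atTop (𝓝 0) := by
      have h2 := ((Real.continuous_rpow_const (q := 2) two_pos.le).tendsto 0).comp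
        (tendsto_one_div_add_atTop_nhds_zero_nat (𝕜 := ℝ))
      rw [Real.zero_rpow two_ne_zero] at h2
      simpa using (h2.const_mul A).const_mul M
    filter_upwards [h1.eventually (gt_mem_nhds hε)] with j hj x
    exact (hdist _ (by positivity) x).trans_lt hj
  exact hunif.continuous (Frequently.of_forall fun j => hcont _ (by positivity))

end RieszPotential

/-! ### Integrability, decay and continuity of solutions -/

namespace IsPositiveSolution

open RieszPotential

variable {n : ℕ} {p c₁ c₂ : ℝ} {u v : EuclideanSpace ℝ (Fin n) → ℝ}

/-- The lower bound c (1+‖x‖)^(2-n) is not in L^s for s ≤ n/(n-2), so the integrability assumed of u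
can hold only at a larger exponent. -/
lemma critical_exponent_lt (h : IsPositiveSolution n p c₁ c₂ u v) (hn : 3 ≤ n) (hp : 1 < p)
    (hc₁ : 0 < c₁) (hu : MemLp u (ENNReal.ofReal ((n : ℝ) * (p - 1) / 2)) volume) :
    (n : ℝ) / (n - 2) < n * (p - 1) / 2 := by
  have hn3 : (3 : ℝ) ≤ n := by exact_mod_cast hn
  by_contra! hcon
  obtain ⟨c, hc, hle⟩ := h.exists_le_left (by omega) hc₁ hu.1
  refine not_memLp_of_le (by omega) (by linarith) hc (s := n * (p - 1) / 2) ?_ ?_ hle hu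
  · have : 0 < p - 1 := by linarith
    positivity
  · rwa [le_div_iff₀ (by linarith), mul_comm] at hcon

/-- Writing u^p = u^(p-1) u with u^(p-1) in L^(n/2), the critical potential estimate passes the
integrability of u on to v. -/
lemma lpn_right_lt_top (h : IsPositiveSolution n p c₁ c₂ u v) (hn : 3 ≤ n) (hp : 1 < p)
    (hc₁ : 0 < c₁) (hc₂ : 0 < c₂)
    (hu : MemLp u (ENNReal.ofReal ((n : ℝ) * (p - 1) / 2)) volume) :
    lpn (n * (p - 1) / 2) (fun x => ENNReal.ofReal (v x)) < ∞ := by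
  have hn3 : (3 : ℝ) ≤ n := by exact_mod_cast hn
  have hp1 : 0 < p - 1 := by linarith
  have hq : 0 < (n : ℝ) * (p - 1) / 2 := by positivity
  have hum := h.measurable_left hu.1
  have hU := (memLp_iff_lpn_lt_top hum (fun x => (h.u_pos x).le) hq).1 hu
  obtain ⟨C, hC, hCle⟩ := exists_lpn_pot_mul_le hn (h.critical_exponent_lt hn hp hc₁ hu)
  have hfun : (fun x => ENNReal.ofReal (v x)) = fun x => ENNReal.ofReal c₂ * pot ((n : ℝ) - 2)
      (fun y => ENNReal.ofReal (u y) ^ (p - 1) * ENNReal.ofReal (u y)) x := by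
    ext x
    rw [h.ofReal_right_eq (by omega) hc₂ x]
    congr 3 with y
    rw [ENNReal.ofReal_rpow_of_pos (h.u_pos y), ← ENNReal.ofReal_mul
      (Real.rpow_pos_of_pos (h.u_pos y) _).le, ← Real.rpow_add_one (h.u_pos y).ne']
    ring_nf
  rw [hfun, lpn_const_mul hq _ (by fun_prop)]
  refine ENNReal.mul_lt_top ENNReal.ofReal_lt_top ((hCle _ _ (by fun_prop) (by fun_prop)).trans_lt
    (ENNReal.mul_lt_top hC.lt_top (ENNReal.mul_lt_top ?_ hU)))
  refine lpn_rpow_lt_top (by positivity) hp1 ?_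
  convert hU using 1
  ring_nf

/-- Both sources are at most (u + v)^p, which reduces the system to one scalar inequality for W = u
+ v. -/
lemma ofReal_add_le_pot (h : IsPositiveSolution n p c₁ c₂ u v) (hn : 3 ≤ n) (hp : 1 < p)
    (hc₁ : 0 < c₁) (hc₂ : 0 < c₂) (x) :
    ENNReal.ofReal (u x) + ENNReal.ofReal (v x) ≤ (ENNReal.ofReal c₁ + ENNReal.ofReal c₂) *
      pot ((n : ℝ) - 2) (fun y => (ENNReal.ofReal (u y) + ENNReal.ofReal (v y)) ^ p) x := by
  rw [h.ofReal_left_eq (by omega) hc₁, h.ofReal_right_eq (by omega) hc₂, add_mul]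
  have hp1 : 0 < p - 1 := by linarith
  gcongr
  · refine pot_mono (fun y => ?_) x
    have hne : ENNReal.ofReal (u y) + ENNReal.ofReal (v y) ≠ 0 := by
      simpa using fun h' => absurd h' (not_le.2 (h.u_pos y))
    have hsplit : (ENNReal.ofReal (u y) + ENNReal.ofReal (v y)) ^ p =
        (ENNReal.ofReal (u y) + ENNReal.ofReal (v y)) ^ (p - 1) *
        (ENNReal.ofReal (u y) + ENNReal.ofReal (v y)) := by
      nth_rewrite 3 [← ENNReal.rpow_one (ENNReal.ofReal (u y) + ENNReal.ofReal (v y))]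
      rw [← ENNReal.rpow_add _ _ hne (by simp)]
      ring_nf
    rw [hsplit, ENNReal.ofReal_mul (Real.rpow_pos_of_pos (h.u_pos y) _).le,
      ← ENNReal.ofReal_rpow_of_pos (h.u_pos y)]
    gcongr
    · exact le_self_add
    · exact le_add_self
  · refine pot_mono (fun y => ?_) x
    rw [← ENNReal.ofReal_rpow_of_pos (h.u_pos y)]
    gcongr
    exact le_self_add

lemma lpn_add_lt_top (h : IsPositiveSolution n p c₁ c₂ u v) (hn : 3 ≤ n) (hp : 1 < p)
    (hc₁ : 0 < c₁) (hc₂ : 0 < c₂)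
    (hu : MemLp u (ENNReal.ofReal ((n : ℝ) * (p - 1) / 2)) volume) {s : ℝ}
    (hs : (n : ℝ) / (n - 2) < s) :
    lpn s (fun x => ENNReal.ofReal (u x) + ENNReal.ofReal (v x)) < ∞ := by
  have hn3 : (3 : ℝ) ≤ n := by exact_mod_cast hn
  have hum := h.measurable_left hu.1
  have hvm := h.measurable_right hu.1
  have hpn := h.critical_exponent_lt hn hp hc₁ hu
  have hq1 : 1 < (n : ℝ) * (p - 1) / 2 :=
    lt_trans ((one_lt_div (by linarith)).2 (by linarith)) hpn
  have hq : 0 < (n : ℝ) * (p - 1) / 2 := by linarith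
  have hU := (memLp_iff_lpn_lt_top hum (fun x => (h.u_pos x).le) hq).1 hu
  refine lpn_lt_top_of_le_pot hn hp hpn
    (C₀ := ENNReal.ofReal c₁ + ENNReal.ofReal c₂) (by simp) (by fun_prop) (by simp)
    ?_ (h.ofReal_add_le_pot hn hp hc₁ hc₂) hs
  exact (lpn_add_le hq1.le (by fun_prop) (by fun_prop)).trans_lt
    (ENNReal.add_lt_top.2 ⟨hU, h.lpn_right_lt_top hn hp hc₁ hc₂ hu⟩)

lemma memLp_of_lt (h : IsPositiveSolution n p c₁ c₂ u v) (hn : 3 ≤ n) (hp : 1 < p)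
    (hc₁ : 0 < c₁) (hc₂ : 0 < c₂)
    (hu : MemLp u (ENNReal.ofReal ((n : ℝ) * (p - 1) / 2)) volume) {s : ℝ}
    (hs : (n : ℝ) / (n - 2) < s) :
    MemLp u (ENNReal.ofReal s) volume ∧ MemLp v (ENNReal.ofReal s) volume := by
  have hn3 : (3 : ℝ) ≤ n := by exact_mod_cast hn
  have hs0 : 0 < s := lt_trans (div_pos (by linarith) (by linarith)) hs
  have hW := h.lpn_add_lt_top hn hp hc₁ hc₂ hu hs
  rw [memLp_iff_lpn_lt_top (h.measurable_left hu.1) (fun x => (h.u_pos x).le) hs0,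
    memLp_iff_lpn_lt_top (h.measurable_right hu.1) (fun x => (h.v_pos x).le) hs0]
  exact ⟨(lpn_mono hs0 fun x => le_self_add).trans_lt hW,
    (lpn_mono hs0 fun x => le_add_self).trans_lt hW⟩

lemma not_memLp_of_le (h : IsPositiveSolution n p c₁ c₂ u v) (hn : 3 ≤ n)
    (hc₁ : 0 < c₁) (hc₂ : 0 < c₂) (hu : AEStronglyMeasurable u volume) {s : ℝ} (hs0 : 0 < s)
    (hs : s ≤ (n : ℝ) / (n - 2)) :
    ¬ MemLp u (ENNReal.ofReal s) volume ∧ ¬ MemLp v (ENNReal.ofReal s) volume := by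
  have hn3 : (3 : ℝ) ≤ n := by exact_mod_cast hn
  obtain ⟨c, hc, hle⟩ := h.exists_le_left (by omega) hc₁ hu
  obtain ⟨d, hd, hled⟩ := h.exists_le_right (by omega) hc₂ hu
  rw [le_div_iff₀ (by linarith), mul_comm] at hs
  exact ⟨RieszPotential.not_memLp_of_le (by omega) (by linarith) hc hs0 hs hle,
    RieszPotential.not_memLp_of_le (by omega) (by linarith) hd hs0 hs hled⟩

lemma exists_add_le (h : IsPositiveSolution n p c₁ c₂ u v) (hn : 3 ≤ n) (hp : 1 < p)
    (hc₁ : 0 < c₁) (hc₂ : 0 < c₂)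
    (hu : MemLp u (ENNReal.ofReal ((n : ℝ) * (p - 1) / 2)) volume) :
    ∃ C : ℝ, 0 ≤ C ∧ ∀ x, u x + v x ≤ C * (1 + ‖x‖) ^ (-((n : ℝ) - 2)) := by
  have hum := h.measurable_left hu.1
  have hvm := h.measurable_right hu.1
  obtain ⟨C, hC, hle⟩ := exists_le_bracket_of_le_pot hn hp (h.critical_exponent_lt hn hp hc₁ hu)
    (C₀ := ENNReal.ofReal c₁ + ENNReal.ofReal c₂) (by simp)
    (W := fun x => ENNReal.ofReal (u x) + ENNReal.ofReal (v x)) (by fun_prop)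
    (fun s hs => h.lpn_add_lt_top hn hp hc₁ hc₂ hu hs) (h.ofReal_add_le_pot hn hp hc₁ hc₂)
  refine ⟨C.toReal, ENNReal.toReal_nonneg, fun x => ?_⟩
  rw [← ENNReal.ofReal_le_ofReal_iff (by positivity), ENNReal.ofReal_mul ENNReal.toReal_nonneg,
    ENNReal.ofReal_toReal hC, ENNReal.ofReal_add (h.u_pos x).le (h.v_pos x).le]
  exact hle x

lemma tendsto_of_le {w : EuclideanSpace ℝ (Fin n) → ℝ} (hn : 3 ≤ n) (hw : ∀ x, 0 < w x) {C : ℝ}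
    (hC : ∀ x, w x ≤ C * (1 + ‖x‖) ^ (-((n : ℝ) - 2))) :
    Tendsto w (cocompact (EuclideanSpace ℝ (Fin n))) (𝓝 0) := by
  have hn3 : (3 : ℝ) ≤ n := by exact_mod_cast hn
  refine tendsto_of_tendsto_of_tendsto_of_le_of_le tendsto_const_nhds ?_ (fun x => (hw x).le) hC
  have h1 : Tendsto (fun x : EuclideanSpace ℝ (Fin n) => 1 + ‖x‖)
      (cocompact (EuclideanSpace ℝ (Fin n))) atTop :=
    tendsto_atTop_add_const_left _ _ (tendsto_norm_cocompact_atTop)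
  have h2 := (tendsto_rpow_neg_atTop (y := (n : ℝ) - 2) (by linarith)).comp h1
  simpa using h2.const_mul C

lemma integrable_source {f : EuclideanSpace ℝ (Fin n) → ℝ} {C : ℝ} (hf : Measurable f)
    (hf0 : ∀ x, 0 < f x) {m : ℝ} (hm : n < m) (hC : ∀ x, f x ≤ C * (1 + ‖x‖) ^ (-m)) :
    Integrable f := by
  have h1 : Integrable (fun x : EuclideanSpace ℝ (Fin n) => (1 + ‖x‖) ^ (-m)) :=
    integrable_one_add_norm (by simpa using hm)
  refine (h1.const_mul C).mono' hf.aestronglyMeasurable (Eventually.of_forall fun x => ?_)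
  rw [Real.norm_of_nonneg (hf0 x).le]
  exact hC x

/-- Decay of order n - 2 together with (n-2)p > n makes both sources bounded and integrable, so
their potentials are continuous. -/
lemma continuous_left_right (h : IsPositiveSolution n p c₁ c₂ u v) (hn : 3 ≤ n) (hp : 1 < p)
    (hc₁ : 0 < c₁) (hc₂ : 0 < c₂)
    (hu : MemLp u (ENNReal.ofReal ((n : ℝ) * (p - 1) / 2)) volume) :
    Continuous u ∧ Continuous v := by
  have hn3 : (3 : ℝ) ≤ n := by exact_mod_cast hn
  have hum := h.measurable_left hu.1
  have hvm := h.measurable_right hu.1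
  obtain ⟨C, hC0, hC⟩ := h.exists_add_le hn hp hc₁ hc₂ hu
  have hm : (n : ℝ) < (n - 2) * p := by
    have := h.critical_exponent_lt hn hp hc₁ hu
    rw [div_lt_iff₀ (by linarith)] at this
    have h2 : (n : ℝ) * 2 < n * ((n - 2) * (p - 1)) := by linarith
    have := lt_of_mul_lt_mul_left h2 (by linarith)
    linarith
  have hpow : ∀ x, (u x + v x) ^ p ≤ C ^ p * (1 + ‖x‖) ^ (-(((n : ℝ) - 2) * p)) := by
    intro x
    have := (add_pos (h.u_pos x) (h.v_pos x)).le
    calc (u x + v x) ^ p ≤ (C * (1 + ‖x‖) ^ (-((n : ℝ) - 2))) ^ p := by gcongr; exact hC x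
      _ = _ := by
        rw [Real.mul_rpow hC0 (by positivity), ← Real.rpow_mul (by positivity), neg_mul]
  have hbd : ∀ x, (u x + v x) ^ p ≤ C ^ p := by
    intro x
    refine (hpow x).trans (mul_le_of_le_one_right (by positivity) ?_)
    exact Real.rpow_le_one_of_one_le_of_nonpos (by simp) (by nlinarith)
  have hl : ∀ x, u x ^ (p - 1) * v x ≤ (u x + v x) ^ p := by
    intro x
    have h1 := h.u_pos x
    have h2 := h.v_pos x
    have h3 : (u x + v x) ^ p = (u x + v x) ^ (p - 1) * (u x + v x) := by
      rw [← Real.rpow_add_one (by positivity)]; ring_nf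
    rw [h3]
    have hp1 : 0 ≤ p - 1 := by linarith
    gcongr <;> linarith
  have hr : ∀ x, u x ^ p ≤ (u x + v x) ^ p := by
    intro x
    have h1 := h.u_pos x
    have h2 := h.v_pos x
    gcongr
    linarith
  constructor
  · have : u = fun x => c₁ * ∫ y, u y ^ (p - 1) * v y / ‖x - y‖ ^ (n - 2) := funext h.u_eq
    rw [this]
    refine continuous_const.mul (continuous_integral_div_norm_pow hn
      (integrable_source (by fun_prop) h.left_source_pos hm fun x => (hl x).trans (hpow x))
      (M := C ^ p) (fun y => ?_) fun x => ?_)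
    · rw [abs_of_pos (h.left_source_pos y)]
      exact (hl y).trans (hbd y)
    · exact (integrable_and_ofReal_eq (by omega) (fun y => (h.left_source_pos y).le) hc₁
        (h.u_pos x) (h.u_eq x)).1
  · have : v = fun x => c₂ * ∫ y, u y ^ p / ‖x - y‖ ^ (n - 2) := funext h.v_eq
    rw [this]
    refine continuous_const.mul (continuous_integral_div_norm_pow hn
      (integrable_source (by fun_prop) h.right_source_pos hm fun x => (hr x).trans (hpow x))
      (M := C ^ p) (fun y => ?_) fun x => ?_)
    · rw [abs_of_pos (h.right_source_pos y)]
      exact (hr y).trans (hbd y)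
    · exact (integrable_and_ofReal_eq (by omega) (fun y => (h.right_source_pos y).le) hc₂
        (h.v_pos x) (h.v_eq x)).1

/-- The upper bound for v and the lower bound for u have the same rate. This comparison allows
u^(p-1) alone to control the increments of u^(p-1) v in the moving plane argument. -/
lemma exists_right_le_mul_left (h : IsPositiveSolution n p c₁ c₂ u v) (hn : 3 ≤ n) (hp : 1 < p)
    (hc₁ : 0 < c₁) (hc₂ : 0 < c₂)
    (hu : MemLp u (ENNReal.ofReal ((n : ℝ) * (p - 1) / 2)) volume) :
    ∃ C : ℝ, 0 ≤ C ∧ ∀ x, v x ≤ C * u x := by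
  obtain ⟨C, hC0, hC⟩ := h.exists_add_le hn hp hc₁ hc₂ hu
  obtain ⟨c, hc, hle⟩ := h.exists_le_left (by omega) hc₁ hu.1
  refine ⟨C / c, by positivity, fun x => ?_⟩
  calc v x ≤ C * (1 + ‖x‖) ^ (-((n : ℝ) - 2)) := by have := hC x; have := h.u_pos x; linarith
    _ = C / c * (c * (1 + ‖x‖) ^ (-((n : ℝ) - 2))) := by field_simp
    _ ≤ _ := by gcongr; exact hle x

end IsPositiveSolution

/-! ### Reflections and the method of moving planes -/

namespace MovingPlane

open RieszPotential

variable {n : ℕ}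

/-- Reflection in the hyperplane `⟪e, x⟫ = t`. -/
noncomputable def refl (e : Euc n) (t : ℝ) (x : Euc n) : Euc n := x + (2 * (t - inner ℝ e x)) • e

/-- The half space `t < ⟪e, x⟫`. -/
def half (e : Euc n) (t : ℝ) : Set (Euc n) := {x | t < inner ℝ e x}

lemma measurableSet_half (e : Euc n) (t : ℝ) : MeasurableSet (half e t) :=
  measurableSet_lt measurable_const (by fun_prop)

lemma isOpen_half (e : Euc n) (t : ℝ) : IsOpen (half e t) :=
  isOpen_lt continuous_const (by fun_prop)

@[fun_prop]
lemma continuous_refl (e : Euc n) (t : ℝ) : Continuous (refl e t) := by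
  unfold refl; fun_prop

lemma continuous_refl_param (e x : Euc n) : Continuous fun t => refl e t x := by
  unfold refl; fun_prop

variable {e : Euc n}

lemma inner_refl (he : ‖e‖ = 1) (t : ℝ) (x : Euc n) :
    inner ℝ e (refl e t x) = 2 * t - inner ℝ e x := by
  unfold refl
  rw [inner_add_right, inner_smul_right, real_inner_self_eq_norm_sq, he]
  ring

lemma refl_refl (he : ‖e‖ = 1) (t : ℝ) (x : Euc n) : refl e t (refl e t x) = x := by
  have h := inner_refl he t x
  rw [refl, h, refl, add_assoc, ← add_smul]
  ring_nf
  simp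

lemma refl_of_inner_eq {t : ℝ} {x : Euc n} (h : inner ℝ e x = t) : refl e t x = x := by
  simp [refl, h]

/-- The added term is positive exactly when x and y lie strictly on the same side of the hyperplane;
this is what orders the kernel against its reflection. -/
lemma norm_sub_refl_sq (he : ‖e‖ = 1) (t : ℝ) (x y : Euc n) :
    ‖x - refl e t y‖ ^ 2 = ‖x - y‖ ^ 2 + 4 * (inner ℝ e x - t) * (inner ℝ e y - t) := by
  have h : x - refl e t y = (x - y) - (2 * (t - inner ℝ e y)) • e := by unfold refl; abel
  rw [h, norm_sub_sq_real, inner_smul_right, norm_smul, he, real_inner_comm e (x - y),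
    inner_sub_right, mul_one, Real.norm_eq_abs, sq_abs]
  ring

lemma norm_refl_sub_refl (he : ‖e‖ = 1) (t : ℝ) (x y : Euc n) :
    ‖refl e t x - refl e t y‖ = ‖x - y‖ := by
  have h := norm_sub_refl_sq he t (refl e t x) y
  rw [norm_sub_rev (refl e t x) y, norm_sub_refl_sq he t y x, inner_refl he] at h
  rw [← sq_eq_sq₀ (norm_nonneg _) (norm_nonneg _), h, norm_sub_rev x y]
  ring

lemma norm_refl_sub (he : ‖e‖ = 1) (t : ℝ) (x y : Euc n) :
    ‖refl e t x - y‖ = ‖x - refl e t y‖ := by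
  rw [← norm_refl_sub_refl he t x, refl_refl he]

lemma measurePreserving_refl (he : ‖e‖ = 1) (t : ℝ) :
    MeasurePreserving (refl e t) (volume : Measure (Euc n)) volume := by
  have h : refl e t = (fun x => (2 * t) • e - x) ∘ (Submodule.reflection (Submodule.span ℝ {e})) := by
    ext1 x
    simp only [Function.comp_apply, Submodule.reflection_singleton_apply, he, refl]
    simp only [RCLike.ofReal_real_eq_id, id_eq, one_pow, div_one]
    module
  rw [h]
  exact (Measure.measurePreserving_sub_left volume _).comp
    (LinearIsometryEquiv.measurePreserving _)

lemma ae_inner_ne (he : ‖e‖ = 1) (t : ℝ) : ∀ᵐ y : Euc n, inner ℝ e y ≠ t := by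
  have h0 : volume ((LinearMap.ker (innerSL ℝ e).toLinearMap : Submodule ℝ (Euc n)) : Set (Euc n))
      = 0 := by
    refine Measure.addHaar_submodule _ _ fun htop => ?_
    have : e ∈ LinearMap.ker (innerSL ℝ e).toLinearMap := by rw [htop]; trivial
    have h1 : inner ℝ e e = (0 : ℝ) := this
    rw [real_inner_self_eq_norm_sq, he] at h1
    norm_num at h1
  rw [ae_iff]
  have hset : {y : Euc n | ¬ inner ℝ e y ≠ t} = (fun y => y + -(t • e)) ⁻¹'
      ((LinearMap.ker (innerSL ℝ e).toLinearMap : Submodule ℝ (Euc n)) : Set (Euc n)) := by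
    ext y
    simp only [ne_eq, not_not, Set.mem_ofPred_eq, Set.mem_preimage, SetLike.mem_coe,
      LinearMap.mem_ker, ContinuousLinearMap.coe_coe, innerSL_apply_apply, inner_add_right,
      inner_neg_right, inner_smul_right, real_inner_self_eq_norm_sq, he]
    constructor <;> intro h <;> linarith
  rw [hset, measure_preimage_add_right, h0]

/-- The integrand in the reflection formula for a Newtonian potential. -/
noncomputable def gap (e : Euc n) (t : ℝ) (f : Euc n → ℝ) (x y : Euc n) : ℝ :=
  (1 / ‖x - y‖ ^ (n - 2) - 1 / ‖x - refl e t y‖ ^ (n - 2)) * (f y - f (refl e t y))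

/-- Reflecting the variable of integration expresses the difference through f and its reflection.
The gap is invariant under the reflection, so the integral over the whole space counts each half
space once, hence the division by 2. -/
lemma integrable_gap_and_eq (he : ‖e‖ = 1) (t : ℝ) {f : Euc n → ℝ}
    (hf : ∀ x, Integrable (fun y => f y / ‖x - y‖ ^ (n - 2))) (x : Euc n) :
    Integrable (gap e t f x) ∧
    (∫ y, f y / ‖x - y‖ ^ (n - 2)) - ∫ y, f y / ‖refl e t x - y‖ ^ (n - 2) =
      (∫ y, gap e t f x y) / 2 := by
  have hmp := measurePreserving_refl he t
  have hemb : MeasurableEmbedding (refl e t) :=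
    (Homeomorph.mk ⟨refl e t, refl e t, refl_refl he t, refl_refl he t⟩
      (continuous_refl e t) (continuous_refl e t)).measurableEmbedding
  have i1 := hf x
  have i2 : Integrable (fun y => f (refl e t y) / ‖x - refl e t y‖ ^ (n - 2)) :=
    (hmp.integrable_comp_emb hemb).2 i1
  have i3 : Integrable (fun y => f y / ‖x - refl e t y‖ ^ (n - 2)) := by
    simpa only [norm_refl_sub he] using hf (refl e t x)
  have i4 : Integrable (fun y => f (refl e t y) / ‖x - y‖ ^ (n - 2)) := by
    have := (hmp.integrable_comp_emb hemb).2 i3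
    simpa only [Function.comp_def, refl_refl he] using this
  have e2 : ∫ y, f (refl e t y) / ‖x - refl e t y‖ ^ (n - 2) = ∫ y, f y / ‖x - y‖ ^ (n - 2) :=
    hmp.integral_comp hemb (fun y => f y / ‖x - y‖ ^ (n - 2))
  have e4 : ∫ y, f (refl e t y) / ‖x - y‖ ^ (n - 2) =
      ∫ y, f y / ‖x - refl e t y‖ ^ (n - 2) := by
    have := hmp.integral_comp hemb (fun y => f y / ‖x - refl e t y‖ ^ (n - 2))
    simpa only [refl_refl he] using this
  have hgap : gap e t f x = fun y => (f y / ‖x - y‖ ^ (n - 2) - f y / ‖x - refl e t y‖ ^ (n - 2)) -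
      (f (refl e t y) / ‖x - y‖ ^ (n - 2) -
        f (refl e t y) / ‖x - refl e t y‖ ^ (n - 2)) := by
    ext y; unfold gap; ring
  have heq : ∫ y, gap e t f x y =
      ((∫ y, f y / ‖x - y‖ ^ (n - 2)) - ∫ y, f y / ‖x - refl e t y‖ ^ (n - 2)) -
      ((∫ y, f (refl e t y) / ‖x - y‖ ^ (n - 2)) -
        ∫ y, f (refl e t y) / ‖x - refl e t y‖ ^ (n - 2)) := by
    rw [hgap]
    exact (integral_sub (i1.sub i3) (i4.sub i2)).trans
      (congrArg₂ (· - ·) (integral_sub i1 i3) (integral_sub i4 i2))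
  refine ⟨hgap ▸ (i1.sub i3).sub (i4.sub i2), ?_⟩
  rw [heq, e2, e4]
  simp only [norm_refl_sub he]
  ring

lemma ae_ne_and_refl_ne (hn : 0 < n) (e : Euc n) (he : ‖e‖ = 1) (t : ℝ) (x : Euc n) :
    ∀ᵐ y : Euc n, y ≠ x ∧ refl e t y ≠ x := by
  have : Nonempty (Fin n) := ⟨⟨0, hn⟩⟩
  have h1 : ∀ᵐ y ∂(volume : Measure (Euc n)), y ≠ x := by simp [ae_iff]
  have h2 : ∀ᵐ y ∂(volume : Measure (Euc n)), y ≠ refl e t x := by simp [ae_iff]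
  filter_upwards [h1, h2] with y hy1 hy2
  refine ⟨hy1, fun h => hy2 ?_⟩
  rw [← h, refl_refl he]

lemma kernel_lt (hn : 3 ≤ n) (he : ‖e‖ = 1) {t : ℝ} {x y : Euc n} (hx : x ∈ half e t)
    (hy : y ∈ half e t) (hyx : y ≠ x) :
    1 / ‖x - refl e t y‖ ^ (n - 2) < 1 / ‖x - y‖ ^ (n - 2) := by
  have hx : t < inner ℝ e x := hx
  have hy : t < inner ℝ e y := hy
  have hpos : 0 < ‖x - y‖ := norm_pos_iff.2 (sub_ne_zero.2 (Ne.symm hyx))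
  have hlt : ‖x - y‖ < ‖x - refl e t y‖ := by
    rw [← sq_lt_sq₀ (norm_nonneg _) (norm_nonneg _), norm_sub_refl_sq he]
    have : 0 < (inner ℝ e x - t) * (inner ℝ e y - t) := mul_pos (by linarith) (by linarith)
    linarith
  exact one_div_lt_one_div_of_lt (by positivity)
    (pow_lt_pow_left₀ hlt (norm_nonneg _) (by omega))

lemma gap_refl (he : ‖e‖ = 1) (t : ℝ) (f : Euc n → ℝ) (x y : Euc n) :
    gap e t f x (refl e t y) = gap e t f x y := by
  unfold gap; rw [refl_refl he]; ring

/-- For two points beyond the hyperplane the kernel difference lies between 0 and the kernel, so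
only the positive part of the increment of f matters. -/
lemma gap_le (hn : 3 ≤ n) (he : ‖e‖ = 1) {t : ℝ} {f : Euc n → ℝ} {g : Euc n → ℝ≥0∞}
    (hfg : ∀ y ∈ half e t, ENNReal.ofReal (f y - f (refl e t y)) ≤ g y) {x y : Euc n}
    (hx : x ∈ half e t) (hy : y ∈ half e t) (hyx : y ≠ x) :
    ENNReal.ofReal (gap e t f x y) ≤ g y * RieszPotential.ker ((n : ℝ) - 2) (x - y) := by
  have hk := kernel_lt hn he hx hy hyx
  have hle : gap e t f x y ≤ max (f y - f (refl e t y)) 0 / ‖x - y‖ ^ (n - 2) := by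
    unfold gap
    have h1 : 0 ≤ 1 / ‖x - refl e t y‖ ^ (n - 2) := by positivity
    calc _ ≤ (1 / ‖x - y‖ ^ (n - 2) - 1 / ‖x - refl e t y‖ ^ (n - 2)) *
          max (f y - f (refl e t y)) 0 := by
          refine mul_le_mul_of_nonneg_left (le_max_left _ _) (by linarith)
      _ ≤ 1 / ‖x - y‖ ^ (n - 2) * max (f y - f (refl e t y)) 0 := by
          refine mul_le_mul_of_nonneg_right (by linarith) (le_max_right _ _)
      _ = _ := by ring
  refine (ENNReal.ofReal_le_ofReal hle).trans ?_
  rw [ofReal_div_norm_pow (by omega) (le_max_right _ _)]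
  gcongr
  rw [ENNReal.ofReal_max]
  simpa using hfg y hy

/-- Comparison of a potential with its reflection. -/
lemma ofReal_sub_refl_le (hn : 3 ≤ n) (he : ‖e‖ = 1) {t : ℝ} {f w : Euc n → ℝ} {c : ℝ} (hc : 0 ≤ c)
    (hf : ∀ x, Integrable (fun y => f y / ‖x - y‖ ^ (n - 2)))
    (hw : ∀ x, w x = c * ∫ y, f y / ‖x - y‖ ^ (n - 2)) {g : Euc n → ℝ≥0∞} (hg : Measurable g)
    (hfg : ∀ y ∈ half e t, ENNReal.ofReal (f y - f (refl e t y)) ≤ g y) {x : Euc n}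
    (hx : x ∈ half e t) :
    ENNReal.ofReal (w x - w (refl e t x)) ≤ ENNReal.ofReal c * pot ((n : ℝ) - 2) g x := by
  obtain ⟨hint, heq⟩ := integrable_gap_and_eq he t hf x
  rw [hw, hw, ← mul_sub, heq, ENNReal.ofReal_mul hc, ENNReal.ofReal_div_of_pos two_pos]
  gcongr
  have hmp := measurePreserving_refl he t
  have h1 : ENNReal.ofReal (∫ y, gap e t f x y) ≤ ∫⁻ y, ENNReal.ofReal (gap e t f x y) := by
    rw [integral_eq_lintegral_pos_part_sub_lintegral_neg_part hint]
    refine (ENNReal.ofReal_le_ofReal (sub_le_self _ ENNReal.toReal_nonneg)).trans ?_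
    exact ENNReal.ofReal_toReal_le
  set h : Euc n → ℝ≥0∞ := fun y => g y * RieszPotential.ker ((n : ℝ) - 2) (x - y) with hh
  have hhm : Measurable h := by fun_prop
  -- The function g controls increments only beyond the hyperplane. For y on the other side the gap
  -- is evaluated at the reflected point, which explains the second term; the two integrals are
  -- equal and cancel the division by 2.
  have h2 : ∫⁻ y, ENNReal.ofReal (gap e t f x y) ≤ ∫⁻ y, (h y + h (refl e t y)) := by
    refine lintegral_mono_ae ?_
    filter_upwards [ae_ne_and_refl_ne (by omega) e he t x, ae_inner_ne he t] with y hy hyt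
    rcases lt_or_gt_of_ne hyt with hlt | hgt
    · have hmem : refl e t y ∈ half e t := by
        simp only [half, Set.mem_ofPred_eq, inner_refl he]; linarith
      rw [← gap_refl he]
      exact (gap_le hn he hfg hx hmem hy.2).trans le_add_self
    · exact (gap_le hn he hfg hx hgt hy.1).trans le_self_add
  rw [lintegral_add_left hhm, hmp.lintegral_comp hhm, ← two_mul] at h2
  refine ENNReal.div_le_of_le_mul ((h1.trans h2).trans_eq ?_)
  rw [mul_comm]
  simp [pot, hh]

/-- Strong comparison principle for a potential and its reflection. -/
lemma eq_refl_of_eq_refl (hn : 3 ≤ n) (he : ‖e‖ = 1) {t : ℝ} {f w : Euc n → ℝ} {c : ℝ} (hc : 0 < c)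
    (hfc : Continuous f)
    (hf : ∀ x, Integrable (fun y => f y / ‖x - y‖ ^ (n - 2)))
    (hw : ∀ x, w x = c * ∫ y, f y / ‖x - y‖ ^ (n - 2))
    (hfg : ∀ y ∈ half e t, f y ≤ f (refl e t y)) {x : Euc n}
    (hx : x ∈ half e t) (hwx : w x = w (refl e t x)) : ∀ y ∈ half e t, f y = f (refl e t y) := by
  obtain ⟨hint, heq⟩ := integrable_gap_and_eq he t hf x
  have hzero : ∫ y, gap e t f x y = 0 := by
    rw [hw, hw] at hwx
    have := mul_left_cancel₀ hc.ne' hwx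
    linarith
  have hnonpos : ∀ y ∈ half e t, y ≠ x → gap e t f x y ≤ 0 := by
    intro y hy hyx
    have := kernel_lt hn he hx hy hyx
    exact mul_nonpos_of_nonneg_of_nonpos (by linarith) (by linarith [hfg y hy])
  have hae : 0 ≤ᵐ[volume] fun y => - gap e t f x y := by
    filter_upwards [ae_ne_and_refl_ne (by omega) e he t x, ae_inner_ne he t] with y hy hyt
    rcases lt_or_gt_of_ne hyt with hlt | hgt
    · have hmem : refl e t y ∈ half e t := by
        simp only [half, Set.mem_ofPred_eq, inner_refl he]; linarith
      rw [← gap_refl he]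
      simpa using hnonpos _ hmem hy.2
    · simpa using hnonpos _ hgt hy.1
  have hz := (integral_eq_zero_iff_of_nonneg_ae hae hint.neg).1
    (by simp only [integral_neg, hzero, neg_zero])
  intro y hy
  by_contra hne
  -- The gap has one sign and zero integral, hence vanishes a.e., while its kernel factor is
  -- strictly positive beyond the hyperplane. This open set is therefore null, hence empty.
  set U := {y ∈ half e t | f y ≠ f (refl e t y)} with hU
  have hUo : IsOpen U :=
    (isOpen_half e t).inter (isOpen_ne_fun hfc (hfc.comp (continuous_refl e t)))
  have hUpos := hUo.measure_pos volume ⟨y, hy, hne⟩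
  refine hUpos.ne' ?_
  refine measure_mono_null (t := {y | ¬ (y ∈ U → False)}) (fun z hz => by simpa using hz) ?_
  rw [← ae_iff]
  filter_upwards [hz, ae_ne_and_refl_ne (by omega) e he t x] with z hz hzx hzU
  have hk := kernel_lt hn he hx hzU.1 hzx.1
  simp only [Pi.zero_apply, neg_eq_zero, gap, mul_eq_zero] at hz
  rcases hz with hz | hz
  · linarith
  · exact hzU.2 (by linarith)

/-- For q ≤ 1 one has s ≤ s^q on [0, 1]; for q ≥ 1 this is Bernoulli's inequality. The relative form
also covers p < 2, where a^(p-1) is not Lipschitz at 0. -/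
lemma one_sub_rpow_le {q s : ℝ} (hq : 0 < q) (hs0 : 0 ≤ s) (hs1 : s ≤ 1) :
    1 - s ^ q ≤ max 1 q * (1 - s) := by
  rcases le_total q 1 with h | h
  · rw [max_eq_left h, one_mul]
    have := Real.rpow_le_rpow_of_exponent_ge' hs0 hs1 hq.le h
    rw [Real.rpow_one] at this
    linarith
  · rw [max_eq_right h]
    have := one_add_mul_self_le_rpow_one_add (s := s - 1) (by linarith) h
    rw [add_sub_cancel] at this
    linarith

/-- Lipschitz estimate for the nonlinearity `a ^ (p - 1) * b`. -/
lemma rpow_mul_sub_rpow_mul_le {p C a a' b b' : ℝ} (hp : 1 < p) (hC : 0 ≤ C) (ha : 0 < a)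
    (ha' : 0 < a') (hb' : 0 < b') (hba : b ≤ C * a) :
    a ^ (p - 1) * b - a' ^ (p - 1) * b' ≤
      (max 1 (p - 1) * C + 1) * a ^ (p - 1) * (max (a - a') 0 + max (b - b') 0) := by
  have hp1 : 0 < p - 1 := by linarith
  have hA : 0 < a ^ (p - 1) := Real.rpow_pos_of_pos ha _
  set A := a ^ (p - 1) with hAdef
  have hm : 0 ≤ max 1 (p - 1) := le_trans zero_le_one (le_max_left _ _)
  have hb0 : 0 ≤ max (b - b') 0 := le_max_right _ _
  have ha0 : 0 ≤ max (a - a') 0 := le_max_right _ _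
  rcases le_or_gt a a' with h | h
  · have h1 : A ≤ a' ^ (p - 1) := by rw [hAdef]; gcongr
    calc A * b - a' ^ (p - 1) * b' ≤ A * b - A * b' := by gcongr
      _ = A * (b - b') := by ring
      _ ≤ A * max (b - b') 0 := by gcongr; exact le_max_left _ _
      _ = 1 * A * (0 + max (b - b') 0) := by ring
      _ ≤ _ := by
          have : 0 ≤ max 1 (p - 1) * C := by positivity
          gcongr
          linarith
  · have h1 : a' ^ (p - 1) ≤ A := by rw [hAdef]; gcongr
    -- The bound b ≤ C a supplies the factor a that makes the increment of the (p-1)-th power linear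
    -- in a - a', with coefficient a constant multiple of A.
    have h2 : A * a - a' ^ (p - 1) * a ≤ max 1 (p - 1) * A * (a - a') := by
      have h3 := one_sub_rpow_le hp1 (s := a' / a) (by positivity)
        ((div_le_one ha).2 h.le)
      rw [Real.div_rpow ha'.le ha.le, ← hAdef] at h3
      have h4 : A * a - a' ^ (p - 1) * a = A * a * (1 - a' ^ (p - 1) / A) := by field_simp
      have h5 : max 1 (p - 1) * A * (a - a') = A * a * (max 1 (p - 1) * (1 - a' / a)) := by
        field_simp
      rw [h4, h5]
      gcongr
    calc A * b - a' ^ (p - 1) * b' = (A - a' ^ (p - 1)) * b + a' ^ (p - 1) * (b - b') := by ring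
      _ ≤ (A - a' ^ (p - 1)) * (C * a) + A * max (b - b') 0 := by
          have : 0 ≤ A - a' ^ (p - 1) := by linarith
          have h6 : a' ^ (p - 1) * (b - b') ≤ A * max (b - b') 0 :=
            (mul_le_mul_of_nonneg_left (le_max_left _ _)
              (Real.rpow_pos_of_pos ha' _).le).trans (mul_le_mul_of_nonneg_right h1 hb0)
          gcongr
      _ = C * (A * a - a' ^ (p - 1) * a) + A * max (b - b') 0 := by ring
      _ ≤ C * (max 1 (p - 1) * A * (a - a')) + A * max (b - b') 0 := by gcongr
      _ ≤ C * (max 1 (p - 1) * A * max (a - a') 0) + A * max (b - b') 0 := by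
          gcongr; exact le_max_left _ _
      _ ≤ _ := by
          have : 0 ≤ A * max (a - a') 0 + max 1 (p - 1) * C * A * max (b - b') 0 := by positivity
          nlinarith

/-- Continuous decaying solutions with comparable components, for which `u ^ (p - 1)` is integrable
with exponents on both sides of `n / 2`. -/
structure IsDecayingSolution (n : ℕ) (p c₁ c₂ : ℝ) (u v : EuclideanSpace ℝ (Fin n) → ℝ) :
    Prop where
  three_le : 3 ≤ n
  one_lt : 1 < p
  left_const_pos : 0 < c₁
  right_const_pos : 0 < c₂
  sol : IsPositiveSolution n p c₁ c₂ u v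
  continuous_left : Continuous u
  continuous_right : Continuous v
  tendsto_left : Tendsto u (cocompact (EuclideanSpace ℝ (Fin n))) (𝓝 0)
  bounded : ∃ M : ℝ, ∀ x, u x ≤ M ∧ v x ≤ M
  comparable : ∃ C : ℝ, 0 ≤ C ∧ ∀ x, v x ≤ C * u x
  integrability : ∃ a b : ℝ, 1 < a ∧ a < n / 2 ∧ n / 2 < b ∧
    lpn a (fun x => ENNReal.ofReal (u x ^ (p - 1))) < ∞ ∧
    lpn b (fun x => ENNReal.ofReal (u x ^ (p - 1))) < ∞

/-- Both functions are dominated by their reflections in the half space. -/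
def Dominated (u v : Euc n → ℝ) (e : Euc n) (t : ℝ) : Prop :=
  ∀ x ∈ half e t, u x ≤ u (refl e t x) ∧ v x ≤ v (refl e t x)

/-- The subset of the half space where domination by the reflection fails. -/
def badSet (u v : Euc n → ℝ) (e : Euc n) (t : ℝ) : Set (Euc n) :=
  half e t ∩ {x | u (refl e t x) < u x ∨ v (refl e t x) < v x}

namespace IsDecayingSolution

variable {p c₁ c₂ : ℝ} {u v : EuclideanSpace ℝ (Fin n) → ℝ} {e : Euc n}

lemma measurableSet_badSet (h : IsDecayingSolution n p c₁ c₂ u v) (e : Euc n) (t : ℝ) :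
    MeasurableSet (badSet u v e t) := by
  have h1 := h.continuous_left
  have h2 := h.continuous_right
  refine (measurableSet_half e t).inter (IsOpen.measurableSet ?_)
  exact (isOpen_lt (h1.comp (continuous_refl e t)) h1).union
    (isOpen_lt (h2.comp (continuous_refl e t)) h2)

lemma integrable_left (h : IsDecayingSolution n p c₁ c₂ u v) (x : Euc n) :
    Integrable (fun y => u y ^ (p - 1) * v y / ‖x - y‖ ^ (n - 2)) :=
  (IsPositiveSolution.integrable_and_ofReal_eq (by have := h.three_le; omega)
    (fun y => (h.sol.left_source_pos y).le) h.left_const_pos (h.sol.u_pos x) (h.sol.u_eq x)).1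

lemma integrable_right (h : IsDecayingSolution n p c₁ c₂ u v) (x : Euc n) :
    Integrable (fun y => u y ^ p / ‖x - y‖ ^ (n - 2)) :=
  (IsPositiveSolution.integrable_and_ofReal_eq (by have := h.three_le; omega)
    (fun y => (h.sol.right_source_pos y).le) h.right_const_pos (h.sol.v_pos x) (h.sol.v_eq x)).1

/-- The narrow region principle. -/
lemma eventually_dominated (h : IsDecayingSolution n p c₁ c₂ u v) (he : ‖e‖ = 1) {l : Filter ℝ}
    [l.IsCountablyGenerated] (hl : ∀ᵐ y, ∀ᶠ t in l, y ∉ badSet u v e t) :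
    ∀ᶠ t in l, Dominated u v e t := by
  obtain ⟨a, b, ha, han, hb, hVa, hVb⟩ := h.integrability
  obtain ⟨C, hC0, hC⟩ := h.comparable
  obtain ⟨M, hM⟩ := h.bounded
  obtain ⟨C', hC', hpot⟩ := exists_pot_le_lpn_add_lpn h.three_le ha han hb
  have hn3 : (3 : ℝ) ≤ n := by exact_mod_cast h.three_le
  have hp := h.one_lt
  have hc₁ := h.left_const_pos
  have hc₂ := h.right_const_pos
  have hum := h.continuous_left.measurable
  have hu0 := h.sol.u_pos
  have hv0 := h.sol.v_pos
  set V : Euc n → ℝ≥0∞ := fun x => ENNReal.ofReal (u x ^ (p - 1)) with hV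
  have hVm : Measurable V := by fun_prop
  set K₁ : ℝ := max 1 (p - 1) * C + 1 with hK₁
  -- The source u^p is the case b = a, C = 1 of the Lipschitz estimate; both positive parts then
  -- come from u, whence the factor 2.
  set K₂ : ℝ := 2 * (max 1 (p - 1) * 1 + 1) with hK₂
  have hm1 : 0 < max 1 (p - 1) := lt_of_lt_of_le one_pos (le_max_left _ _)
  have hK₁0 : 0 < K₁ := by positivity
  have hK₂0 : 0 < K₂ := by positivity
  have hbm := h.measurableSet_badSet e
  have htend : Tendsto (fun t => ENNReal.ofReal (c₁ * K₁ + c₂ * K₂) * (C' *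
      (lpn a ((badSet u v e t).indicator V) + lpn b ((badSet u v e t).indicator V)))) l (𝓝 0) := by
    have h1 := (tendsto_lpn_indicator hbm hl (by linarith) hVm hVa).add
      (tendsto_lpn_indicator hbm hl (by linarith) hVm hVb)
    have h2 := ENNReal.Tendsto.const_mul (ENNReal.Tendsto.const_mul h1 (Or.inr hC'))
      (Or.inr (ENNReal.ofReal_ne_top (r := c₁ * K₁ + c₂ * K₂)))
    simpa using h2
  filter_upwards [htend.eventually (gt_mem_nhds (show (0 : ℝ≥0∞) < 2⁻¹ by simp))] with t ht
  -- The total excess over the reflection; on the half space it is supported in the bad set, so only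
  -- V restricted to that set enters.
  set φ : Euc n → ℝ := fun x => max (u x - u (refl e t x)) 0 + max (v x - v (refl e t x)) 0 with hφ
  have hφbad : ∀ x ∈ half e t, x ∉ badSet u v e t → φ x = 0 := by
    intro x hx hxb
    have h1 : u x ≤ u (refl e t x) ∧ v x ≤ v (refl e t x) := by
      simpa [badSet, hx, not_or] using hxb
    simp [hφ, h1.1, h1.2]
  set P : Euc n → ℝ≥0∞ := pot ((n : ℝ) - 2) ((badSet u v e t).indicator V) with hP
  have hindm : Measurable ((badSet u v e t).indicator V) := hVm.indicator (hbm t)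
  have hPle : ∀ x, ENNReal.ofReal (c₁ * K₁ + c₂ * K₂) * P x ≤ 2⁻¹ := by
    intro x
    refine le_trans ?_ ht.le
    gcongr
    exact hpot _ hindm x
  have hsource : ∀ (K m : ℝ), 0 ≤ K → 0 ≤ m → (∀ x ∈ half e t, φ x ≤ m) → ∀ f : Euc n → ℝ,
      (∀ y, f y - f (refl e t y) ≤ K * u y ^ (p - 1) * φ y) → ∀ y ∈ half e t,
      ENNReal.ofReal (f y - f (refl e t y)) ≤
        ENNReal.ofReal (K * m) * (badSet u v e t).indicator V y := by
    intro K m hK hm hφm f hf y hy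
    have hup : 0 < u y ^ (p - 1) := Real.rpow_pos_of_pos (hu0 y) _
    by_cases hyb : y ∈ badSet u v e t
    · rw [Set.indicator_of_mem hyb, hV, ← ENNReal.ofReal_mul (by positivity)]
      apply ENNReal.ofReal_le_ofReal
      calc _ ≤ K * u y ^ (p - 1) * φ y := hf y
        _ ≤ K * u y ^ (p - 1) * m := by gcongr; exact hφm y hy
        _ = _ := by ring
    · have h1 := hf y
      rw [hφbad y hy hyb, mul_zero] at h1
      rw [ENNReal.ofReal_of_nonpos h1]
      exact zero_le
  -- The source increments are at most K V m on the bad set and nonpositive elsewhere in the half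
  -- space. The potential of V over that set is so small that the resulting bound on φ is half of m.
  have hhalf : ∀ m : ℝ, 0 ≤ m → (∀ x ∈ half e t, φ x ≤ m) → ∀ x ∈ half e t, φ x ≤ m / 2 := by
    intro m hm hφm x hx
    have h1 := ofReal_sub_refl_le h.three_le he hc₁.le h.integrable_left h.sol.u_eq
      (hindm.const_mul (ENNReal.ofReal (K₁ * m)))
      (hsource K₁ m hK₁0.le hm hφm (fun y => u y ^ (p - 1) * v y) fun y =>
        rpow_mul_sub_rpow_mul_le hp hC0 (hu0 _) (hu0 _) (hv0 _) (hC y)) hx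
    have h2 := ofReal_sub_refl_le h.three_le he hc₂.le h.integrable_right h.sol.v_eq
      (hindm.const_mul (ENNReal.ofReal (K₂ * m)))
      (hsource K₂ m hK₂0.le hm hφm (fun y => u y ^ p) fun y => by
        have h3 := rpow_mul_sub_rpow_mul_le hp zero_le_one (hu0 y) (hu0 (refl e t y))
          (hu0 (refl e t y)) (b := u y) (by linarith)
        rw [← Real.rpow_add_one (hu0 _).ne', ← Real.rpow_add_one (hu0 _).ne',
          sub_add_cancel] at h3
        refine h3.trans ?_
        have h4 : max (u y - u (refl e t y)) 0 ≤ φ y := le_add_of_nonneg_right (le_max_right _ _)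
        have h5 : 0 < u y ^ (p - 1) := Real.rpow_pos_of_pos (hu0 y) _
        calc _ ≤ (max 1 (p - 1) * 1 + 1) * u y ^ (p - 1) * (φ y + φ y) := by gcongr
          _ = _ := by rw [hK₂]; ring) hx
    rw [pot_const_mul _ hindm] at h1 h2
    rw [← ENNReal.ofReal_le_ofReal_iff (by positivity),
      ENNReal.ofReal_add (le_max_right _ _) (le_max_right _ _), ENNReal.ofReal_max,
      ENNReal.ofReal_max, ENNReal.ofReal_zero, max_eq_left zero_le, max_eq_left zero_le]
    calc _ ≤ _ := add_le_add h1 h2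
      _ = ENNReal.ofReal m * (ENNReal.ofReal (c₁ * K₁ + c₂ * K₂) * P x) := by
          rw [ENNReal.ofReal_mul hK₁0.le, ENNReal.ofReal_mul hK₂0.le,
            ENNReal.ofReal_add (mul_pos hc₁ hK₁0).le (mul_pos hc₂ hK₂0).le, ENNReal.ofReal_mul hc₁.le,
            ENNReal.ofReal_mul hc₂.le]
          ring
      _ ≤ ENNReal.ofReal m * 2⁻¹ := by gcongr; exact hPle x
      _ = _ := by
          rw [ENNReal.ofReal_div_of_pos two_pos, div_eq_mul_inv]; simp
  have hM0 : 0 ≤ M := (hu0 0).le.trans (hM 0).1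
  have hiter : ∀ k : ℕ, ∀ x ∈ half e t, φ x ≤ 2 * M * (1 / 2) ^ k := by
    intro k
    induction k with
    | zero =>
      intro x _
      have h1 : max (u x - u (refl e t x)) 0 ≤ M :=
        max_le (by linarith [(hM x).1, hu0 (refl e t x)]) hM0
      have h2 : max (v x - v (refl e t x)) 0 ≤ M :=
        max_le (by linarith [(hM x).2, hv0 (refl e t x)]) hM0
      simp only [hφ]; linarith
    | succ k ih =>
      intro x hx
      refine (hhalf _ (by positivity) ih x hx).trans_eq ?_
      rw [pow_succ]; ring
  intro x hx
  have hle : φ x ≤ 0 := by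
    have h1 : Tendsto (fun k : ℕ => 2 * M * (1 / 2 : ℝ) ^ k) atTop (𝓝 (2 * M * 0)) :=
      (tendsto_pow_atTop_nhds_zero_of_lt_one (by norm_num) (by norm_num)).const_mul _
    rw [mul_zero] at h1
    exact ge_of_tendsto' h1 fun k => hiter k x hx
  have h1 := le_max_left (u x - u (refl e t x)) 0
  have h2 := le_max_left (v x - v (refl e t x)) 0
  have h3 := le_max_right (u x - u (refl e t x)) 0
  have h4 := le_max_right (v x - v (refl e t x)) 0
  simp only [hφ] at hle
  constructor <;> linarith

/-- Each fixed point eventually leaves the half space, so the bad sets eventually avoid it; this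
starts the moving plane. -/
lemma eventually_dominated_atTop (h : IsDecayingSolution n p c₁ c₂ u v) (he : ‖e‖ = 1) :
    ∀ᶠ t in atTop, Dominated u v e t := by
  refine h.eventually_dominated he (Eventually.of_forall fun y => ?_)
  filter_upwards [eventually_gt_atTop (inner ℝ e y)] with t ht hy
  exact lt_asymm ht hy.1

/-- Strict domination or equality. -/
lemma lt_or_eq_refl (h : IsDecayingSolution n p c₁ c₂ u v) (he : ‖e‖ = 1) {t : ℝ}
    (hd : Dominated u v e t) :
    (∀ x ∈ half e t, u x < u (refl e t x) ∧ v x < v (refl e t x)) ∨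
    (∀ x ∈ half e t, u x = u (refl e t x) ∧ v x = v (refl e t x)) := by
  have hp1 : 0 < p - 1 := by linarith [h.one_lt]
  have hp0 : 0 < p := by linarith [h.one_lt]
  have hu0 := h.sol.u_pos
  have hv0 := h.sol.v_pos
  have hcu := h.continuous_left
  have hcv := h.continuous_right
  have hf : ∀ y ∈ half e t, u y ^ (p - 1) * v y ≤
      u (refl e t y) ^ (p - 1) * v (refl e t y) := by
    intro y hy
    have := (hu0 y).le
    have := (hv0 y).le
    have := (hu0 (refl e t y)).le
    gcongr
    · exact (hd y hy).1
    · exact (hd y hy).2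
  have hg : ∀ y ∈ half e t, u y ^ p ≤ u (refl e t y) ^ p := by
    intro y hy
    have := (hu0 y).le
    gcongr
    exact (hd y hy).1
  have hfc : Continuous fun y => u y ^ (p - 1) * v y :=
    (hcu.rpow_const fun x => Or.inl (hu0 x).ne').mul hcv
  have hgc : Continuous fun y => u y ^ p := hcu.rpow_const fun x => Or.inl (hu0 x).ne'
  have key : ∀ x ∈ half e t, u x = u (refl e t x) →
      ∀ y ∈ half e t, u y = u (refl e t y) ∧ v y = v (refl e t y) := by
    intro x hx hxe y hy
    have heq := eq_refl_of_eq_refl h.three_le he h.left_const_pos hfc h.integrable_left h.sol.u_eq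
      hf hx hxe y hy
    obtain ⟨h1, h2⟩ := hd y hy
    have h3 : u y ^ (p - 1) ≤ u (refl e t y) ^ (p - 1) := by
      have := (hu0 y).le
      gcongr
    have h4 : 0 < u y ^ (p - 1) := Real.rpow_pos_of_pos (hu0 y) _
    -- Each factor of the source is at most its reflected value, so equality of the positive
    -- products forces equality of both factors.
    have h5 : u y ^ (p - 1) = u (refl e t y) ^ (p - 1) := by
      by_contra hne
      have h6 := lt_of_le_of_ne h3 hne
      nlinarith [hv0 y]
    rw [h5] at heq h4
    exact ⟨(Real.rpow_left_inj (hu0 _).le (hu0 _).le hp1.ne').1 h5, mul_left_cancel₀ h4.ne' heq⟩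
  by_cases hcase : ∃ x ∈ half e t, u x = u (refl e t x) ∨ v x = v (refl e t x)
  · right
    obtain ⟨x, hx, hxe | hxe⟩ := hcase
    · exact key x hx hxe
    · have heq := eq_refl_of_eq_refl h.three_le he h.right_const_pos hgc h.integrable_right
        h.sol.v_eq hg hx hxe x hx
      exact key x hx ((Real.rpow_left_inj (hu0 _).le (hu0 _).le hp0.ne').1 heq)
  · left
    push Not at hcase
    intro x hx
    exact ⟨lt_of_le_of_ne (hd x hx).1 (hcase x hx).1, lt_of_le_of_ne (hd x hx).2 (hcase x hx).2⟩

lemma dominated_of_forall_gt (h : IsDecayingSolution n p c₁ c₂ u v) {t₀ : ℝ}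
    (hd : ∀ t, t₀ < t → Dominated u v e t) : Dominated u v e t₀ := by
  intro x hx
  have hx : t₀ < inner ℝ e x := hx
  have hev : ∀ᶠ t in 𝓝[>] t₀, u x ≤ u (refl e t x) ∧ v x ≤ v (refl e t x) := by
    filter_upwards [self_mem_nhdsWithin, mem_nhdsWithin_of_mem_nhds (gt_mem_nhds hx)] with t ht htx
    exact hd t ht x htx
  have hu : Tendsto (fun t => u (refl e t x)) (𝓝[>] t₀) (𝓝 (u (refl e t₀ x))) :=
    ((h.continuous_left.comp (continuous_refl_param e x)).tendsto t₀).mono_left nhdsWithin_le_nhds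
  have hv : Tendsto (fun t => v (refl e t x)) (𝓝[>] t₀) (𝓝 (v (refl e t₀ x))) :=
    ((h.continuous_right.comp (continuous_refl_param e x)).tendsto t₀).mono_left nhdsWithin_le_nhds
  exact ⟨ge_of_tendsto hu (hev.mono fun t ht => ht.1), ge_of_tendsto hv (hev.mono fun t ht => ht.2)⟩

lemma tendsto_norm_smul_cocompact {l : Filter ℝ} {g : ℝ → ℝ} (he : ‖e‖ = 1)
    (hg : Tendsto (fun t => |g t|) l atTop) :
    Tendsto (fun t => g t • e) l (cocompact (Euc n)) := by
  rw [← Metric.cobounded_eq_cocompact, ← tendsto_norm_atTop_iff_cobounded]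
  simpa [norm_smul, he] using hg

/-- In every direction there is a hyperplane of symmetry, with domination beyond it. -/
lemma exists_symmetric (h : IsDecayingSolution n p c₁ c₂ u v) (he : ‖e‖ = 1) :
    ∃ t₀ : ℝ, (∀ t, t₀ < t → Dominated u v e t) ∧
      ∀ x, u (refl e t₀ x) = u x ∧ v (refl e t₀ x) = v x := by
  set S : Set ℝ := {t | ∀ s, t ≤ s → Dominated u v e s} with hS
  have hne : S.Nonempty := by
    obtain ⟨T, hT⟩ := (eventually_atTop.1 (h.eventually_dominated_atTop he))
    exact ⟨T, hT⟩
  -- For t < 0 the origin lies beyond the plane and reflects to 2t e. Since u decays, u(2t e) falls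
  -- below u(0) for very negative t and domination fails; the bound -1 in the minimum ensures t < 0.
  have hbdd : BddBelow S := by
    have hlim : Tendsto (fun t : ℝ => u ((2 * t) • e)) atBot (𝓝 0) := by
      refine h.tendsto_left.comp (tendsto_norm_smul_cocompact he ?_)
      exact tendsto_abs_atBot_atTop.comp (tendsto_id.const_mul_atBot two_pos)
    obtain ⟨T, hT⟩ := eventually_atBot.1 (hlim.eventually (gt_mem_nhds (h.sol.u_pos 0)))
    refine ⟨min T (-1), fun t ht => ?_⟩
    by_contra hcon
    rw [not_le] at hcon
    have h0 : (0 : Euc n) ∈ half e t := by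
      have := hcon.trans_le (min_le_right _ _)
      simp only [half, Set.mem_ofPred_eq, inner_zero_right]; linarith
    have h1 := (ht t le_rfl 0 h0).1
    have h2 := hT t (hcon.le.trans (min_le_left _ _))
    simp only [refl, inner_zero_right, sub_zero, zero_add] at h1
    linarith
  set t₀ := sInf S with ht₀
  have hgt : ∀ t, t₀ < t → Dominated u v e t := by
    intro t ht
    obtain ⟨s, hs, hst⟩ := exists_lt_of_csInf_lt hne ht
    exact hs t hst.le
  refine ⟨t₀, hgt, ?_⟩
  have hd := h.dominated_of_forall_gt hgt
  have heq : ∀ x ∈ half e t₀, u x = u (refl e t₀ x) ∧ v x = v (refl e t₀ x) := by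
    -- If domination at t₀ were strict, then for t just below t₀ the bad set would avoid any given
    -- point off the limiting hyperplane. Domination would then persist below the infimum t₀.
    refine (h.lt_or_eq_refl he hd).resolve_left fun hlt => ?_
    have hev : ∀ᶠ t in 𝓝[<] t₀, Dominated u v e t := by
      refine h.eventually_dominated he ?_
      filter_upwards [ae_inner_ne he t₀] with y hy
      rcases lt_or_gt_of_ne hy with hy | hy
      · filter_upwards [mem_nhdsWithin_of_mem_nhds (lt_mem_nhds hy)] with t ht hmem
        exact lt_asymm ht hmem.1
      · obtain ⟨h1, h2⟩ := hlt y hy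
        have hu := ((h.continuous_left.comp (continuous_refl_param e y)).tendsto t₀).eventually
          (lt_mem_nhds h1)
        have hv := ((h.continuous_right.comp (continuous_refl_param e y)).tendsto t₀).eventually
          (lt_mem_nhds h2)
        filter_upwards [mem_nhdsWithin_of_mem_nhds hu, mem_nhdsWithin_of_mem_nhds hv]
          with t ht1 ht2 hmem
        rcases hmem.2 with h3 | h3
        · exact lt_asymm ht1 h3
        · exact lt_asymm ht2 h3
    obtain ⟨r, hr, hrS⟩ := mem_nhdsLT_iff_exists_Ioo_subset.1 hev
    have hr : r < t₀ := hr
    have hmem : (r + t₀) / 2 ∈ S := by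
      intro s hs
      rcases lt_trichotomy s t₀ with h1 | h1 | h1
      · exact hrS ⟨by linarith, h1⟩
      · rw [h1]; exact hd
      · exact hgt s h1
    have := csInf_le hbdd hmem
    linarith
  intro x
  rcases lt_trichotomy (inner ℝ e x) t₀ with hx | hx | hx
  · have hmem : refl e t₀ x ∈ half e t₀ := by
      simp only [half, Set.mem_ofPred_eq, inner_refl he]; linarith
    have := heq _ hmem
    rwa [refl_refl he] at this
  · rw [refl_of_inner_eq hx]; exact ⟨rfl, rfl⟩
  · exact ⟨(heq x hx).1.symm, (heq x hx).2.symm⟩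

/-- Beyond the hyperplane of symmetry the domination is strict. -/
lemma lt_refl_of_lt (h : IsDecayingSolution n p c₁ c₂ u v) (he : ‖e‖ = 1) {t₀ t : ℝ}
    (hd : Dominated u v e t) (hsym : ∀ x, u (refl e t₀ x) = u x) (ht : t₀ < t) {x : Euc n}
    (hx : x ∈ half e t) : u x < u (refl e t x) ∧ v x < v (refl e t x) := by
  refine (h.lt_or_eq_refl he hd).resolve_right (fun heq => ?_) x hx
  have hsym' : ∀ x, u (refl e t x) = u x := by
    intro x
    rcases lt_trichotomy (inner ℝ e x) t with hx | hx | hx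
    · have hmem : refl e t x ∈ half e t := by
        simp only [half, Set.mem_ofPred_eq, inner_refl he]; linarith
      have := (heq _ hmem).1
      rwa [refl_refl he] at this
    · rw [refl_of_inner_eq hx]
    · exact (heq x hx).1.symm
  -- Symmetry about two parallel hyperplanes makes u periodic along e, which is impossible for a
  -- positive function vanishing at infinity.
  have hper : ∀ x, u (x + (2 * (t - t₀)) • e) = u x := by
    intro x
    have h1 : x + (2 * (t - t₀)) • e = refl e t (refl e t₀ x) := by
      have h2 := inner_refl he t₀ x
      rw [refl, h2, refl, add_assoc, ← add_smul]
      ring_nf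
    rw [h1, hsym', hsym]
  have hper' : ∀ k : ℕ, u (((k : ℝ) * (2 * (t - t₀))) • e) = u 0 := by
    intro k
    induction k with
    | zero => simp
    | succ k ih =>
      rw [← ih, ← hper (((k : ℝ) * (2 * (t - t₀))) • e), ← add_smul]
      push_cast; ring_nf
  have hlim : Tendsto (fun s : ℝ => u ((s * (2 * (t - t₀))) • e)) atTop (𝓝 0) := by
    refine h.tendsto_left.comp (tendsto_norm_smul_cocompact he ?_)
    exact tendsto_abs_atTop_atTop.comp (tendsto_id.atTop_mul_const (by linarith))
  have hlim' := hlim.comp (tendsto_natCast_atTop_atTop (R := ℝ))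
  have hconst : Tendsto (fun _ : ℕ => u 0) atTop (𝓝 0) :=
    hlim'.congr fun k => hper' k
  have := tendsto_nhds_unique hconst tendsto_const_nhds
  exact (h.sol.u_pos 0).ne this

/-- Radial symmetry and monotonicity. -/
theorem exists_isRadialDecreasingAbout (h : IsDecayingSolution n p c₁ c₂ u v) :
    ∃ a, IsRadialDecreasingAbout u a ∧ IsRadialDecreasingAbout v a := by
  obtain ⟨a, ha⟩ := h.continuous_left.exists_forall_ge' 0
    (h.tendsto_left.eventually (ge_mem_nhds (h.sol.u_pos 0)))
  have hplane : ∀ e : Euc n, ‖e‖ = 1 →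
      (∀ t, inner ℝ e a < t → ∀ x ∈ half e t, u x < u (refl e t x) ∧ v x < v (refl e t x)) ∧
      ∀ x, u (refl e (inner ℝ e a) x) = u x ∧ v (refl e (inner ℝ e a) x) = v x := by
    intro e he
    obtain ⟨t₀, hd, hsym⟩ := h.exists_symmetric he
    have hlt : ∀ t, t₀ < t → ∀ x ∈ half e t, u x < u (refl e t x) ∧ v x < v (refl e t x) :=
      fun t ht x hx => h.lt_refl_of_lt he (hd t ht) (fun x => (hsym x).1) ht hx
    -- Strict domination beyond t₀ keeps every maximum point out of that region. Both a and its
    -- mirror image are maximum points, so a lies on the hyperplane of symmetry.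
    have hmax : ∀ b, u b = u a → inner ℝ e b ≤ t₀ := by
      intro b hb
      by_contra hcon
      rw [not_le] at hcon
      have h1 := (hlt ((inner ℝ e b + t₀) / 2) (by linarith) b (by
        simp only [half, Set.mem_ofPred_eq]; linarith)).1
      rw [hb] at h1
      exact (ha _).not_gt h1
    have h1 := hmax a rfl
    have h2 := hmax (refl e t₀ a) (hsym a).1
    rw [inner_refl he] at h2
    have h3 : inner ℝ e a = t₀ := by linarith
    rw [h3]
    exact ⟨hlt, hsym⟩
  -- The hyperplane is the perpendicular bisector of x and y, oriented towards y. The identity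
  -- locates it relative to a: it passes through a when x and y are equidistant from a, and lies
  -- strictly beyond a when x is nearer.
  have hbis : ∀ x y : Euc n, x ≠ y → ∃ e : Euc n, ‖e‖ = 1 ∧ ∃ t : ℝ, refl e t y = x ∧ y ∈ half e t ∧
      2 * ‖y - x‖ * (t - inner ℝ e a) = ‖y - a‖ ^ 2 - ‖x - a‖ ^ 2 := by
    intro x y hxy
    have hpos : 0 < ‖y - x‖ := norm_pos_iff.2 (sub_ne_zero.2 (Ne.symm hxy))
    set e : Euc n := ‖y - x‖⁻¹ • (y - x) with he
    have hye : y - x = ‖y - x‖ • e := by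
      rw [he, smul_smul, mul_inv_cancel₀ hpos.ne', one_smul]
    have hnorm : ‖e‖ = 1 := by
      rw [he, norm_smul, norm_inv, norm_norm, inv_mul_cancel₀ hpos.ne']
    have hyx : inner ℝ e y = inner ℝ e x + ‖y - x‖ := by
      have h1 : inner ℝ e (y - x) = ‖y - x‖ := by
        nth_rewrite 1 [hye]
        rw [inner_smul_right, real_inner_self_eq_norm_sq, hnorm]; ring
      rw [inner_sub_right] at h1; linarith
    refine ⟨e, hnorm, (inner ℝ e x + inner ℝ e y) / 2, ?_, ?_, ?_⟩
    · have h1 : 2 * ((inner ℝ e x + inner ℝ e y) / 2 - inner ℝ e y) = -‖y - x‖ := by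
        rw [hyx]; ring
      rw [refl, h1, neg_smul, ← hye]; abel
    · simp only [half, Set.mem_ofPred_eq]; linarith
    · have h1 : y - a = (x - a) + ‖y - x‖ • e := by rw [← hye]; abel
      have h2 : ‖y - a‖ ^ 2 = ‖x - a‖ ^ 2 + 2 * (‖y - x‖ * (inner ℝ e x - inner ℝ e a)) +
          ‖y - x‖ ^ 2 := by
        nth_rewrite 1 [h1]
        rw [norm_add_sq_real, inner_smul_right, real_inner_comm, inner_sub_right, norm_smul, hnorm,
          norm_norm, mul_one]
      rw [h2, hyx]; ring
  have heq : ∀ x y, ‖x - a‖ = ‖y - a‖ → u x = u y ∧ v x = v y := by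
    intro x y hxy
    by_cases hne : x = y
    · rw [hne]; exact ⟨rfl, rfl⟩
    obtain ⟨e, he, t, hr, -, ht⟩ := hbis x y hne
    rw [hxy, sub_self] at ht
    have hpos : 0 < ‖y - x‖ := norm_pos_iff.2 (sub_ne_zero.2 (Ne.symm hne))
    have h1 : t = inner ℝ e a := by
      have := (mul_eq_zero.1 ht).resolve_left (by positivity)
      linarith
    rw [← hr, h1]
    exact (hplane e he).2 y
  have hlt : ∀ x y, ‖x - a‖ < ‖y - a‖ → u y < u x ∧ v y < v x := by
    intro x y hxy
    have hne : x ≠ y := by rintro rfl; exact lt_irrefl _ hxy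
    obtain ⟨e, he, t, hr, hy, ht⟩ := hbis x y hne
    have hpos : 0 < ‖y - x‖ := norm_pos_iff.2 (sub_ne_zero.2 (Ne.symm hne))
    have h1 : inner ℝ e a < t := by
      have h2 : 0 < ‖y - a‖ ^ 2 - ‖x - a‖ ^ 2 := by
        have := pow_lt_pow_left₀ hxy (norm_nonneg _) two_ne_zero
        linarith
      rw [← ht] at h2
      have := pos_of_mul_pos_right h2 (by positivity)
      linarith
    have := (hplane e he).1 t h1 y hy
    rwa [hr] at this
  exact ⟨a, ⟨fun x y hxy => (heq x y hxy).1, fun x y hxy => (hlt x y hxy).1⟩,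
    fun x y hxy => (heq x y hxy).2, fun x y hxy => (hlt x y hxy).2⟩

end IsDecayingSolution

end MovingPlane

/-! ### Assembly of the conclusions -/

namespace IsPositiveSolution

open RieszPotential

variable {n : ℕ} {p c₁ c₂ : ℝ} {u v : EuclideanSpace ℝ (Fin n) → ℝ}

lemma exists_le (h : IsPositiveSolution n p c₁ c₂ u v) (hn : 3 ≤ n) (hp : 1 < p)
    (hc₁ : 0 < c₁) (hc₂ : 0 < c₂)
    (hu : MemLp u (ENNReal.ofReal ((n : ℝ) * (p - 1) / 2)) volume) :
    ∃ M : ℝ, ∀ x, u x ≤ M ∧ v x ≤ M := by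
  have hn3 : (3 : ℝ) ≤ n := by exact_mod_cast hn
  obtain ⟨C, hC0, hC⟩ := h.exists_add_le hn hp hc₁ hc₂ hu
  refine ⟨C, fun x => ?_⟩
  have h1 : C * (1 + ‖x‖) ^ (-((n : ℝ) - 2)) ≤ C :=
    mul_le_of_le_one_right hC0
      (Real.rpow_le_one_of_one_le_of_nonpos (by simp) (by linarith))
  have := hC x
  have := h.u_pos x
  have := h.v_pos x
  constructor <;> linarith

lemma tendsto_zero (h : IsPositiveSolution n p c₁ c₂ u v) (hn : 3 ≤ n) (hp : 1 < p)
    (hc₁ : 0 < c₁) (hc₂ : 0 < c₂)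
    (hu : MemLp u (ENNReal.ofReal ((n : ℝ) * (p - 1) / 2)) volume) :
    Tendsto u (cocompact (EuclideanSpace ℝ (Fin n))) (𝓝 0) ∧
      Tendsto v (cocompact (EuclideanSpace ℝ (Fin n))) (𝓝 0) := by
  obtain ⟨C, -, hC⟩ := h.exists_add_le hn hp hc₁ hc₂ hu
  exact ⟨tendsto_of_le hn h.u_pos fun x => by have := hC x; have := h.v_pos x; linarith,
    tendsto_of_le hn h.v_pos fun x => by have := hC x; have := h.u_pos x; linarith⟩

lemma isDecayingSolution (h : IsPositiveSolution n p c₁ c₂ u v) (hn : 3 ≤ n) (hp : 1 < p)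
    (hc₁ : 0 < c₁) (hc₂ : 0 < c₂)
    (hu : MemLp u (ENNReal.ofReal ((n : ℝ) * (p - 1) / 2)) volume) :
    MovingPlane.IsDecayingSolution n p c₁ c₂ u v := by
  have hn3 : (3 : ℝ) ≤ n := by exact_mod_cast hn
  have hp1 : 0 < p - 1 := by linarith
  have hn2 : (0 : ℝ) < n - 2 := by linarith
  have hpn := h.critical_exponent_lt hn hp hc₁ hu
  have hum := h.measurable_left hu.1
  have hlpn : ∀ s : ℝ, 0 < s → n / (n - 2) < (p - 1) * s →
      lpn s (fun x => ENNReal.ofReal (u x ^ (p - 1))) < ∞ := by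
    intro s hs0 hs
    simp_rw [← ENNReal.ofReal_rpow_of_pos (h.u_pos _)]
    refine lpn_rpow_lt_top hs0 hp1 ?_
    rw [← memLp_iff_lpn_lt_top hum (fun x => (h.u_pos x).le) (by positivity)]
    exact (h.memLp_of_lt hn hp hc₁ hc₂ hu hs).1
  obtain ⟨hcu, hcv⟩ := h.continuous_left_right hn hp hc₁ hc₂ hu
  -- A Lebesgue exponent for u^(p-1) below n/2 exists because n(p-1)/2 strictly exceeds n/(n-2); the
  -- one above n/2 is taken to be n.
  obtain ⟨a, ha1, ha2⟩ := exists_between (a₁ := max 1 (n / (n - 2) / (p - 1)))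
    (a₂ := (n : ℝ) / 2) (max_lt (by linarith) (by rw [div_lt_iff₀ hp1]; linarith))
  have ha : n / (n - 2) < (p - 1) * a := by
    have := (le_max_right _ _).trans_lt ha1
    rwa [div_lt_iff₀ hp1, mul_comm] at this
  have ha3 : 1 < a := (le_max_left _ _).trans_lt ha1
  refine ⟨hn, hp, hc₁, hc₂, h, hcu, hcv, (h.tendsto_zero hn hp hc₁ hc₂ hu).1,
    h.exists_le hn hp hc₁ hc₂ hu, h.exists_right_le_mul_left hn hp hc₁ hc₂ hu, a, n, ha3, ha2,
    by linarith, hlpn a (by linarith) ha, hlpn n (by linarith) (ha.trans ?_)⟩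
  gcongr
  linarith

end IsPositiveSolution

theorem theorem3p1 (n : ℕ) (hn : 3 ≤ n) (p c₁ c₂ : ℝ) (hp : 1 < p) (hc₁ : 0 < c₁) (hc₂ : 0 < c₂)
    (u v : EuclideanSpace ℝ (Fin n) → ℝ)
    (huv : IsPositiveSolution n p c₁ c₂ u v)
    (hu : MemLp u (ENNReal.ofReal ((n : ℝ) * (p - 1) / 2)) volume) :
    ((∀ s : ℝ, (n : ℝ) / ((n : ℝ) - 2) < s →
        MemLp u (ENNReal.ofReal s) volume ∧ MemLp v (ENNReal.ofReal s) volume) ∧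
      (∀ s : ℝ, 0 < s → s ≤ (n : ℝ) / ((n : ℝ) - 2) →
        ¬ MemLp u (ENNReal.ofReal s) volume ∧ ¬ MemLp v (ENNReal.ofReal s) volume)) ∧
    ((∃ M : ℝ, ∀ x, |u x| ≤ M ∧ |v x| ≤ M) ∧
      Tendsto u (cocompact (EuclideanSpace ℝ (Fin n))) (𝓝 0) ∧
      Tendsto v (cocompact (EuclideanSpace ℝ (Fin n))) (𝓝 0)) ∧
    (∃ a : EuclideanSpace ℝ (Fin n),
      IsRadialDecreasingAbout u a ∧ IsRadialDecreasingAbout v a) := by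

  have hd := huv.isDecayingSolution hn hp hc₁ hc₂ hu
  refine ⟨⟨fun s hs => huv.memLp_of_lt hn hp hc₁ hc₂ hu hs,
    fun s hs0 hs => huv.not_memLp_of_le hn hc₁ hc₂ hu.1 hs0 hs⟩,
    ⟨?_, huv.tendsto_zero hn hp hc₁ hc₂ hu⟩, hd.exists_isRadialDecreasingAbout⟩
  obtain ⟨M, hM⟩ := hd.bounded
  refine ⟨M, fun x => ?_⟩
  rw [abs_of_pos (huv.u_pos x), abs_of_pos (huv.v_pos x)]
  exact hM x
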